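/- **Lattice.** A honeycomb patch has $L_y\times L_x$ unit cells, $L_x,L_y\ge 1$. A cell consists of an upper vertex (shape Y) and below it a lower vertex (shape $\lambda$), joined by a vertical edge; its top-left, top-right, bottom-right, bottom-left edges lead to its north, east, south, west neighbours, so that the cells form a square lattice. The patch has a smooth boundary: each edge leaving it ends in an additional trivalent vertex, which belongs to the adjacent cell, and consecutive such vertices are joined by rim edges. Every plaquette, also at the boundary, is filled. A state is a function of the string types on all edges. Its *doubled* form has two copies of each edge label, one at each end ($|i\rangle\mapsto|ii\rangle$), so that every cell has three physical indices per vertex. **isoTNS.** A state on an $L_y\times L_x$ array of cells is an *isoTNS of bond dimension at most $\chi$* if for every row $r_0$ and every column $c_0$ it equals exactly the contraction of a square-lattice tensor network (PEPS, open boundary, all bonds of dimension at most $\chi$) such that, regarded as a map between its outgoing legs and its physical index with its incoming legs, every tensor except the one at $(r_0,c_0)$ is an isometry: $\sum_{\rm phys,\,in}\overline{T_{{\rm out}'}}\,T_{\rm out}=\delta_{{\rm out},{\rm out}'}$. Here a tensor off the row $r_0$ and the column $c_0$ (the orthogonality hypersurface) has two outgoing legs, pointing towards the row and towards the column, and a tensor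 on the hypersurface other than $(r_0,c_0)$ has one, pointing towards $(r_0,c_0)$. **Levin–Wen models.** The string types are $0,\dots,N$, with a duality $i\mapsto i^*$ ($i^{**}=i$, $0^*=0$) and branching rules $\delta_{ijk}\in\{0,1\}$ that are invariant under permutations and under dualizing all three strings, and satisfy $\delta_{ij0}=1\iff j=i^*$ and $\sum_e\delta_{abe^*}\delta_{ecd}=\sum_f\delta_{afd}\delta_{bcf^*}$. There are numbers $F^{ijm}_{kln}\in\mathbb C$, vanishing unless $\delta_{ijm}\delta_{klm^*}\delta_{iln}\delta_{jkn^*}=1$, and $v_s\in\mathbb C$ with $v_s^2=\ell_s=1/F^{ss^*0}_{ss^*0}$, such that $$\sum_n F^{mlq}_{kp^*n}F^{jip}_{mns^*}F^{js^*n}_{lkr^*}=F^{jip}_{q^*kr^*}F^{riq^*}_{mls^*},\qquad F^{ijk}_{j^*i^*0}=\tfrac{v_k}{v_iv_j}\delta_{ijk},$$ $$F^{ijm}_{kln}=F^{jim}_{lkn^*}=F^{lkm^*}_{jin}=\tfrac{v_mv_n}{v_jv_l}F^{imj}_{k^*nl},\qquad F^{i^*j^*m^*}_{k^*l^*n^*}=\overline{F^{ijm}_{kln}}.$$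 With $d_s=|\ell_s|$ and $\mathcal D=\sum_s d_s^2$, the fixed-point ground state is $\prod_pB_p|0\rangle$, where $p$ runs over all plaquettes, $B_p=\sum_s\frac{\ell_s}{\mathcal D}B_p^s$, and $B_p^s$ adds a loop $s$ to $p$ and fuses it into the edges around $p$. Explicitly, the matrix element of $B^s_p$ is the product over the corners of $p$ of $F^{a\,y\,x}_{s^*x'y'}$, where, with strings oriented into the vertex, $a$ is the outer edge and $x$, $y$ are the edges by which the counterclockwise walk around $p$ enters and leaves the corner, before (unprimed) and after (primed); the other edges are unchanged. **Abelian models.** A Lin–Levin model is given by a finite abelian group $G$ of string types ($a^*=-a$; $a,b,c$ may meet iff $a+b+c=0$), phases $F(a,b,c)$, equal to $1$ if an argument is $0$, with $$F(a+b,c,e)F(a,b,c+e)=F(a,b,c)F(a,b+c,e)F(b,c,e),$$ and phases $d_a$ with $d_{a+b}=d_ad_b$. Its fixed-point ground state is $\prod_pB_p|0\rangle$ with $B_p=\frac1{|G|}\sum_sd_sB_p^s$, where $B_p^s$ fuses a counterclockwise loop $s$ into the edges around $p$ by means of the moves $F$. Explicitly, label all strings upwards, so that a Y splits $k=i+j$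 (top left $i$, top right $j$) and a $\lambda$ fuses $l$ (bottom left) and $m$ (bottom right) into $k=l+m$; north and east boundary vertices count as $\lambda$, south and west ones as Y. At a Y the loop contributes $F(i-s,s,j)^{-1}$, $F(s,i,j)$, $F(i,j-s,s)$ if $p$ is the top, left, right plaquette there; at a $\lambda$ it contributes $F(l-s,s,m)$, $F(s,l,m)^{-1}$, $F(l,m-s,s)^{-1}$ if $p$ is the bottom, left, right one. A rim edge on which the vertical direction has a maximum (at the topmost plaquette) or a minimum (at the lowest one), with counterclockwise label $x$, contributes $F(-x-s,s,x)$ or its inverse. More generally, an *abelian string-net tensor network* is given by branching rules as above for which for all $a,b$ there is exactly one $c$ with $\delta_{abc}=1$, by numbers $F^{ijm}_{kln}$ of modulus $1$ where the fusion constraints hold and $0$ elsewhere, and by arbitrary phases $\mathcal N$, which may depend on the vertex and on all labels at it. Its state is the sum over plaquette labels of the product over all vertices of $\mathcal N\,F^{i\alpha^*\beta}_{\gamma jk}$ (at a Y with top-left, bottom, top-right edges $i,k,j$ and left, top, right plaquettes $\alpha,\beta,\gamma$) and $\mathcal N\,\overline{F^{l\alpha^*\sigma}_{\gamma mk}}$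 (at a $\lambda$ with top, bottom-left, bottom-right edges $k,l,m$ and left, bottom, right plaquettes $\alpha,\sigma,\gamma$); edges are oriented into a Y and out of a $\lambda$, and the outside of the patch has label $0$. This is the form in which the tensor networks of the Levin–Wen and Lin–Levin abelian models can be written. **Theorem.** 1. For every Levin–Wen model: (a) there are full-rank "$A$-symbols" $A^{ijm}_{kln}$ with $F^{ijm}_{kln}=A^{ijm}_{kln}\delta_{ijm}\delta_{klm^*}$ and $\sum_n\overline{A^{ijm}_{kln}}A^{ijm'}_{kln}=\delta_{mm'}$ for all indices; (b) there is a $\chi$ such that for all $L_x,L_y$ the doubled fixed-point ground state is exactly an isoTNS of bond dimension at most $\chi$; (c) the fixed-point ground state, and so each of these networks, reproduces the string-net PEPS: up to a nonzero scalar it is the sum over plaquette labels of the product of the tensors $\sqrt{v_iv_j/v_k}\,F^{i\alpha^*\beta}_{\gamma jk}$ at upper vertices and $\sqrt{v_lv_m/v_k}\,\overline{F^{l\alpha^*\sigma}_{\gamma mk}}$ at lower vertices (labels as above) and the edge tensors, in which rim edges carry the labels of their plaquettes, the branching rule holds, and the third edge $i$ contributes $\sqrt{v_i}$; the leftmost and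 the rightmost plaquette contribute one more factor $v$. Here $\sqrt{v_iv_j/v_k}=\sqrt{v_i}\sqrt{v_j}/\sqrt{v_k}$ for any fixed choice of the roots $\sqrt{v_i}$. 2. For every Lin–Levin abelian model there is a $\chi$ such that for all $L_x,L_y$ the doubled fixed-point ground state is exactly an isoTNS of bond dimension at most $\chi$. 3. For all abelian branching rules and $F$ as above there is a $\chi$ such that for all $L_x,L_y$ and all phases $\mathcal N$ the doubled state of the abelian string-net tensor network is exactly an isoTNS of bond dimension at most $\chi$. -/

import Mathlib

open scoped BigOperators ComplexConjugate Matrix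

namespace StringNet

noncomputable section

/-! ### Isometric tensor networks on a square lattice with open boundary

The lattice has rows `0, …, m` and columns `0, …, n`; every lattice with at least one row and one
column is of this form. -/

/-- The four ancilla legs of a tensor. -/
inductive Leg
  | north | east | south | west
  deriving DecidableEq

instance : Fintype Leg :=
  ⟨{Leg.north, Leg.east, Leg.south, Leg.west}, fun g => by cases g <;> simp⟩

/-- Dimension of a leg at site `(r, c)`, when `hdim r b` is the dimension of the `b`-th bond of row
`r` (between the columns `b - 1` and `b`) and `vdim a c` that of the `a`-th bond of column `c`
(between the rows `a - 1` and `a`). -/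
def legDim {m n : ℕ} (hdim : Fin (m + 1) → Fin (n + 2) → ℕ) (vdim : Fin (m + 2) → Fin (n + 1) → ℕ)
    (r : Fin (m + 1)) (c : Fin (n + 1)) : Leg → ℕ
  | .north => vdim r.castSucc c
  | .east => hdim r c.succ
  | .south => vdim r.succ c
  | .west => hdim r c.castSucc

/-- A PEPS with physical index set `P r c` at the site `(r, c)`. The bonds that would leave the
lattice have dimension one, i.e. edge and corner tensors have fewer legs. -/
structure PEPS (m n : ℕ) (P : Fin (m + 1) → Fin (n + 1) → Type) where
  hdim : Fin (m + 1) → Fin (n + 2) → ℕ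
  vdim : Fin (m + 2) → Fin (n + 1) → ℕ
  hdim_first : ∀ r, hdim r 0 = 1
  hdim_last : ∀ r, hdim r (Fin.last _) = 1
  vdim_first : ∀ c, vdim 0 c = 1
  vdim_last : ∀ c, vdim (Fin.last _) c = 1
  tensor : ∀ r c, P r c → (∀ g : Leg, Fin (legDim hdim vdim r c g)) → ℂ

variable {m n : ℕ} {P : Fin (m + 1) → Fin (n + 1) → Type}

/-- The ancilla indices that a choice of bond indices assigns to the legs of the site `(r, c)`. -/
def PEPS.legIndex (net : PEPS m n P) (h : ∀ r b, Fin (net.hdim r b))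
    (v : ∀ a c, Fin (net.vdim a c)) (r : Fin (m + 1)) (c : Fin (n + 1)) :
    ∀ g : Leg, Fin (legDim net.hdim net.vdim r c g)
  | .north => v r.castSucc c
  | .east => h r c.succ
  | .south => v r.succ c
  | .west => h r c.castSucc

/-- The wavefunction of the network: contraction of all ancilla indices. -/
def PEPS.contract (net : PEPS m n P) (p : ∀ r c, P r c) : ℂ :=
  ∑ h : (∀ r b, Fin (net.hdim r b)), ∑ v : (∀ a c, Fin (net.vdim a c)),
    ∏ r, ∏ c, net.tensor r c (p r c) (net.legIndex h v r c)

/-- All bonds have dimension at most `χ`. -/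
def PEPS.BondDimLE (net : PEPS m n P) (χ : ℕ) : Prop :=
  (∀ r b, net.hdim r b ≤ χ) ∧ ∀ a c, net.vdim a c ≤ χ

/-- A tensor as a matrix: the rows are the physical index together with the incoming legs, the
columns are the outgoing legs. -/
def legMatrix {Q : Type} {dim : Leg → ℕ} (T : Q → (∀ g, Fin (dim g)) → ℂ) (out : Finset Leg) :
    Matrix (Q × (∀ g : {g // g ∉ out}, Fin (dim g))) (∀ g : {g // g ∈ out}, Fin (dim g)) ℂ :=
  fun x y => T x.1 fun g => if hg : g ∈ out then y ⟨g, hg⟩ else x.2 ⟨g, hg⟩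

/-- Contracting `T` with its complex conjugate over the physical index and the incoming legs gives
the identity on the outgoing legs. -/
def IsIsometric {Q : Type} [Fintype Q] {dim : Leg → ℕ} (T : Q → (∀ g, Fin (dim g)) → ℂ)
    (out : Finset Leg) : Prop :=
  (legMatrix T out)ᴴ * legMatrix T out = 1

/-- The outgoing legs at `(r, c)` when the orthogonality hypersurface consists of the row `r₀` and
the column `c₀`. Off the hypersurface there are two of them, pointing to the row and to the column;
on the hypersurface there is one, pointing to the orthogonality center `(r₀, c₀)`. -/
def outLegs (r₀ r : Fin (m + 1)) (c₀ c : Fin (n + 1)) : Finset Leg :=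
  (if r < r₀ then {Leg.south} else ∅) ∪ (if r₀ < r then {Leg.north} else ∅) ∪
    (if c < c₀ then {Leg.east} else ∅) ∪ (if c₀ < c then {Leg.west} else ∅)

/-- The network is in isometric form with orthogonality hypersurface the row `r₀` and the
column `c₀`, and orthogonality center `(r₀, c₀)`. -/
def PEPS.IsIsometricForm [∀ r c, Fintype (P r c)] (net : PEPS m n P)
    (r₀ : Fin (m + 1)) (c₀ : Fin (n + 1)) : Prop :=
  ∀ r c, (r, c) ≠ (r₀, c₀) → IsIsometric (net.tensor r c) (outLegs r₀ r c₀ c)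

/-- `Ψ` is exactly an isoTNS of bond dimension at most `χ`: for every choice of a row and a column
it is the contraction of a network in isometric form. -/
def IsIsoTNS [∀ r c, Fintype (P r c)] (χ : ℕ) (Ψ : (∀ r c, P r c) → ℂ) : Prop :=
  ∀ (r₀ : Fin (m + 1)) (c₀ : Fin (n + 1)), ∃ net : PEPS m n P,
    net.BondDimLE χ ∧ net.IsIsometricForm r₀ c₀ ∧ ∀ p, net.contract p = Ψ p

/-! ### The honeycomb lattice

The unit cell `(r, c)` consists of an upper vertex (shape `Y`, with edges to the top left, the
bottom and the top right) and, below it, a lower vertex (shape `λ`, with edges to the top, the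
bottom left and the bottom right), joined by a vertical edge. The edges to the top left, top right,
bottom right, bottom left lead to the north, east, south, west neighbours `(r - 1, c)`,
`(r, c + 1)`, `(r + 1, c)`, `(r, c - 1)`. The patch is closed along its boundary: an edge that
leaves the patch ends in an additional trivalent vertex, and consecutive ones of these are joined by
rim edges, so that the lattice is a trivalent planar graph. Its plaquettes are the grid points
`(a, b)`, where the left, top, bottom, right plaquettes at the cell `(r, c)` are `(r, c)`,
`(r, c + 1)`, `(r + 1, c)`, `(r + 1, c + 1)`. -/

/-- Plaquettes (not counting the region outside). -/
abbrev Face (m n : ℕ) := Fin (m + 2) × Fin (n + 2)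

/-- The plaquettes at the boundary. -/
abbrev RimFace (m n : ℕ) :=
  {p : Face m n // (p.1 = 0 ∨ p.1 = Fin.last _) ∨ (p.2 = 0 ∨ p.2 = Fin.last _)}

/-- Edges: the vertical one of the cell `(r, c)`; the `a`-th north-south edge of column `c`; the
`b`-th east-west edge of row `r`; the rim edge between a boundary plaquette and the outside. All but
the rim edges are oriented from a lower to an upper vertex, as in a bipartite lattice; a rim edge is
oriented clockwise around its plaquette. -/
inductive Edge (m n : ℕ)
  | vert (r : Fin (m + 1)) (c : Fin (n + 1))
  | ns (a : Fin (m + 2)) (c : Fin (n + 1))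
  | ew (r : Fin (m + 1)) (b : Fin (n + 2))
  | rim (p : RimFace m n)
  deriving DecidableEq, Fintype

/-- Vertices: the upper and the lower one of each cell, and the boundary vertices, at the end of the
edges that leave the patch to the north, east, south, west. -/
inductive Vertex (m n : ℕ)
  | up (r : Fin (m + 1)) (c : Fin (n + 1))
  | dn (r : Fin (m + 1)) (c : Fin (n + 1))
  | bN (c : Fin (n + 1))
  | bE (r : Fin (m + 1))
  | bS (c : Fin (n + 1))
  | bW (r : Fin (m + 1))
  deriving DecidableEq, Fintype

namespace Vertex

/-- The unit cell to which a vertex belongs; a boundary vertex belongs to the adjacent cell. -/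
def cell : Vertex m n → Fin (m + 1) × Fin (n + 1)
  | up r c => (r, c)
  | dn r c => (r, c)
  | bN c => (0, c)
  | bE r => (r, Fin.last n)
  | bS c => (Fin.last m, c)
  | bW r => (r, 0)

/-- Whether the vertex has the shape `Y` (otherwise it has the shape `λ`). The north and east
boundary vertices take the place of lower vertices, the south and west ones that of upper ones. -/
def isUpper : Vertex m n → Bool
  | up _ _ => true
  | dn _ _ => false
  | bN _ => false
  | bE _ => false
  | bS _ => true
  | bW _ => true

/-- The three edges at a vertex in counterclockwise order: top left, bottom, top right at a `Y`;
top, bottom left, bottom right at a `λ`. -/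
def edge : Vertex m n → Fin 3 → Edge m n
  | up r c => ![.ns r.castSucc c, .vert r c, .ew r c.succ]
  | dn r c => ![.vert r c, .ew r c.castSucc, .ns r.succ c]
  | bN c => ![.rim ⟨(0, c.succ), .inl (.inl rfl)⟩, .rim ⟨(0, c.castSucc), .inl (.inl rfl)⟩,
      .ns 0 c]
  | bE r => ![.rim ⟨(r.castSucc, Fin.last _), .inr (.inr rfl)⟩, .ew r (Fin.last _),
      .rim ⟨(r.succ, Fin.last _), .inr (.inr rfl)⟩]
  | bS c => ![.ns (Fin.last _) c, .rim ⟨(Fin.last _, c.castSucc), .inl (.inr rfl)⟩,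
      .rim ⟨(Fin.last _, c.succ), .inl (.inr rfl)⟩]
  | bW r => ![.rim ⟨(r.castSucc, 0), .inr (.inl rfl)⟩, .rim ⟨(r.succ, 0), .inr (.inl rfl)⟩,
      .ew r 0]

/-- Whether the orientation of the edge points into the vertex. -/
def pointsIn : Vertex m n → Fin 3 → Bool
  | up _ _ => ![true, true, true]
  | dn _ _ => ![false, false, false]
  | bN _ => ![false, true, false]
  | bE _ => ![true, false, false]
  | bS _ => ![true, false, true]
  | bW _ => ![false, true, true]

/-- The plaquette at the vertex that lies opposite to an edge; `none` is the outside. These are the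
right, top, left plaquettes at a `Y` and the bottom, right, left ones at a `λ`. -/
def face : Vertex m n → Fin 3 → Option (Face m n)
  | up r c => ![some (r.succ, c.succ), some (r.castSucc, c.succ), some (r.castSucc, c.castSucc)]
  | dn r c => ![some (r.succ, c.castSucc), some (r.succ, c.succ), some (r.castSucc, c.castSucc)]
  | bN c => ![some (0, c.castSucc), some (0, c.succ), none]
  | bE r => ![some (r.succ, Fin.last _), none, some (r.castSucc, Fin.last _)]
  | bS c => ![none, some (Fin.last _, c.succ), some (Fin.last _, c.castSucc)]
  | bW r => ![some (r.succ, 0), some (r.castSucc, 0), none]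

end Vertex

/-- The edge belongs to the boundary of the plaquette `p`. At a vertex `v` whose plaquette opposite
to the edge `e` is `p`, these are the two edges other than `e`. -/
def Borders (p : Face m n) (E : Edge m n) : Prop :=
  ∃ (v : Vertex m n) (e : Fin 3), v.face e = some p ∧ (v.edge (e + 1) = E ∨ v.edge (e + 2) = E)

/-- String configurations with string types `ι`. A state of the string-net is a function
`Config ι m n → ℂ`. -/
abbrev Config (ι : Type) (m n : ℕ) := Edge m n → ι

variable {ι : Type}

/-- The string types at a vertex, with all three strings oriented into the vertex. -/
def inward (dual : ι → ι) (X : Config ι m n) (v : Vertex m n) (e : Fin 3) : ι :=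
  if v.pointsIn e then X (v.edge e) else dual (X (v.edge e))

/-- Physical indices of a unit cell after the degree of freedom of every edge has been doubled: each
vertex of the cell carries three string types. -/
abbrev Phys (ι : Type) (m n : ℕ) (r : Fin (m + 1)) (c : Fin (n + 1)) : Type :=
  {v : Vertex m n // v.cell = (r, c)} → Fin 3 → ι

open scoped Classical in
/-- Doubling of the degrees of freedom, `|i⟩ ↦ |i i⟩` for each edge, with one copy for each end. -/
def double [Fintype ι] (ψ : Config ι m n → ℂ) (x : ∀ r c, Phys ι m n r c) : ℂ :=
  ∑ X : Config ι m n,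
    if ∀ v e, x v.cell.1 v.cell.2 ⟨v, rfl⟩ e = X (v.edge e) then ψ X else 0

/-- The string-net tensor network. The tensor of a vertex depends on the string types of its three
edges, oriented into the vertex, and on the loop labels of the plaquettes opposite to them, where
the outside has the trivial label `vac`. The loop labels are contracted. -/
def loopNetwork [Fintype ι] (dual : ι → ι) (vac : ι)
    (T : Vertex m n → (Fin 3 → ι) → (Fin 3 → ι) → ℂ) (X : Config ι m n) : ℂ :=
  ∑ g : Face m n → ι, ∏ v, T v (inward dual X v) fun e => (v.face e).elim vac g

/-! ### Levin–Wen models -/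

/-- String types `0, …, N`, where `0` is the trivial one, with duals and branching rules. -/
structure FusionRules (N : ℕ) where
  dual : Fin (N + 1) → Fin (N + 1)
  dual_dual : ∀ i, dual (dual i) = i
  dual_zero : dual 0 = 0
  /-- the three strings, oriented into a vertex, may meet there -/
  allowed : Fin (N + 1) → Fin (N + 1) → Fin (N + 1) → Prop
  allowed_swap : ∀ i j k, allowed i j k → allowed j i k
  allowed_rotate : ∀ i j k, allowed i j k → allowed j k i
  allowed_dual : ∀ i j k, allowed i j k → allowed (dual i) (dual j) (dual k)
  allowed_zero : ∀ i j, allowed i j 0 ↔ j = dual i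
  allowed_assoc : ∀ a b c d,
    Nat.card {e // allowed a b (dual e) ∧ allowed e c d} =
      Nat.card {f // allowed a f d ∧ allowed b c (dual f)}

/-- The fusion constraints for the six indices of an `F`-symbol. -/
def FusionRules.Admissible {N : ℕ} (R : FusionRules N) (i j m k l n : Fin (N + 1)) : Prop :=
  R.allowed i j m ∧ R.allowed k l (R.dual m) ∧ R.allowed i l n ∧ R.allowed j k (R.dual n)

/-- An isotopy-invariant, mirror-symmetric string-net model. `F i j m k l n` is the `F`-symbol with
upper indices `i j m` and lower indices `k l n`. -/
structure LevinWen (N : ℕ) extends FusionRules N where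
  F : Fin (N + 1) → Fin (N + 1) → Fin (N + 1) →
    Fin (N + 1) → Fin (N + 1) → Fin (N + 1) → ℂ
  v : Fin (N + 1) → ℂ
  F_eq_zero : ∀ i j m k l n, ¬ toFusionRules.Admissible i j m k l n → F i j m k l n = 0
  v_sq : ∀ s, v s ^ 2 * F s (dual s) 0 s (dual s) 0 = 1
  normalization : ∀ i j k, allowed i j k → F i j k (dual j) (dual i) 0 = v k / (v i * v j)
  tetrahedral₁ : ∀ i j m k l n, F i j m k l n = F j i m l k (dual n)
  tetrahedral₂ : ∀ i j m k l n, F i j m k l n = F l k (dual m) j i n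
  tetrahedral₃ : ∀ i j m k l n, F i j m k l n = v m * v n / (v j * v l) * F i m j (dual k) n l
  pentagon : ∀ i j k l m p q r s,
    ∑ n, F m l q k (dual p) n * F j i p m n (dual s) * F j (dual s) n l k (dual r) =
      F j i p (dual q) k (dual r) * F r i (dual q) m l (dual s)
  unitary : ∀ i j m k l n,
    F (dual i) (dual j) (dual m) (dual k) (dual l) (dual n) = conj (F i j m k l n)

namespace LevinWen

variable {N : ℕ} (M : LevinWen N)

open scoped Classical in
/-- `A` is a full-rank version of the `F`-symbol: it is unitary for all indices, and it becomes `F`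
when the fusion constraints are imposed. -/
def IsASymbol (A : Fin (N + 1) → Fin (N + 1) → Fin (N + 1) →
    Fin (N + 1) → Fin (N + 1) → Fin (N + 1) → ℂ) : Prop :=
  (∀ i j m k l n, M.F i j m k l n =
    if M.allowed i j m ∧ M.allowed k l (M.dual m) then A i j m k l n else 0) ∧
  ∀ i j k l m m', ∑ n, conj (A i j m k l n) * A i j m' k l n = if m = m' then 1 else 0

/-- The quantum dimension, `d_s = 1 / |F^{s s* 0}_{s s* 0}| = |v_s|²`. -/
def d (s : Fin (N + 1)) : ℝ := ‖M.v s‖ ^ 2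

/-- The total quantum dimension `∑ d_s²`. -/
def totalDim : ℝ := ∑ s, M.d s ^ 2

open scoped Classical in
/-- The operator that adds a loop of type `s` to the plaquette `p`: the loop is fused into the edges
around `p`. Each corner of `p` contributes an `F`-symbol, whose first index is the edge that leaves
`p` there; rows are final and columns initial configurations. -/
def addLoop (m n : ℕ) (p : Face m n) (s : Fin (N + 1)) :
    Matrix (Config (Fin (N + 1)) m n) (Config (Fin (N + 1)) m n) ℂ := fun X' X =>
  if ∀ E, ¬ Borders p E → X' E = X E then
    ∏ v : Vertex m n, ∏ e : Fin 3,
      if v.face e = some p then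
        M.F (inward M.dual X v e) (inward M.dual X v (e + 1)) (inward M.dual X v (e + 2))
          (M.dual s) (inward M.dual X' v (e + 2)) (inward M.dual X' v (e + 1))
      else 1
  else 0

/-- The plaquette operator `B_p = ∑_s (ℓ_s / 𝒟) B_p^s` with `ℓ_s = v_s²`. -/
def plaquette (m n : ℕ) (p : Face m n) :
    Matrix (Config (Fin (N + 1)) m n) (Config (Fin (N + 1)) m n) ℂ :=
  ∑ s, (M.v s ^ 2 / (M.totalDim : ℂ)) • M.addLoop m n p s

/-- The fixed-point ground state `∏_p B_p |0⟩` (the order of the commuting factors is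
immaterial). -/
def groundState (m n : ℕ) : Config (Fin (N + 1)) m n → ℂ :=
  ((Finset.univ : Finset (Face m n)).toList.map (M.plaquette m n)).prod.mulVec
    (Pi.single (fun _ => 0) 1)

open scoped Classical in
/-- The string-net tensors, where `w` is a choice of the square roots `√v`. At an upper vertex with
edges `i, k, j` and plaquettes `γ, β, α` opposite to them the tensor is
`√(v_i v_j / v_k) F^{i α* β}_{γ j k}`, at a lower vertex with edges `k, l, m` and plaquettes
`σ, γ, α` it is `√(v_l v_m / v_k) (F^{l α* σ}_{γ m k})*`. At the boundary vertices the rim edges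
carry the loop labels of their plaquettes and the third edge `i` contributes `√v_i`; the plaquettes
at the leftmost and the rightmost corner of the patch contribute another factor `v`. -/
def tensor (w : Fin (N + 1) → ℂ) {m n : ℕ} :
    Vertex m n → (Fin 3 → Fin (N + 1)) → (Fin 3 → Fin (N + 1)) → ℂ
  | .up _ _, a, f => w (a 0) * w (a 2) / w (a 1) * M.F (a 0) (M.dual (f 2)) (f 1) (f 0) (a 2) (a 1)
  | .dn _ _, a, f => w (M.dual (a 1)) * w (M.dual (a 2)) / w (M.dual (a 0)) *
      conj (M.F (M.dual (a 1)) (M.dual (f 2)) (f 0) (f 1) (M.dual (a 2)) (M.dual (a 0)))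
  | .bN _, a, f =>
      if M.allowed (a 0) (a 1) (a 2) ∧ M.dual (a 0) = f 1 ∧ a 1 = f 0 then w (M.dual (a 2)) else 0
  | .bE r, a, f =>
      (if r = Fin.last m then M.v (f 0) else 1) *
        if M.allowed (a 0) (a 1) (a 2) ∧ a 0 = f 2 ∧ M.dual (a 2) = f 0 then w (M.dual (a 1)) else 0
  | .bS _, a, f =>
      if M.allowed (a 0) (a 1) (a 2) ∧ M.dual (a 1) = f 2 ∧ a 2 = f 1 then w (a 0) else 0
  | .bW r, a, f =>
      (if r = 0 then M.v (f 1) else 1) *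
        if M.allowed (a 0) (a 1) (a 2) ∧ M.dual (a 0) = f 1 ∧ a 1 = f 0 then w (a 2) else 0

end LevinWen

/-! ### Abelian string-nets -/

/-- For any two string types there is exactly one third with which they may meet. -/
def FusionRules.IsAbelian {N : ℕ} (R : FusionRules N) : Prop :=
  ∀ a b, ∃! c, R.allowed a b c

/-- The `F`-symbol of an abelian string-net obeys the fusion constraints, and it has modulus one
where these are satisfied. -/
def FusionRules.IsAbelianFSymbol {N : ℕ} (R : FusionRules N)
    (F : Fin (N + 1) → Fin (N + 1) → Fin (N + 1) →
      Fin (N + 1) → Fin (N + 1) → Fin (N + 1) → ℂ) : Prop :=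
  ∀ i j m k l n, (R.Admissible i j m k l n → ‖F i j m k l n‖ = 1) ∧
    (¬ R.Admissible i j m k l n → F i j m k l n = 0)

/-- The triangular tensor `𝒩 F` of an abelian string-net, with a phase `𝒩`. -/
def FusionRules.abelianTensor {N : ℕ} (R : FusionRules N)
    (F : Fin (N + 1) → Fin (N + 1) → Fin (N + 1) →
      Fin (N + 1) → Fin (N + 1) → Fin (N + 1) → ℂ) {m n : ℕ}
    (phase : Vertex m n → (Fin 3 → Fin (N + 1)) → (Fin 3 → Fin (N + 1)) → ℂ)
    (v : Vertex m n) (a f : Fin 3 → Fin (N + 1)) : ℂ :=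
  phase v a f *
    if v.isUpper then F (a 0) (R.dual (f 2)) (f 1) (f 0) (a 2) (a 1)
    else conj (F (R.dual (a 1)) (R.dual (f 2)) (f 0) (f 1) (R.dual (a 2)) (R.dual (a 0)))

/-- The data of a Lin–Levin abelian string-net model with string types in a finite abelian group
`G`, dual `a* = -a`, and branching rule `a + b + c = 0`: here `F a b c` is the phase of the move
from `(a b) c` to `a (b c)`, and `d a` is the value of a closed loop. (The phases that these models
attach to null strings are functions of `F` and `d`, and they do not appear for a lattice in which
every vertex is a fusion or a splitting of upward strings.) -/
structure LinLevin (G : Type) [AddCommGroup G] where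
  F : G → G → G → ℂ
  d : G → ℂ
  norm_F : ∀ a b c, ‖F a b c‖ = 1
  F_zero_left : ∀ b c, F 0 b c = 1
  F_zero_mid : ∀ a c, F a 0 c = 1
  F_zero_right : ∀ a b, F a b 0 = 1
  pentagon : ∀ a b c e,
    F (a + b) c e * F a b (c + e) = F a b c * F a (b + c) e * F b c e
  norm_d : ∀ a, ‖d a‖ = 1
  d_add : ∀ a b, d (a + b) = d a * d b

namespace LinLevin

variable {G : Type} [AddCommGroup G] (L : LinLevin G)

/-- The phase from fusing a counterclockwise loop `s` into the two edges at the corner opposite to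
the edge `e` of a vertex, at which the strings oriented into the vertex are `a`. In terms of the
labels of upward strings, a `Y` splits `k = i + j` into `i = -a 0`, `j = -a 2`, and a `λ` fuses
`l = a 1`, `m = a 2` into `k = l + m`. -/
def corner (isUpper : Bool) (a : Fin 3 → G) (s : G) : Fin 3 → ℂ :=
  if isUpper then
    ![L.F (-a 0) (-a 2 - s) s, (L.F (-a 0 - s) s (-a 2))⁻¹, L.F s (-a 0) (-a 2)]
  else
    ![L.F (a 1 - s) s (a 2), (L.F (a 1) (a 2 - s) s)⁻¹, (L.F s (a 1) (a 2))⁻¹]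

/-- The rim edge of the topmost plaquette `(0, n + 1)` has a maximum and that of the lowest
plaquette `(m + 1, 0)` has a minimum with respect to the vertical direction; this is the phase
from fusing a loop `s` along them, when the edge has the label `x` as a counterclockwise loop. -/
def turn (m n : ℕ) (p : Face m n) (X : Config G m n) (s : G) : ℂ :=
  let turnPhase : G → ℂ := fun x => L.F (-x - s) s x
  (if p = (0, Fin.last _) then
    turnPhase (-X (.rim ⟨(0, Fin.last _), .inl (.inl rfl)⟩)) else 1) *
  if p = (Fin.last _, 0) then
    (turnPhase (-X (.rim ⟨(Fin.last _, 0), .inl (.inr rfl)⟩)))⁻¹ else 1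

open scoped Classical in
/-- The operator that adds a counterclockwise loop of type `s` to the plaquette `p`; it vanishes on
configurations that violate the branching rule at a vertex of `p`. Rows are final and columns
initial configurations. -/
def addLoop (m n : ℕ) (p : Face m n) (s : G) :
    Matrix (Config G m n) (Config G m n) ℂ := fun X' X =>
  if (∀ E, ¬ Borders p E → X' E = X E) ∧
      ∀ (v : Vertex m n) (e : Fin 3), v.face e = some p →
        inward Neg.neg X v 0 + inward Neg.neg X v 1 + inward Neg.neg X v 2 = 0 ∧
        inward Neg.neg X' v (e + 1) = inward Neg.neg X v (e + 1) - s ∧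
        inward Neg.neg X' v (e + 2) = inward Neg.neg X v (e + 2) + s then
    L.turn m n p X s * ∏ v : Vertex m n, ∏ e : Fin 3,
      if v.face e = some p then L.corner v.isUpper (inward Neg.neg X v) s e else 1
  else 0

variable [Fintype G] [DecidableEq G]

/-- The plaquette operator `B_p = ∑_s (d_s / |G|) B_p^s`. -/
def plaquette (m n : ℕ) (p : Face m n) : Matrix (Config G m n) (Config G m n) ℂ :=
  ∑ s, (L.d s / (Fintype.card G : ℂ)) • L.addLoop m n p s

/-- The fixed-point ground state `∏_p B_p |0⟩` (the order of the commuting factors is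
immaterial). -/
def groundState (m n : ℕ) : Config G m n → ℂ :=
  ((Finset.univ : Finset (Face m n)).toList.map (L.plaquette m n)).prod.mulVec
    (Pi.single (fun _ => 0) 1)

end LinLevin

end

end StringNet

/-! Fill the plaquettes one after the other. A loop is always added to a plaquette that is still
empty, so the strings around it are fixed beforehand by the neighbouring loops, and the F-moves at
its corners turn the vertex amplitudes into those with one more loop label. Hence the ground state
is a sum over plaquette labels of products of vertex amplitudes (`LevinWen.prod_plaquette_mulVec`,
`LinLevin.exists_phase`): rotation-invariant F-symbols for Levin–Wen models, phases for Lin–Levin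
models. The empty outside forces every rim string to equal the label of its plaquette.

Isometry comes from single vertices. Unitarity of F, obtained from the pentagon with one label
trivial (`LevinWen.sum_F_mul_conj`), says that a sum over one string at a vertex makes the loop
label opposite to it orthogonal (`IsVertexTensor`). The identity ∑ d_x d_y = D d_z (`IsBalanced`)
takes care of sums over a string together with a loop beside it. In the abelian case both hold
because two labels determine the third. Together they give Gram identities for the two vertices of a
cell (`gram_vertical`, `gram_horizontal`, `gram_arm`), which by reflections cover all eight sets of
outgoing legs.

Every bond carries a string and the loops on its two sides. The weight of a string on a bond is put
on the cell nearer to the orthogonality center. Of the cells around a plaquette, the nearest one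
receives a weight u with |u|² = d/D, and the farthest one, if the plaquette is inside the patch, a
weight v with |v|² = d. The product of all weights does not depend on the center
(`prod_cellWeight`), so that one state has an isometric form for every center.

The resulting tensors are isometric only on outgoing indices that obey the branching rules. They are
completed to isometries (`exists_isometry_extension`), which also produces the A-symbols. The
contraction does not notice: going outwards from the center, nonvanishing cells pass on only
admissible indices, so the altered columns are never reached (`exists_label_outLegs`,
`exists_isometricForm`). -/

namespace StringNet

/-! ### Linear algebra and sums -/

/-- A matrix whose columns in `S` are orthonormal agrees on these columns with an isometry. -/
theorem exists_isometry_extension {R C : Type*} [Fintype R] [Fintype C] [DecidableEq C]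
    (hcard : Fintype.card C ≤ Fintype.card R) (A : Matrix R C ℂ) (S : Set C)
    (hA : ∀ c ∈ S, ∀ c' ∈ S, ∑ x, conj (A x c) * A x c' = if c = c' then 1 else 0) :
    ∃ A' : Matrix R C ℂ, A'ᴴ * A' = 1 ∧ ∀ x, ∀ c ∈ S, A' x c = A x c := by
  classical
  obtain ⟨φ⟩ := Function.Embedding.nonempty_of_card_le hcard
  let col : C → EuclideanSpace ℂ R := fun c => WithLp.toLp 2 fun x => A x c
  -- The columns are placed in a family indexed by `R`, because an orthonormal family extends to a
  -- basis with the same index set when this set has as many elements as the dimension.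
  let w : R → EuclideanSpace ℂ R := fun x => if h : ∃ c, φ c = x then col h.choose else 0
  have hw : ∀ c, w (φ c) = col c := fun c => by
    have h : ∃ c', φ c' = φ c := ⟨c, rfl⟩
    simp only [w, dif_pos h, φ.injective h.choose_spec]
  have hinner : ∀ u v : EuclideanSpace ℂ R, inner ℂ u v = ∑ x, conj (u x) * v x := fun u v => by
    simp only [PiLp.inner_apply, RCLike.inner_apply]
    exact Finset.sum_congr rfl fun _ _ => mul_comm _ _
  have hort : Orthonormal ℂ ((φ '' S).domRestrict w) := by
    rw [orthonormal_iff_ite]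
    rintro ⟨_, c, hc, rfl⟩ ⟨_, c', hc', rfl⟩
    simp only [Set.domRestrict_apply, hw, hinner, col, hA c hc c' hc']
    refine if_congr ?_ rfl rfl
    exact ⟨fun h => Subtype.ext (congrArg φ h), fun h => φ.injective (congrArg Subtype.val h)⟩
  obtain ⟨b, hb⟩ := hort.exists_orthonormalBasis_extension_of_card_eq (by simp)
  refine ⟨Matrix.of fun x c => b (φ c) x, ?_, fun x c hc => ?_⟩
  · ext c c'
    have h := orthonormal_iff_ite.1 b.orthonormal (φ c) (φ c')
    rw [hinner] at h
    simp only [φ.injective.eq_iff] at h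
    rw [Matrix.mul_apply, Matrix.one_apply, ← h]
    rfl
  · simp only [Matrix.of_apply, hb _ (Set.mem_image_of_mem φ hc), hw, col]

/-- Summing over the part of a type that is parametrized by a map injective on `Q`. -/
theorem sum_ite_eq_sum_param {α β M : Type*} [Fintype α] [Fintype β] [AddCommMonoid M]
    (P : β → Prop) [DecidablePred P] (Q : α → Prop) [DecidablePred Q] (φ : α → β)
    (hφ : ∀ a a', Q a → Q a' → φ a = φ a' → a = a') (hP : ∀ b, P b ↔ ∃ a, Q a ∧ φ a = b)
    (f : β → M) :
    (∑ b, if P b then f b else 0) = ∑ a, if Q a then f (φ a) else 0 := by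
  classical
  rw [← Finset.sum_filter, ← Finset.sum_filter]
  refine (Finset.sum_bij (fun a _ => φ a) (fun a ha => ?_) (fun a ha b hb h => ?_)
    (fun b hb => ?_) fun _ _ => rfl).symm
  · simp only [Finset.mem_filter, Finset.mem_univ, true_and] at ha ⊢
    exact (hP _).2 ⟨a, ha, rfl⟩
  · simp only [Finset.mem_filter, Finset.mem_univ, true_and] at ha hb
    exact hφ a b ha hb h
  · simp only [Finset.mem_filter, Finset.mem_univ, true_and] at hb
    obtain ⟨a, ha, h⟩ := (hP b).1 hb
    exact ⟨a, by simpa using ha, h⟩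

theorem sum_ite_eq_sum_range {α β M : Type*} [Fintype α] [Fintype β] [AddCommMonoid M]
    (P : β → Prop) [DecidablePred P] (φ : α → β)
    (hφ : Function.Injective φ) (hP : ∀ b, P b ↔ ∃ a, φ a = b) (f : β → M) :
    (∑ b, if P b then f b else 0) = ∑ a, f (φ a) := by
  rw [sum_ite_eq_sum_param P (fun _ => True) φ (fun _ _ _ _ h => hφ h) (by simpa using hP)]
  simp

theorem prod_sum_ite {α β : Type*} [Fintype α] [DecidableEq α] [Fintype β]
    (P : α → β → Prop) [∀ a b, Decidable (P a b)] [DecidablePred fun t : α → β => ∀ a, P a (t a)]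
    (f : α → β → ℂ) : ∏ a, ∑ b, (if P a b then f a b else 0) =
      ∑ t : α → β, if ∀ a, P a (t a) then ∏ a, f a (t a) else 0 := by
  rw [Finset.prod_univ_sum, Fintype.piFinset_univ]
  refine Finset.sum_congr rfl fun t _ => ?_
  rw [Finset.prod_ite_zero]
  simp only [Finset.mem_univ, true_implies]

/-! ### Products over a segment with a marked point -/

section Products

variable {M : Type*} [CommMonoid M] {m : ℕ}

/-- Sites are `r`, bonds are `a`, and arrows point to `r₀`. Every bond, also at the two ends, is a
non-outgoing leg of exactly one site, the one nearer to `r₀`: bonds up to `r₀.castSucc` come from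
the first product, the others from the second. -/
theorem prod_segment_create (r₀ : Fin (m + 1)) (y : Fin (m + 2) → M) :
    (∏ r : Fin (m + 1), if r₀ < r then 1 else y r.castSucc) *
      (∏ r : Fin (m + 1), if r < r₀ then 1 else y r.succ) = ∏ a, y a := by
  have h1 : (∏ r : Fin (m + 1), if r₀ < r then 1 else y r.castSucc) =
      ∏ a : Fin (m + 2), if a ≤ r₀.castSucc then y a else 1 := by
    rw [Fin.prod_univ_castSucc (n := m + 1), if_neg (by simp), mul_one]
    refine Finset.prod_congr rfl fun r _ => ?_
    rcases lt_or_ge r₀ r with h | h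
    · simp [h, not_le.2 h]
    · simp [h, not_lt.2 h]
  have h2 : (∏ r : Fin (m + 1), if r < r₀ then 1 else y r.succ) =
      ∏ a : Fin (m + 2), if a ≤ r₀.castSucc then 1 else y a := by
    rw [Fin.prod_univ_succ (n := m + 1), if_pos (Fin.zero_le _), one_mul]
    refine Finset.prod_congr rfl fun r _ => ?_
    have : r.succ ≤ r₀.castSucc ↔ r < r₀ := by
      rw [Fin.le_def, Fin.lt_def, Fin.val_succ, Fin.val_castSucc, Nat.succ_le_iff]
    simp only [this]
  rw [h1, h2, ← Finset.prod_mul_distrib]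
  refine Finset.prod_congr rfl fun a _ => ?_
  split_ifs <;> simp

/-- The counterpart for outgoing legs: a bond is the outgoing leg of exactly one site, the one
farther from `r₀`, except that the two end bonds have no site beyond them. -/
theorem prod_segment_consume (r₀ : Fin (m + 1)) (y : Fin (m + 2) → M) :
    (∏ r : Fin (m + 1), if r₀ < r then y r.castSucc else 1) *
      (∏ r : Fin (m + 1), if r < r₀ then y r.succ else 1) =
      ∏ a, if a = 0 ∨ a = Fin.last _ then 1 else y a := by
  have h1 : (∏ r : Fin (m + 1), if r₀ < r then y r.castSucc else 1) =
      ∏ a : Fin (m + 2), if r₀.castSucc < a ∧ a ≠ Fin.last _ then y a else 1 := by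
    rw [Fin.prod_univ_castSucc (n := m + 1), if_neg (by simp), mul_one]
    refine Finset.prod_congr rfl fun r _ => ?_
    simp [Fin.castSucc_lt_last r |>.ne]
  have h2 : (∏ r : Fin (m + 1), if r < r₀ then y r.succ else 1) =
      ∏ a : Fin (m + 2), if a ≤ r₀.castSucc ∧ a ≠ 0 then y a else 1 := by
    rw [Fin.prod_univ_succ (n := m + 1), if_neg (by simp), one_mul]
    refine Finset.prod_congr rfl fun r _ => ?_
    have : r.succ ≤ r₀.castSucc ↔ r < r₀ := by
      rw [Fin.le_def, Fin.lt_def, Fin.val_succ, Fin.val_castSucc, Nat.succ_le_iff]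
    simp [this]
  rw [h1, h2, ← Finset.prod_mul_distrib]
  refine Finset.prod_congr rfl fun a _ => ?_
  rcases eq_or_ne a 0 with rfl | ha
  · simp
  rcases eq_or_ne a (Fin.last _) with rfl | hb
  · have h : ¬ Fin.last (m + 1) ≤ r₀.castSucc := by simp
    simp [h]
  · by_cases h : a ≤ r₀.castSucc
    · simp [h, ha, hb]
    · simp [h, ha, hb, not_le.1 h]

end Products

/-! ### Vertex tensors -/

/-- A relation between a string and the loop labels on its two sides, for which the weights `d`
satisfy `∑ d_x d_y = D d_z`, where the sum is over the string and one of the two loop labels. -/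
structure IsBalanced {ι : Type} [Fintype ι] (d : ι → ℝ) (D : ℝ) (B : ι → ι → ι → Prop) :
    Prop where
  left : ∀ f, open scoped Classical in (∑ x, ∑ f', if B x f f' then d x * d f' else 0) = D * d f
  right : ∀ f', open scoped Classical in (∑ x, ∑ f, if B x f f' then d x * d f else 0) = D * d f'

/-- Unitarity of a tensor `Y i j k L T R` at a vertex with strings `i` (between the loops `L` and
`T`), `j` (between `T` and `R`), and `k` (between `L` and `R`). -/
structure IsVertexTensor {ι : Type} [Fintype ι] [DecidableEq ι] (d : ι → ℝ) (Bi Bj Bk : ι → ι → ι → Prop)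
    (Y : ι → ι → ι → ι → ι → ι → ℂ) : Prop where
  support : ∀ i j k L T R, Y i j k L T R ≠ 0 → Bi i L T ∧ Bj j T R ∧ Bk k L R
  sum_i : ∀ j k L T R R', Bj j T R → Bk k L R →
    ∑ i, (d i : ℂ) * (conj (Y i j k L T R) * Y i j k L T R') = if R = R' then 1 / (d R : ℂ) else 0
  sum_j : ∀ i k L L' T R, Bi i L T → Bk k L R →
    ∑ j, (d j : ℂ) * (conj (Y i j k L T R) * Y i j k L' T R) = if L = L' then 1 / (d L : ℂ) else 0
  sum_k : ∀ i j L T T' R, Bi i L T → Bj j T R →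
    ∑ k, (d k : ℂ) * (conj (Y i j k L T R) * Y i j k L T' R) = if T = T' then 1 / (d T : ℂ) else 0

namespace IsVertexTensor

variable {ι : Type} [Fintype ι] [DecidableEq ι] {d : ι → ℝ} {D : ℝ} {Bi Bj Bk : ι → ι → ι → Prop}
  {Y : ι → ι → ι → ι → ι → ι → ℂ}

-- Tracing a vertex out from the side of `k`: the sum over `j` gives 1/d_L, and balance for `i` and
-- `T` turns this into the constant `D`. Only the branching rule for `k` survives.
open scoped Classical in
theorem sum_ijT (hY : IsVertexTensor d Bi Bj Bk Y) (hd : ∀ i, 0 < d i) (hB : IsBalanced d D Bi)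
    (k L R : ι) :
    ∑ i, ∑ j, ∑ T, (d i : ℂ) * d j * d T * (conj (Y i j k L T R) * Y i j k L T R) =
      if Bk k L R then (D : ℂ) else 0 := by
  split_ifs with hk
  · have h : ∀ i, ∑ j, ∑ T, (d i : ℂ) * d j * d T * (conj (Y i j k L T R) * Y i j k L T R) =
        ((∑ T, if Bi i L T then d i * d T else 0 : ℝ) : ℂ) * (1 / d L) := fun i => by
      rw [Finset.sum_comm]
      push_cast
      rw [Finset.sum_mul]
      refine Finset.sum_congr rfl fun T _ => ?_
      split_ifs with hi
      · have := hY.sum_j i k L L T R hi hk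
        rw [if_pos rfl] at this
        push_cast
        rw [← this, Finset.mul_sum]
        exact Finset.sum_congr rfl fun _ _ => by ring
      · rw [Complex.ofReal_zero, zero_mul]
        refine Finset.sum_eq_zero fun j _ => ?_
        have : Y i j k L T R = 0 := by
          by_contra h0
          exact hi (hY.support _ _ _ _ _ _ h0).1
        simp [this]
    simp only [h, ← Finset.sum_mul, ← Complex.ofReal_sum, hB.left]
    have : (d L : ℂ) ≠ 0 := by exact_mod_cast (hd L).ne'
    push_cast
    field_simp
  · refine Finset.sum_eq_zero fun i _ => Finset.sum_eq_zero fun j _ =>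
      Finset.sum_eq_zero fun T _ => ?_
    have : Y i j k L T R = 0 := by
      by_contra h0
      exact hk (hY.support _ _ _ _ _ _ h0).2.2
    simp [this]

/-- The same from the side of `i`: the sum over `k` gives 1/d_T, and balance for `j` and `R` gives D
d_T. -/
theorem sum_jkR (hY : IsVertexTensor d Bi Bj Bk Y) (hd : ∀ i, 0 < d i) (hB : IsBalanced d D Bj)
    {i L T : ι} (hi : Bi i L T) :
    ∑ j, ∑ k, ∑ R, (d j : ℂ) * d k * d R * (conj (Y i j k L T R) * Y i j k L T R) = D := by
  classical
  have h : ∀ j, ∑ k, ∑ R, (d j : ℂ) * d k * d R * (conj (Y i j k L T R) * Y i j k L T R) =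
      ((∑ R, if Bj j T R then d j * d R else 0 : ℝ) : ℂ) * (1 / d T) := fun j => by
    rw [Finset.sum_comm]
    push_cast
    rw [Finset.sum_mul]
    refine Finset.sum_congr rfl fun R _ => ?_
    split_ifs with hj
    · have := hY.sum_k i j L T T R hi hj
      rw [if_pos rfl] at this
      push_cast
      rw [← this, Finset.mul_sum]
      exact Finset.sum_congr rfl fun _ _ => by ring
    · rw [Complex.ofReal_zero, zero_mul]
      refine Finset.sum_eq_zero fun k _ => ?_
      have : Y i j k L T R = 0 := by
        by_contra h0
        exact hj (hY.support _ _ _ _ _ _ h0).2.1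
      simp [this]
  simp only [h, ← Finset.sum_mul, ← Complex.ofReal_sum, hB.left]
  have : (d T : ℂ) ≠ 0 := by exact_mod_cast (hd T).ne'
  push_cast
  field_simp

end IsVertexTensor

/-! ### Networks of copy tensors -/

/-- Dimension of the bond `a`, where the bonds that leave the patch are trivial. -/
def bondDim (K : ℕ) {b : ℕ} (a : Fin (b + 2)) : ℕ :=
  if a = 0 ∨ a = Fin.last _ then 1 else K

section

set_option linter.unusedSectionVars false

variable {ι : Type} [Fintype ι] [DecidableEq ι] {m n : ℕ}

/-- A bond carries the label of an edge and the labels of the plaquettes on its two sides. -/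
noncomputable def bondIndex {b : ℕ} (a : Fin (b + 2)) (t : ι × ι × ι) :
    Fin (bondDim (Fintype.card (ι × ι × ι)) a) :=
  -- A trivial bond forgets its labels. Nothing is lost, since the boundary vertex at its end shows
  -- them in the physical index of the cell.
  if h : a = 0 ∨ a = Fin.last _ then ⟨0, by simp [bondDim, h]⟩
  else (Fintype.equivFin _ t).cast (by simp [bondDim, h])

theorem bondIndex_injective {b : ℕ} {a : Fin (b + 2)} (h : ¬ (a = 0 ∨ a = Fin.last _)) :
    Function.Injective (bondIndex (ι := ι) a) := fun s t hst => by
  simpa [bondIndex, h] using hst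

/-- The labels that occur at a unit cell: the strings `i`, `j`, `k`, `l`, `m` on the top left,
top right, vertical, bottom left, bottom right edges, and the loops on the left, top, bottom, right
plaquettes. -/
@[ext]
structure CellLabel (ι : Type) where
  (i j k l m L T B R : ι)

instance : Fintype (CellLabel ι) :=
  Fintype.ofEquiv (ι × ι × ι × ι × ι × ι × ι × ι × ι)
    { toFun := fun ⟨i, j, k, l, m, L, T, B, R⟩ => ⟨i, j, k, l, m, L, T, B, R⟩
      invFun := fun t => (t.i, t.j, t.k, t.l, t.m, t.L, t.T, t.B, t.R)
      left_inv := fun _ => rfl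
      right_inv := fun _ => rfl }

namespace CellLabel

/-- The labels that the cell communicates to its neighbours. -/
def leg (t : CellLabel ι) : Leg → ι × ι × ι
  | .north => (t.i, t.L, t.T)
  | .east => (t.j, t.T, t.R)
  | .south => (t.m, t.B, t.R)
  | .west => (t.l, t.L, t.B)

/-- The string types on the edges around the vertices of a cell. The rim edges carry the labels of
their plaquettes. -/
def phys (t : CellLabel ι) : Vertex m n → Fin 3 → ι
  | .up _ _ => ![t.i, t.k, t.j]
  | .dn _ _ => ![t.k, t.l, t.m]
  | .bN _ => ![t.T, t.L, t.i]
  | .bE _ => ![t.T, t.j, t.R]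
  | .bS _ => ![t.m, t.B, t.R]
  | .bW _ => ![t.L, t.B, t.l]

/-- The bond indices at the legs of the cell `(r, c)`. -/
noncomputable def legIndex (r : Fin (m + 1)) (c : Fin (n + 1)) (t : CellLabel ι) :
    ∀ g : Leg, Fin (legDim (fun _ b => bondDim (Fintype.card (ι × ι × ι)) b)
      (fun a _ => bondDim (Fintype.card (ι × ι × ι)) a) r c g)
  | .north => bondIndex r.castSucc (t.leg .north)
  | .east => bondIndex c.succ (t.leg .east)
  | .south => bondIndex r.succ (t.leg .south)
  | .west => bondIndex c.castSucc (t.leg .west)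

end CellLabel

/-- A tensor at the cell `(r, c)` of a network with bonds as above. -/
abbrev CellTensor (ι : Type) [Fintype ι] (m n : ℕ) (r : Fin (m + 1)) (c : Fin (n + 1)) : Type :=
  Phys ι m n r c → (∀ g : Leg, Fin (legDim (fun _ b => bondDim (Fintype.card (ι × ι × ι)) b)
      (fun a _ => bondDim (Fintype.card (ι × ι × ι)) a) r c g)) → ℂ

/-- The network with given cell tensors. -/
def cellNetwork (T : ∀ r c, CellTensor ι m n r c) : PEPS m n (Phys ι m n) where
  hdim _ b := bondDim (Fintype.card (ι × ι × ι)) b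
  vdim a _ := bondDim (Fintype.card (ι × ι × ι)) a
  hdim_first _ := by simp [bondDim]
  hdim_last _ := by simp [bondDim]
  vdim_first _ := by simp [bondDim]
  vdim_last _ := by simp [bondDim]
  tensor := T

theorem cellNetwork_bondDimLE [Nonempty ι] (T : ∀ r c, CellTensor ι m n r c) :
    (cellNetwork T).BondDimLE (Fintype.card (ι × ι × ι)) := by
  have h : ∀ {b : ℕ} (a : Fin (b + 2)),
      bondDim (Fintype.card (ι × ι × ι)) a ≤ Fintype.card (ι × ι × ι) := fun a => by
    unfold bondDim
    split_ifs
    · exact Fintype.card_pos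
    · exact le_rfl
  exact ⟨fun _ b => h b, fun a _ => h a⟩

open scoped Classical in
/-- The tensor that copies the labels of the cell to the physical index and to the legs. -/
noncomputable def copyTensor (r : Fin (m + 1)) (c : Fin (n + 1)) (κ : CellLabel ι → ℂ) :
    CellTensor ι m n r c := fun x g =>
  ∑ t, if (∀ v e, x v e = t.phys v.1 e) ∧ g = t.legIndex r c then κ t else 0

/-- The labels at a cell in a configuration of strings and loops. -/
def cellLabel (X : Config ι m n) (g : Face m n → ι) (r : Fin (m + 1)) (c : Fin (n + 1)) :
    CellLabel ι where
  i := X (.ns r.castSucc c)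
  j := X (.ew r c.succ)
  k := X (.vert r c)
  l := X (.ew r c.castSucc)
  m := X (.ns r.succ c)
  L := g (r.castSucc, c.castSucc)
  T := g (r.castSucc, c.succ)
  B := g (r.succ, c.castSucc)
  R := g (r.succ, c.succ)

theorem cellLabel_phys {X : Config ι m n} {g : Face m n → ι} (h : ∀ p, X (.rim p) = g p)
    (v : Vertex m n) (e : Fin 3) :
    (cellLabel X g v.cell.1 v.cell.2).phys v e = X (v.edge e) := by
  cases v <;> fin_cases e <;> simp [CellLabel.phys, cellLabel, Vertex.edge, Vertex.cell, h]

variable {t : Fin (m + 1) → Fin (n + 1) → CellLabel ι}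

/-- Labels at the cells that agree on the bonds come from a configuration. -/
theorem exists_config
    (hv : ∀ (r : Fin m) c, (t r.castSucc c).leg .south = (t r.succ c).leg .north)
    (hh : ∀ r (c : Fin n), (t r c.castSucc).leg .east = (t r c.succ).leg .west) :
    ∃ (X : Config ι m n) (g : Face m n → ι), (∀ p, X (.rim p) = g p) ∧ cellLabel X g = t := by
  -- A plaquette is read off as the left plaquette of the cell with the same coordinates. In the
  -- last row or column there is no such cell, and the bottom, top or right plaquette of the last
  -- cell is used.
  let g : Face m n → ι := fun p =>
    Fin.lastCases (motive := fun _ => ι)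
      (Fin.lastCases (motive := fun _ => ι) (t (Fin.last m) (Fin.last n)).R
        (fun c => (t (Fin.last m) c).B) p.2)
      (fun r => Fin.lastCases (motive := fun _ => ι) (t r (Fin.last n)).T
        (fun c => (t r c).L) p.2) p.1
  let X : Config ι m n := fun E => match E with
    | .vert r c => (t r c).k
    | .ns a c => Fin.lastCases (motive := fun _ => ι) (t (Fin.last m) c).m (fun r => (t r c).i) a
    | .ew r b => Fin.lastCases (motive := fun _ => ι) (t r (Fin.last n)).j (fun c => (t r c).l) b
    | .rim p => g p
  simp only [CellLabel.leg, Prod.mk.injEq] at hv hh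
  have hL : ∀ r c, g (Fin.castSucc r, Fin.castSucc c) = (t r c).L := by simp [g]
  have hT : ∀ r c, g (Fin.castSucc r, Fin.succ c) = (t r c).T := fun r c => by
    induction c using Fin.lastCases with
    | last => simp [g]
    | cast c => rw [Fin.succ_castSucc, hL, (hh r c).2.1]
  have hB : ∀ r c, g (Fin.succ r, Fin.castSucc c) = (t r c).B := fun r c => by
    induction r using Fin.lastCases with
    | last => simp [g]
    | cast r => rw [Fin.succ_castSucc, hL, (hv r c).2.1]
  have hR : ∀ r c, g (Fin.succ r, Fin.succ c) = (t r c).R := fun r c => by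
    induction r using Fin.lastCases with
    | last =>
      induction c using Fin.lastCases with
      | last => simp [g]
      | cast c => rw [Fin.succ_castSucc, hB, (hh _ c).2.2]
    | cast r => rw [Fin.succ_castSucc, hT, (hv r c).2.2]
  refine ⟨X, g, fun _ => rfl, ?_⟩
  funext r c
  ext
  · simp [cellLabel, X]
  · induction c using Fin.lastCases with
    | last => simp [cellLabel, X]
    | cast c => simp [cellLabel, X, (hh r c).1, Fin.succ_castSucc, -Fin.castSucc_succ]
  · simp [cellLabel, X]
  · simp [cellLabel, X]
  · induction r using Fin.lastCases with
    | last => simp [cellLabel, X]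
    | cast r => simp [cellLabel, X, (hv r c).1, Fin.succ_castSucc, -Fin.castSucc_succ]
  all_goals simp [cellLabel, hL, hT, hB, hR]

theorem leg_south_eq_of_legIndex {r : Fin m} {c : Fin (n + 1)} {s t : CellLabel ι}
    (h : s.legIndex r.castSucc c .south = t.legIndex r.succ c .north) :
    s.leg .south = t.leg .north := by
  refine bondIndex_injective (a := r.castSucc.succ) ?_ h
  simp [Fin.ext_iff]
  omega

theorem leg_east_eq_of_legIndex {r : Fin (m + 1)} {c : Fin n} {s t : CellLabel ι}
    (h : s.legIndex r c.castSucc .east = t.legIndex r c.succ .west) :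
    s.leg .east = t.leg .west := by
  refine bondIndex_injective (a := c.castSucc.succ) ?_ h
  simp [Fin.ext_iff]
  omega

/-- Copying labels from a configuration to the bonds. -/
theorem contract_cellNetwork_copyTensor (κ : Fin (m + 1) → Fin (n + 1) → CellLabel ι → ℂ)
    (x : ∀ r c, Phys ι m n r c) :
    (cellNetwork fun r c => copyTensor r c (κ r c)).contract x =
      double (fun X => ∑ g : Face m n → ι,
        if ∀ p : RimFace m n, X (.rim p) = g p then ∏ r, ∏ c, κ r c (cellLabel X g r c) else 0)
        x := by
  classical
  unfold PEPS.contract double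
  let net := cellNetwork fun r c => copyTensor r c (κ r c)
  let P : ((∀ r b, Fin (net.hdim r b)) × (∀ a c, Fin (net.vdim a c))) ×
      (Fin (m + 1) → Fin (n + 1) → CellLabel ι) → Prop := fun q => ∀ r, ∀ c,
    (∀ v e, x r c v e = (q.2 r c).phys v.1 e) ∧
      net.legIndex q.1.1 q.1.2 r c = (q.2 r c).legIndex r c
  let Q : Config ι m n × (Face m n → ι) → Prop := fun q =>
    (∀ v e, x v.cell.1 v.cell.2 ⟨v, rfl⟩ e = q.1 (v.edge e)) ∧ ∀ p, q.1 (.rim p) = q.2 p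
  let φ : Config ι m n × (Face m n → ι) → ((∀ r b, Fin (net.hdim r b)) ×
      (∀ a c, Fin (net.vdim a c))) × (Fin (m + 1) → Fin (n + 1) → CellLabel ι) := fun q =>
    ((fun r b => bondIndex b (q.1 (.ew r b), q.2 (r.castSucc, b), q.2 (r.succ, b)),
      fun a c => bondIndex a (q.1 (.ns a c), q.2 (a, c.castSucc), q.2 (a, c.succ))),
      cellLabel q.1 q.2)
  -- Bond indices and cell labels that are consistent with each other and with `x` (`P`) correspond
  -- bijectively to string configurations with loop labels whose rim strings match (`Q`).
  have key := sum_ite_eq_sum_param P Q φ ?_ ?_ fun q => ∏ r, ∏ c, κ r c (q.2 r c)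
  · rw [Fintype.sum_prod_type, Fintype.sum_prod_type, Fintype.sum_prod_type] at key
    refine Eq.trans ?_ (key.trans ?_)
    · refine Finset.sum_congr rfl fun h _ => Finset.sum_congr rfl fun v _ => ?_
      obtain ⟨p, hp⟩ : ∃ p : Fin (m + 1) → Fin (n + 1) → CellLabel ι → Prop, ∀ r c t,
          p r c t ↔ (∀ v e, x r c v e = CellLabel.phys t v.1 e) ∧
            net.legIndex h v r c = t.legIndex r c := ⟨_, fun _ _ _ => Iff.rfl⟩
      have h1 : ∀ r c, copyTensor r c (κ r c) (x r c) (net.legIndex h v r c) =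
          ∑ t, if p r c t then κ r c t else 0 := fun r c =>
        Finset.sum_congr rfl fun t _ => by
          by_cases h : p r c t
          · rw [if_pos h]
            exact if_pos ((hp r c t).1 h)
          · rw [if_neg h]
            exact if_neg (mt (hp r c t).2 h)
      have h2 : ∀ t : Fin (m + 1) → Fin (n + 1) → CellLabel ι,
          P ((h, v), t) ↔ ∀ r c, p r c (t r c) := fun t =>
        forall_congr' fun r => forall_congr' fun c => (hp r c _).symm
      calc _ = ∏ r, ∏ c, ∑ t, (if p r c t then κ r c t else 0) :=
            Finset.prod_congr rfl fun r _ => Finset.prod_congr rfl fun c _ => h1 r c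
        _ = ∏ r, ∑ t : Fin (n + 1) → CellLabel ι, (if ∀ c, p r c (t c) then ∏ c, κ r c (t c)
              else 0) := Finset.prod_congr rfl fun r _ => prod_sum_ite _ _
        _ = ∑ t : Fin (m + 1) → Fin (n + 1) → CellLabel ι, if ∀ r, ∀ c, p r c (t r c) then
              ∏ r, ∏ c, κ r c (t r c) else 0 := prod_sum_ite
                (fun r (t : Fin (n + 1) → CellLabel ι) => ∀ c, p r c (t c)) _
        _ = _ := Finset.sum_congr rfl fun t _ => by
            by_cases h : P ((h, v), t)
            · rw [if_pos h, if_pos ((h2 t).1 h)]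
            · rw [if_neg h, if_neg (mt (h2 t).2 h)]
    · refine Finset.sum_congr rfl fun X _ => ?_
      split_ifs with hX
      · refine Finset.sum_congr rfl fun g _ => ?_
        simp only [Q, φ, hX, true_and, implies_true]
      · exact Finset.sum_eq_zero fun g _ => if_neg fun h => hX h.1
  · rintro ⟨X, g⟩ ⟨X', g'⟩ ⟨-, h⟩ ⟨-, h'⟩ hφ
    have ht := (Prod.ext_iff.1 hφ).2
    simp only [φ] at ht
    have hc : ∀ r c, cellLabel X g r c = cellLabel X' g' r c := fun r c => by rw [ht]
    have hg : g = g' := by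
      funext ⟨a, b⟩
      induction a using Fin.lastCases with
      | last =>
        rw [← Fin.succ_last]
        induction b using Fin.lastCases with
        | last => exact congrArg CellLabel.R (hc _ (Fin.last n))
        | cast c => exact congrArg CellLabel.B (hc _ c)
      | cast r =>
        induction b using Fin.lastCases with
        | last => exact congrArg CellLabel.T (hc r (Fin.last n))
        | cast c => exact congrArg CellLabel.L (hc r c)
    subst hg
    refine Prod.ext ?_ rfl
    funext E
    cases E with
    | vert r c => exact congrArg CellLabel.k (hc r c)
    | ns a c =>
      induction a using Fin.lastCases with
      | last => exact congrArg CellLabel.m (hc (Fin.last m) c)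
      | cast r => exact congrArg CellLabel.i (hc r c)
    | ew r b =>
      induction b using Fin.lastCases with
      | last => exact congrArg CellLabel.j (hc r (Fin.last n))
      | cast c => exact congrArg CellLabel.l (hc r c)
    | rim p => exact (h p).trans (h' p).symm
  · rintro ⟨⟨h, v⟩, t⟩
    constructor
    · intro hP
      have hP1 : ∀ r c v e, x r c v e = (t r c).phys v.1 e := fun r c => (hP r c).1
      have hP2 : ∀ r c g, net.legIndex h v r c g = (t r c).legIndex r c g :=
        fun r c g => congrFun (hP r c).2 g
      -- Adjacent cells see the same index on their common bond, which is not trivial, so their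
      -- labels agree there and glue to a configuration.
      obtain ⟨X, g, hXg, rfl⟩ := exists_config (t := t)
        (fun r c => leg_south_eq_of_legIndex
          ((hP2 r.castSucc c .south).symm.trans (hP2 r.succ c .north)))
        (fun r c => leg_east_eq_of_legIndex
          ((hP2 r c.castSucc .east).symm.trans (hP2 r c.succ .west)))
      refine ⟨(X, g), ⟨fun v e => ?_, hXg⟩, ?_⟩
      · rw [hP1, cellLabel_phys hXg]
      · refine Prod.ext (Prod.ext ?_ ?_) rfl
        · funext r b
          induction b using Fin.lastCases with
          | last => exact (hP2 r (Fin.last n) .east).symm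
          | cast c => exact (hP2 r c .west).symm
        · funext a c
          induction a using Fin.lastCases with
          | last => exact (hP2 (Fin.last m) c .south).symm
          | cast r => exact (hP2 r c .north).symm
    · rintro ⟨⟨X, g⟩, ⟨hX, hg⟩, hq⟩ r c
      simp only [φ, Prod.mk.injEq] at hq
      obtain ⟨⟨rfl, rfl⟩, rfl⟩ := hq
      refine ⟨?_, ?_⟩
      · rintro ⟨v, hv⟩ e
        obtain ⟨rfl, rfl⟩ : v.cell.1 = r ∧ v.cell.2 = c := by rw [hv]; exact ⟨rfl, rfl⟩
        exact (hX v e).trans (cellLabel_phys hg v e).symm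
      · funext g'
        cases g' <;> rfl

end

/-! ### Gram identities for the two vertices of a cell. -/

section

set_option linter.unusedSectionVars false

variable {ι : Type} [Fintype ι] [DecidableEq ι] {d : ι → ℝ} {D : ℝ}
  {Bi Bj Bk Bl Bm : ι → ι → ι → Prop} {Y Z : ι → ι → ι → ι → ι → ι → ℂ} {v u : ι → ℂ}

theorem IsBalanced.mirror (h : IsBalanced d D Bi) : IsBalanced d D fun x f f' => Bi x f' f :=
  ⟨h.right, h.left⟩

/-- The mirror image of a vertex tensor. -/
theorem IsVertexTensor.mirror (h : IsVertexTensor d Bi Bj Bk Y) :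
    IsVertexTensor d (fun x f f' => Bj x f' f) (fun x f f' => Bi x f' f) (fun x f f' => Bk x f' f)
      fun i j k L T R => Y j i k R T L where
  support _ _ _ _ _ _ h0 :=
    ⟨(h.support _ _ _ _ _ _ h0).2.1, (h.support _ _ _ _ _ _ h0).1, (h.support _ _ _ _ _ _ h0).2.2⟩
  sum_i j k L T R R' hj hk := h.sum_j j k R R' T L hj hk
  sum_j i k L L' T R hi hk := h.sum_i i k R T L L' hi hk
  sum_k i j L T T' R hi hj := h.sum_k j i R T T' L hj hi

variable (hD : 0 < D) (hd : ∀ i, 0 < d i) (hv : ∀ x, conj (v x) * v x = d x)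
  (hu : ∀ x, conj (u x) * u x = d x / D)

include hD hd hv hu

/-- The tensor of a cell is isometric from the two legs on one side of the horizontal diagonal. -/
theorem gram_vertical (hY : IsVertexTensor d Bi Bj Bk Y) (hZ : IsVertexTensor d Bl Bm Bk Z)
    (hB : IsBalanced d D Bi) {l m L R B B' : ι} (hl : Bl l L B) (hm : Bm m B R) :
    ∑ q : ι × ι × ι × ι, conj (v q.1 * v q.2.1 * v q.2.2.1 * u q.2.2.2 * v B *
        (Y q.2.1 q.2.2.1 q.1 L q.2.2.2 R * Z l m q.1 L B R)) *
      (v q.1 * v q.2.1 * v q.2.2.1 * u q.2.2.2 * v B' *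
        (Y q.2.1 q.2.2.1 q.1 L q.2.2.2 R * Z l m q.1 L B' R)) = if B = B' then 1 else 0 := by
  classical
  have hDc : (D : ℂ) ≠ 0 := by exact_mod_cast hD.ne'
  have hdB : (d B : ℂ) ≠ 0 := by exact_mod_cast (hd B).ne'
  simp only [Fintype.sum_prod_type]
  -- At fixed `k` the vertex `Y` is traced out and yields `D`, which cancels the 1/D in |u_T|². The
  -- remaining sum over `k` is the orthogonality of `Z` in the loop `B`.
  have key : ∀ k, ∑ i, ∑ j, ∑ T, conj (v k * v i * v j * u T * v B *
        (Y i j k L T R * Z l m k L B R)) *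
      (v k * v i * v j * u T * v B' * (Y i j k L T R * Z l m k L B' R)) =
      conj (v B) * v B' * ((d k : ℂ) * (conj (Z l m k L B R) * Z l m k L B' R)) := fun k => by
    have h : ∀ i j T, conj (v k * v i * v j * u T * v B * (Y i j k L T R * Z l m k L B R)) *
        (v k * v i * v j * u T * v B' * (Y i j k L T R * Z l m k L B' R)) =
        conj (v B) * v B' * ((d k : ℂ) * (conj (Z l m k L B R) * Z l m k L B' R)) / D *
          ((d i : ℂ) * d j * d T * (conj (Y i j k L T R) * Y i j k L T R)) := fun i j T => by
      rw [show ∀ a b : ℂ, conj (v B) * v B' * (d k * a) / D * (d i * d j * d T * b) =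
        conj (v B) * v B' * d k * d i * d j * (d T / D) * a * b from fun a b => by ring,
        ← hu T, ← hv k, ← hv i, ← hv j]
      simp only [map_mul]
      ring
    simp only [h, ← Finset.mul_sum, hY.sum_ijT hd hB]
    split_ifs with hk
    · rw [div_mul_cancel₀ _ hDc]
    · have : Z l m k L B R = 0 := by
        by_contra h0
        exact hk (hZ.support _ _ _ _ _ _ h0).2.2
      simp [this]
  simp only [key, ← Finset.mul_sum, hZ.sum_k l m L B B' R hl hm]
  split_ifs with h
  · subst h
    rw [hv]
    field_simp
  · simp

/-- The tensor of a cell is isometric from the two legs on one side of the vertical diagonal. -/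
theorem gram_horizontal (hY : IsVertexTensor d Bi Bj Bk Y) (hZ : IsVertexTensor d Bl Bm Bk Z)
    (hB : IsBalanced d D Bk) {j m T B R R' : ι} (hj : Bj j T R) (hm : Bm m B R) :
    ∑ q : ι × ι × ι × ι, conj (v q.1 * v q.2.2.1 * v q.2.2.2 * u q.2.1 * v R *
        (Y q.2.2.1 j q.1 q.2.1 T R * Z q.2.2.2 m q.1 q.2.1 B R)) *
      (v q.1 * v q.2.2.1 * v q.2.2.2 * u q.2.1 * v R' *
        (Y q.2.2.1 j q.1 q.2.1 T R' * Z q.2.2.2 m q.1 q.2.1 B R')) = if R = R' then 1 else 0 := by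
  classical
  have hDc : (D : ℂ) ≠ 0 := by exact_mod_cast hD.ne'
  have hdR : (d R : ℂ) ≠ 0 := by exact_mod_cast (hd R).ne'
  simp only [Fintype.sum_prod_type]
  -- Here both vertices contain the loop `R`, and the sums over `i` and `l` each give 1/d_R on the
  -- diagonal. One of these cancels against |v_R|²; the other is cancelled by the balanced sum over
  -- `k` and `L`.
  have key : ∀ k L, ∑ i, ∑ l, conj (v k * v i * v l * u L * v R *
        (Y i j k L T R * Z l m k L B R)) *
      (v k * v i * v l * u L * v R' * (Y i j k L T R' * Z l m k L B R')) =
      if R = R' then ((if Bk k L R then d k * d L else 0 : ℝ) : ℂ) * (1 / (D * d R)) else 0 :=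
        fun k L => by
    by_cases hk : Bk k L R
    · have h : ∀ i l, conj (v k * v i * v l * u L * v R * (Y i j k L T R * Z l m k L B R)) *
          (v k * v i * v l * u L * v R' * (Y i j k L T R' * Z l m k L B R')) =
          conj (v R) * v R' * (d k * d L) / D *
            (((d i : ℂ) * (conj (Y i j k L T R) * Y i j k L T R')) *
            ((d l : ℂ) * (conj (Z l m k L B R) * Z l m k L B R'))) := fun i l => by
        rw [show ∀ a b : ℂ, conj (v R) * v R' * (d k * d L) / D * ((d i * a) * (d l * b)) =
          conj (v R) * v R' * d k * d i * d l * (d L / D) * a * b from fun a b => by ring,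
          ← hu L, ← hv k, ← hv i, ← hv l]
        simp only [map_mul]
        ring
      simp only [h, ← Finset.mul_sum]
      rw [← Finset.sum_mul, hY.sum_i _ _ _ _ _ _ hj hk, hZ.sum_i _ _ _ _ _ _ hm hk, if_pos hk]
      split_ifs with hR
      · subst hR
        rw [hv]
        push_cast
        field_simp
      · simp
    · have : ∀ i, Y i j k L T R = 0 := fun i => by
        by_contra h0
        exact hk (hY.support _ _ _ _ _ _ h0).2.2
      simp [this, hk]
  simp only [key]
  split_ifs with hR
  · simp only [← Finset.sum_mul, ← Complex.ofReal_sum, hB.right]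
    push_cast
    field_simp
  · simp

/-- The tensor of a cell is isometric from one leg. -/
theorem gram_arm (hY : IsVertexTensor d Bi Bj Bk Y) (hZ : IsVertexTensor d Bl Bm Bk Z)
    (hB : IsBalanced d D Bi) (hB' : IsBalanced d D Bm) {l L B : ι} (hl : Bl l L B) :
    ∑ q : ι × ι × ι × ι × ι × ι,
      conj (v q.2.1 * v q.2.2.2.1 * v q.2.2.2.2.1 * v q.1 * u q.2.2.2.2.2 * u q.2.2.1 *
        (Y q.2.2.2.1 q.2.2.2.2.1 q.2.1 L q.2.2.2.2.2 q.2.2.1 * Z l q.1 q.2.1 L B q.2.2.1)) *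
      (v q.2.1 * v q.2.2.2.1 * v q.2.2.2.2.1 * v q.1 * u q.2.2.2.2.2 * u q.2.2.1 *
        (Y q.2.2.2.1 q.2.2.2.2.1 q.2.1 L q.2.2.2.2.2 q.2.2.1 * Z l q.1 q.2.1 L B q.2.2.1)) = 1 := by
  classical
  have hDc : (D : ℂ) ≠ 0 := by exact_mod_cast hD.ne'
  -- Both vertices are traced out, `Y` from the vertical string and then `Z` from the leg `l`. This
  -- gives D², which cancels the two factors 1/D in |u_T|² and |u_R|².
  simp only [Fintype.sum_prod_type]
  have key : ∀ m k R, ∑ i, ∑ j, ∑ T, conj (v k * v i * v j * v m * u T * u R *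
        (Y i j k L T R * Z l m k L B R)) *
      (v k * v i * v j * v m * u T * u R * (Y i j k L T R * Z l m k L B R)) =
      (1 / D) * ((d m : ℂ) * d k * d R * (conj (Z l m k L B R) * Z l m k L B R)) :=
        fun m k R => by
    have h : ∀ i j T, conj (v k * v i * v j * v m * u T * u R *
        (Y i j k L T R * Z l m k L B R)) *
      (v k * v i * v j * v m * u T * u R * (Y i j k L T R * Z l m k L B R)) =
        (1 / D) * ((d m : ℂ) * d k * d R * (conj (Z l m k L B R) * Z l m k L B R)) / D *
          ((d i : ℂ) * d j * d T * (conj (Y i j k L T R) * Y i j k L T R)) := fun i j T => by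
      rw [show ∀ a b : ℂ, (1 / D) * (d m * d k * d R * a) / D * (d i * d j * d T * b) =
        d m * d k * (d R / D) * d i * d j * (d T / D) * a * b from fun a b => by ring,
        ← hu T, ← hu R, ← hv k, ← hv i, ← hv j, ← hv m]
      simp only [map_mul]
      ring
    simp only [h, ← Finset.mul_sum, hY.sum_ijT hd hB]
    split_ifs with hk
    · rw [div_mul_cancel₀ _ hDc]
    · have : Z l m k L B R = 0 := by
        by_contra h0
        exact hk (hZ.support _ _ _ _ _ _ h0).2.2
      simp [this]
  simp only [key, ← Finset.mul_sum, hZ.sum_jkR hd hB' hl]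
  field_simp

end

theorem Leg.forall_iff {p : Leg → Prop} :
    (∀ g, p g) ↔ p .north ∧ p .east ∧ p .south ∧ p .west :=
  ⟨fun h => ⟨h _, h _, h _, h _⟩, fun h g => by cases g <;> simp [h]⟩

/-! ### The weights of a cell and its Gram matrix for every set of outgoing legs. -/

section

set_option linter.unusedSectionVars false

variable {ι : Type} [Fintype ι] [DecidableEq ι]

/-- The weight of a loop label at the corner between the legs `a` and `b`. -/
def faceWeight (v u : ι → ℂ) (out : Finset Leg) (a b : Leg) (f : ι) : ℂ :=
  if a ∈ out then (if b ∈ out then v f else 1) else if b ∈ out then 1 else u f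

/-- The weight of the labels at a cell, when the labels of the outgoing legs are those that have
been generated by cells closer to the orthogonality center. -/
def cellWeight (v u : ι → ℂ) (out : Finset Leg) (t : CellLabel ι) : ℂ :=
  v t.k * (∏ g, if g ∈ out then 1 else v (t.leg g).1) *
    (faceWeight v u out .north .west t.L * faceWeight v u out .north .east t.T *
      faceWeight v u out .south .west t.B * faceWeight v u out .south .east t.R)

/-- The amplitude of the labels at a cell. -/
def cellAmplitude (v u : ι → ℂ) (Y Z : ι → ι → ι → ι → ι → ι → ℂ) (out : Finset Leg)
    (t : CellLabel ι) : ℂ :=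
  cellWeight v u out t * (Y t.i t.j t.k t.L t.T t.R * Z t.l t.m t.k t.L t.B t.R)

namespace CellLabel

/-- The branching rule on a leg. -/
def LegRel (Bns Bew : ι → ι → ι → Prop) (t : CellLabel ι) : Leg → Prop
  | .north => Bns t.i t.L t.T
  | .east => Bew t.j t.T t.R
  | .south => Bns t.m t.B t.R
  | .west => Bew t.l t.L t.B

/-- The strings, and the loops at the legs that are not outgoing, are the same. -/
def SameRecord (out : Finset Leg) (t t' : CellLabel ι) : Prop :=
  (t.i = t'.i ∧ t.j = t'.j ∧ t.k = t'.k ∧ t.l = t'.l ∧ t.m = t'.m) ∧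
    ∀ g, g ∉ out → t.leg g = t'.leg g

end CellLabel

variable {d : ι → ℝ} {D : ℝ} {Bns Bew Bk : ι → ι → ι → Prop}
  {Y Z : ι → ι → ι → ι → ι → ι → ℂ} {v u : ι → ℂ}

theorem leg_prod {M : Type*} [CommMonoid M] (f : Leg → M) :
    ∏ g, f g = f .north * f .east * f .south * f .west := by
  rw [show (Finset.univ : Finset Leg) = {Leg.north, Leg.east, Leg.south, Leg.west} from rfl]
  simp [mul_assoc]

open CellLabel

variable (hD : 0 < D) (hd : ∀ i, 0 < d i) (hv : ∀ x, conj (v x) * v x = d x)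
  (hu : ∀ x, conj (u x) * u x = d x / D)
  (hY : IsVertexTensor d Bns Bew Bk Y) (hZ : IsVertexTensor d Bew Bns Bk Z)
  (hns : IsBalanced d D Bns) (hew : IsBalanced d D Bew) (hk : IsBalanced d D Bk)

/-- The overlap of two columns of the tensor of a cell. -/
noncomputable def labelGram (κ : CellLabel ι → ℂ) (out : Finset Leg) (s s' : CellLabel ι) : ℂ :=
  open scoped Classical in
  ∑ q : CellLabel ι × CellLabel ι, if q.1.SameRecord out q.2 ∧ (∀ g ∈ out, q.1.leg g = s.leg g) ∧
    ∀ g ∈ out, q.2.leg g = s'.leg g then conj (κ q.1) * κ q.2 else 0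

include hD hd hv hu hY hZ hns hew hk

/-- All strings are recorded physically, and the legs that are not outgoing record every loop except
the corner `B` between the two outgoing legs. Labels with different records give zero on both sides;
otherwise the pairs in the sum are parametrized by `k`, `i`, `j`, `T`, and the sum is that of
`gram_vertical`. -/
theorem labelGram_south_west {s s' : CellLabel ι}
    (hs : ∀ g ∈ ({.south, .west} : Finset Leg), s.LegRel Bns Bew g) :
    labelGram (cellAmplitude v u Y Z {.south, .west}) {.south, .west} s s' =
      if ∀ g ∈ ({.south, .west} : Finset Leg), s.leg g = s'.leg g then 1 else 0 := by
  classical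
  unfold labelGram
  simp only [Finset.mem_insert, Finset.mem_singleton, forall_eq_or_imp, forall_eq, LegRel] at hs
  by_cases hc : s.l = s'.l ∧ s.m = s'.m ∧ s.L = s'.L ∧ s.R = s'.R
  · rw [sum_ite_eq_sum_range _ (fun q : ι × ι × ι × ι =>
      ((⟨q.2.1, q.2.2.1, q.1, s.l, s.m, s.L, q.2.2.2, s.B, s.R⟩ : CellLabel ι),
       (⟨q.2.1, q.2.2.1, q.1, s.l, s.m, s.L, q.2.2.2, s'.B, s.R⟩ : CellLabel ι)))]
    · refine Eq.trans (Finset.sum_congr rfl fun q _ => ?_)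
        ((gram_vertical hD hd hv hu hY hZ hns (B' := s'.B) hs.2 hs.1).trans ?_)
      · simp only [cellAmplitude, cellWeight, faceWeight, leg_prod, leg, Finset.mem_insert,
          Finset.mem_singleton, reduceCtorEq, or_true, or_false, if_true, if_false,
          map_mul, map_one]
        ring
      · simp [leg, hc]
    · intro q q' h
      simp at h
      ext <;> simp [h]
    · rintro ⟨⟨i, j, k, l, m, L, T, B, R⟩, ⟨i', j', k', l', m', L', T', B', R'⟩⟩
      simp [SameRecord, leg, Leg.forall_iff]
      grind
  · rw [if_neg]
    · refine Finset.sum_eq_zero fun q _ => if_neg ?_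
      simp [SameRecord, leg, Leg.forall_iff]
      grind
    · simp [leg]
      grind

/-- Turning the cell upside down exchanges `Y` with `Z` and `B` with `T`. -/
theorem labelGram_north_east {s s' : CellLabel ι}
    (hs : ∀ g ∈ ({.north, .east} : Finset Leg), s.LegRel Bns Bew g) :
    labelGram (cellAmplitude v u Y Z {.north, .east}) {.north, .east} s s' =
      if ∀ g ∈ ({.north, .east} : Finset Leg), s.leg g = s'.leg g then 1 else 0 := by
  classical
  unfold labelGram
  simp only [Finset.mem_insert, Finset.mem_singleton, forall_eq_or_imp, forall_eq, LegRel] at hs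
  by_cases hc : s.i = s'.i ∧ s.j = s'.j ∧ s.L = s'.L ∧ s.R = s'.R
  · rw [sum_ite_eq_sum_range _ (fun q : ι × ι × ι × ι =>
      ((⟨s.i, s.j, q.1, q.2.1, q.2.2.1, s.L, s.T, q.2.2.2, s.R⟩ : CellLabel ι),
       (⟨s.i, s.j, q.1, q.2.1, q.2.2.1, s.L, s'.T, q.2.2.2, s.R⟩ : CellLabel ι)))]
    · refine Eq.trans (Finset.sum_congr rfl fun q _ => ?_)
        ((gram_vertical hD hd hv hu hZ hY hew (B' := s'.T) hs.1 hs.2).trans ?_)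
      · simp only [cellAmplitude, cellWeight, faceWeight, leg_prod, leg, Finset.mem_insert,
          Finset.mem_singleton, reduceCtorEq, or_true, or_false, if_true, if_false,
          map_mul, map_one]
        ring
      · simp [leg, hc]
    · intro q q' h
      simp at h
      ext <;> simp [h]
    · rintro ⟨⟨i, j, k, l, m, L, T, B, R⟩, ⟨i', j', k', l', m', L', T', B', R'⟩⟩
      simp [SameRecord, leg, Leg.forall_iff]
      grind
  · rw [if_neg]
    · refine Finset.sum_eq_zero fun q _ => if_neg ?_
      simp [SameRecord, leg, Leg.forall_iff]
      grind
    · simp [leg]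
      grind

/-- The corner `R` between the outgoing legs belongs to both vertices, so the identity is that of
`gram_horizontal`. -/
theorem labelGram_south_east {s s' : CellLabel ι}
    (hs : ∀ g ∈ ({.south, .east} : Finset Leg), s.LegRel Bns Bew g) :
    labelGram (cellAmplitude v u Y Z {.south, .east}) {.south, .east} s s' =
      if ∀ g ∈ ({.south, .east} : Finset Leg), s.leg g = s'.leg g then 1 else 0 := by
  classical
  unfold labelGram
  simp only [Finset.mem_insert, Finset.mem_singleton, forall_eq_or_imp, forall_eq, LegRel] at hs
  by_cases hc : s.j = s'.j ∧ s.m = s'.m ∧ s.T = s'.T ∧ s.B = s'.B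
  · rw [sum_ite_eq_sum_range _ (fun q : ι × ι × ι × ι =>
      ((⟨q.2.2.1, s.j, q.1, q.2.2.2, s.m, q.2.1, s.T, s.B, s.R⟩ : CellLabel ι),
       (⟨q.2.2.1, s.j, q.1, q.2.2.2, s.m, q.2.1, s.T, s.B, s'.R⟩ : CellLabel ι)))]
    · refine Eq.trans (Finset.sum_congr rfl fun q _ => ?_)
        ((gram_horizontal hD hd hv hu hY hZ hk (R' := s'.R) hs.2 hs.1).trans ?_)
      · simp only [cellAmplitude, cellWeight, faceWeight, leg_prod, leg, Finset.mem_insert,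
          Finset.mem_singleton, reduceCtorEq, or_true, or_false, if_true, if_false,
          map_mul, map_one]
        ring
      · simp [leg, hc]
    · intro q q' h
      simp at h
      ext <;> simp [h]
    · rintro ⟨⟨i, j, k, l, m, L, T, B, R⟩, ⟨i', j', k', l', m', L', T', B', R'⟩⟩
      simp [SameRecord, leg, Leg.forall_iff]
      grind
  · rw [if_neg]
    · refine Finset.sum_eq_zero fun q _ => if_neg ?_
      simp [SameRecord, leg, Leg.forall_iff]
      grind
    · simp [leg]
      grind

/-- The left-right mirror image of the case of south and east. -/
theorem labelGram_north_west {s s' : CellLabel ι}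
    (hs : ∀ g ∈ ({.north, .west} : Finset Leg), s.LegRel Bns Bew g) :
    labelGram (cellAmplitude v u Y Z {.north, .west}) {.north, .west} s s' =
      if ∀ g ∈ ({.north, .west} : Finset Leg), s.leg g = s'.leg g then 1 else 0 := by
  classical
  unfold labelGram
  simp only [Finset.mem_insert, Finset.mem_singleton, forall_eq_or_imp, forall_eq, LegRel] at hs
  by_cases hc : s.i = s'.i ∧ s.l = s'.l ∧ s.T = s'.T ∧ s.B = s'.B
  · rw [sum_ite_eq_sum_range _ (fun q : ι × ι × ι × ι =>
      ((⟨s.i, q.2.2.1, q.1, s.l, q.2.2.2, s.L, s.T, s.B, q.2.1⟩ : CellLabel ι),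
       (⟨s.i, q.2.2.1, q.1, s.l, q.2.2.2, s'.L, s.T, s.B, q.2.1⟩ : CellLabel ι)))]
    · refine Eq.trans (Finset.sum_congr rfl fun q _ => ?_)
        ((gram_horizontal hD hd hv hu hY.mirror hZ.mirror hk.mirror (R' := s'.L) hs.1 hs.2).trans ?_)
      · simp only [cellAmplitude, cellWeight, faceWeight, leg_prod, leg, Finset.mem_insert,
          Finset.mem_singleton, reduceCtorEq, or_true, or_false, if_true, if_false,
          map_mul, map_one]
        ring
      · simp [leg, hc]
    · intro q q' h
      simp at h
      ext <;> simp [h]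
    · rintro ⟨⟨i, j, k, l, m, L, T, B, R⟩, ⟨i', j', k', l', m', L', T', B', R'⟩⟩
      simp [SameRecord, leg, Leg.forall_iff]
      grind
  · rw [if_neg]
    · refine Finset.sum_eq_zero fun q _ => if_neg ?_
      simp [SameRecord, leg, Leg.forall_iff]
      grind
    · simp [leg]
      grind

/-- With a single outgoing leg, the three others record all four loops. Different columns are
therefore orthogonal, and only the norm remains, which is `gram_arm`. The other three directions
follow by exchanging `Y` with `Z`, by the mirror image, or by both. -/
theorem labelGram_west {s s' : CellLabel ι}
    (hs : ∀ g ∈ ({.west} : Finset Leg), s.LegRel Bns Bew g) :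
    labelGram (cellAmplitude v u Y Z {.west}) {.west} s s' =
      if ∀ g ∈ ({.west} : Finset Leg), s.leg g = s'.leg g then 1 else 0 := by
  classical
  unfold labelGram
  simp only [Finset.mem_singleton, forall_eq, LegRel] at hs
  by_cases hc : s.l = s'.l ∧ s.L = s'.L ∧ s.B = s'.B
  · rw [sum_ite_eq_sum_range _ (fun q : ι × ι × ι × ι × ι × ι =>
      ((⟨q.2.2.2.1, q.2.2.2.2.1, q.2.1, s.l, q.1, s.L, q.2.2.2.2.2, s.B, q.2.2.1⟩ :
        CellLabel ι),
       (⟨q.2.2.2.1, q.2.2.2.2.1, q.2.1, s.l, q.1, s.L, q.2.2.2.2.2, s.B, q.2.2.1⟩ :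
        CellLabel ι)))]
    · refine Eq.trans (Finset.sum_congr rfl fun q _ => ?_)
        ((gram_arm hD hd hv hu hY hZ hns hns hs).trans ?_)
      · simp only [cellAmplitude, cellWeight, faceWeight, leg_prod, leg,
          Finset.mem_singleton, reduceCtorEq, if_true, if_false,
          map_mul, map_one]
        ring
      · simp [leg, hc]
    · intro q q' h
      simp at h
      ext <;> simp [h]
    · rintro ⟨⟨i, j, k, l, m, L, T, B, R⟩, ⟨i', j', k', l', m', L', T', B', R'⟩⟩
      simp [SameRecord, leg, Leg.forall_iff]
      grind
  · rw [if_neg]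
    · refine Finset.sum_eq_zero fun q _ => if_neg ?_
      simp [SameRecord, leg, Leg.forall_iff]
      grind
    · simp [leg]
      grind

theorem labelGram_north {s s' : CellLabel ι}
    (hs : ∀ g ∈ ({.north} : Finset Leg), s.LegRel Bns Bew g) :
    labelGram (cellAmplitude v u Y Z {.north}) {.north} s s' =
      if ∀ g ∈ ({.north} : Finset Leg), s.leg g = s'.leg g then 1 else 0 := by
  classical
  unfold labelGram
  simp only [Finset.mem_singleton, forall_eq, LegRel] at hs
  by_cases hc : s.i = s'.i ∧ s.L = s'.L ∧ s.T = s'.T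
  · rw [sum_ite_eq_sum_range _ (fun q : ι × ι × ι × ι × ι × ι =>
      ((⟨s.i, q.1, q.2.1, q.2.2.2.1, q.2.2.2.2.1, s.L, s.T, q.2.2.2.2.2, q.2.2.1⟩ :
        CellLabel ι),
       (⟨s.i, q.1, q.2.1, q.2.2.2.1, q.2.2.2.2.1, s.L, s.T, q.2.2.2.2.2, q.2.2.1⟩ :
        CellLabel ι)))]
    · refine Eq.trans (Finset.sum_congr rfl fun q _ => ?_)
        ((gram_arm hD hd hv hu hZ hY hew hew hs).trans ?_)
      · simp only [cellAmplitude, cellWeight, faceWeight, leg_prod, leg,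
          Finset.mem_singleton, reduceCtorEq, if_true, if_false,
          map_mul, map_one]
        ring
      · simp [leg, hc]
    · intro q q' h
      simp at h
      ext <;> simp [h]
    · rintro ⟨⟨i, j, k, l, m, L, T, B, R⟩, ⟨i', j', k', l', m', L', T', B', R'⟩⟩
      simp [SameRecord, leg, Leg.forall_iff]
      grind
  · rw [if_neg]
    · refine Finset.sum_eq_zero fun q _ => if_neg ?_
      simp [SameRecord, leg, Leg.forall_iff]
      grind
    · simp [leg]
      grind

theorem labelGram_south {s s' : CellLabel ι}
    (hs : ∀ g ∈ ({.south} : Finset Leg), s.LegRel Bns Bew g) :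
    labelGram (cellAmplitude v u Y Z {.south}) {.south} s s' =
      if ∀ g ∈ ({.south} : Finset Leg), s.leg g = s'.leg g then 1 else 0 := by
  classical
  unfold labelGram
  simp only [Finset.mem_singleton, forall_eq, LegRel] at hs
  by_cases hc : s.m = s'.m ∧ s.B = s'.B ∧ s.R = s'.R
  · rw [sum_ite_eq_sum_range _ (fun q : ι × ι × ι × ι × ι × ι =>
      ((⟨q.2.2.2.2.1, q.2.2.2.1, q.2.1, q.1, s.m, q.2.2.1, q.2.2.2.2.2, s.B, s.R⟩ :
        CellLabel ι),
       (⟨q.2.2.2.2.1, q.2.2.2.1, q.2.1, q.1, s.m, q.2.2.1, q.2.2.2.2.2, s.B, s.R⟩ :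
        CellLabel ι)))]
    · refine Eq.trans (Finset.sum_congr rfl fun q _ => ?_)
        ((gram_arm hD hd hv hu hY.mirror hZ.mirror hew.mirror hew.mirror hs).trans ?_)
      · simp only [cellAmplitude, cellWeight, faceWeight, leg_prod, leg,
          Finset.mem_singleton, reduceCtorEq, if_true, if_false,
          map_mul, map_one]
        ring
      · simp [leg, hc]
    · intro q q' h
      simp at h
      ext <;> simp [h]
    · rintro ⟨⟨i, j, k, l, m, L, T, B, R⟩, ⟨i', j', k', l', m', L', T', B', R'⟩⟩
      simp [SameRecord, leg, Leg.forall_iff]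
      grind
  · rw [if_neg]
    · refine Finset.sum_eq_zero fun q _ => if_neg ?_
      simp [SameRecord, leg, Leg.forall_iff]
      grind
    · simp [leg]
      grind

theorem labelGram_east {s s' : CellLabel ι}
    (hs : ∀ g ∈ ({.east} : Finset Leg), s.LegRel Bns Bew g) :
    labelGram (cellAmplitude v u Y Z {.east}) {.east} s s' =
      if ∀ g ∈ ({.east} : Finset Leg), s.leg g = s'.leg g then 1 else 0 := by
  classical
  unfold labelGram
  simp only [Finset.mem_singleton, forall_eq, LegRel] at hs
  by_cases hc : s.j = s'.j ∧ s.T = s'.T ∧ s.R = s'.R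
  · rw [sum_ite_eq_sum_range _ (fun q : ι × ι × ι × ι × ι × ι =>
      ((⟨q.1, s.j, q.2.1, q.2.2.2.2.1, q.2.2.2.1, q.2.2.1, s.T, q.2.2.2.2.2, s.R⟩ :
        CellLabel ι),
       (⟨q.1, s.j, q.2.1, q.2.2.2.2.1, q.2.2.2.1, q.2.2.1, s.T, q.2.2.2.2.2, s.R⟩ :
        CellLabel ι)))]
    · refine Eq.trans (Finset.sum_congr rfl fun q _ => ?_)
        ((gram_arm hD hd hv hu hZ.mirror hY.mirror hns.mirror hns.mirror hs).trans ?_)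
      · simp only [cellAmplitude, cellWeight, faceWeight, leg_prod, leg,
          Finset.mem_singleton, reduceCtorEq, if_true, if_false,
          map_mul, map_one]
        ring
      · simp [leg, hc]
    · intro q q' h
      simp at h
      ext <;> simp [h]
    · rintro ⟨⟨i, j, k, l, m, L, T, B, R⟩, ⟨i', j', k', l', m', L', T', B', R'⟩⟩
      simp [SameRecord, leg, Leg.forall_iff]
      grind
  · rw [if_neg]
    · refine Finset.sum_eq_zero fun q _ => if_neg ?_
      simp [SameRecord, leg, Leg.forall_iff]
      grind
    · simp [leg]
      grind

end

/-! ### Completion of the copy tensors to isometries. -/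

section

set_option linter.unusedSectionVars false

theorem sum_conj_mul_fiber {α β : Type*} [Fintype α] [DecidableEq α] [Fintype β] (ρ : β → α)
    (p p' : β → Prop) [DecidablePred p] [DecidablePred p'] (κ : β → ℂ) :
    ∑ x, conj (∑ t, if x = ρ t ∧ p t then κ t else 0) * (∑ t, if x = ρ t ∧ p' t then κ t else 0) =
      ∑ q : β × β, if ρ q.1 = ρ q.2 ∧ p q.1 ∧ p' q.2 then conj (κ q.1) * κ q.2 else 0 := by
  simp only [map_sum, Finset.sum_mul_sum, Fintype.sum_prod_type]
  rw [Finset.sum_comm]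
  refine Finset.sum_congr rfl fun t _ => ?_
  rw [Finset.sum_comm]
  refine Finset.sum_congr rfl fun t' _ => ?_
  rw [Finset.sum_eq_single (ρ t)]
  · by_cases h1 : p t <;> by_cases h2 : ρ t = ρ t' <;> by_cases h3 : p' t' <;> simp [h1, h2, h3]
  · intro x _ hx
    simp [hx]
  · simp

variable {ι : Type} [Fintype ι] [DecidableEq ι] {m n : ℕ} {r r₀ : Fin (m + 1)} {c c₀ : Fin (n + 1)}

theorem outLegs_cases (h : (r, c) ≠ (r₀, c₀)) :
    outLegs r₀ r c₀ c = {.south, .east} ∨ outLegs r₀ r c₀ c = {.south, .west} ∨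
    outLegs r₀ r c₀ c = {.north, .east} ∨ outLegs r₀ r c₀ c = {.north, .west} ∨
    outLegs r₀ r c₀ c = {.south} ∨ outLegs r₀ r c₀ c = {.north} ∨
    outLegs r₀ r c₀ c = {.east} ∨ outLegs r₀ r c₀ c = {.west} := by
  rcases lt_trichotomy r r₀ with hr | rfl | hr <;> rcases lt_trichotomy c c₀ with hc | rfl | hc
  all_goals first | exact (h rfl).elim | skip
  all_goals clear h
  all_goals try have hr' := lt_asymm hr
  all_goals try have hc' := lt_asymm hc
  all_goals simp only [outLegs, *, lt_irrefl, if_true, if_false]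
  all_goals decide

theorem mem_outLegs (g : Leg) : g ∈ outLegs r₀ r c₀ c ↔ match g with
    | .north => r₀ < r
    | .east => c < c₀
    | .south => r < r₀
    | .west => c₀ < c := by
  cases g <;> simp [outLegs] <;> split_ifs <;> simp_all

/-- The leg is not trivial. -/
def Interior (r : Fin (m + 1)) (c : Fin (n + 1)) : Leg → Prop
  | .north => r ≠ 0
  | .east => c ≠ Fin.last n
  | .south => r ≠ Fin.last m
  | .west => c ≠ 0

/-- Outgoing legs point towards the center and so never leave the patch. -/
theorem interior_of_mem_outLegs {g : Leg} (h : g ∈ outLegs r₀ r c₀ c) : Interior r c g := by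
  rw [mem_outLegs] at h
  cases g
  · exact ((Fin.zero_le _).trans_lt h).ne'
  · exact (h.trans_le (Fin.le_last _)).ne
  · exact (h.trans_le (Fin.le_last _)).ne
  · exact ((Fin.zero_le _).trans_lt h).ne'

theorem CellLabel.legIndex_eq_iff {g : Leg} (h : Interior r c g) {s t : CellLabel ι} :
    s.legIndex r c g = t.legIndex r c g ↔ s.leg g = t.leg g := by
  refine ⟨fun h' => ?_, fun h' => by cases g <;> exact congrArg (bondIndex _) h'⟩
  cases g
  · refine bondIndex_injective (a := r.castSucc) ?_ h'
    simpa [Interior, Fin.castSucc_ne_last] using h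
  · refine bondIndex_injective (a := c.succ) ?_ h'
    simpa [Interior] using h
  · refine bondIndex_injective (a := r.succ) ?_ h'
    simpa [Interior] using h
  · refine bondIndex_injective (a := c.castSucc) ?_ h'
    simpa [Interior, Fin.castSucc_ne_last] using h

/-- A leg across the boundary has no index, but the boundary vertex belonging to the cell displays
its string and both loops, the latter through the rim strings. So the row index of the tensor
retains the labels of all legs that are not outgoing. -/
theorem CellLabel.sameRecord_iff {out : Finset Leg} (hout : ∀ g ∈ out, Interior r c g)
    (t t' : CellLabel ι) :
    (((fun v e => t.phys v.1 e : Phys ι m n r c),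
      fun g : {g // g ∉ out} => t.legIndex r c g.1) =
      ((fun v e => t'.phys v.1 e : Phys ι m n r c),
      fun g : {g // g ∉ out} => t'.legIndex r c g.1)) ↔ t.SameRecord out t' := by
  constructor
  · intro h
    have h1 : ∀ (v : Vertex m n) (_ : v.cell = (r, c)) e, t.phys v e = t'.phys v e :=
      fun v hv e => congrFun (congrFun (Prod.ext_iff.1 h).1 ⟨v, hv⟩) e
    have h2 : ∀ g (_ : g ∉ out), t.legIndex r c g = t'.legIndex r c g :=
      fun g hg => congrFun (Prod.ext_iff.1 h).2 ⟨g, hg⟩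
    have hi : t.i = t'.i := h1 (.up r c) rfl 0
    have hk : t.k = t'.k := h1 (.up r c) rfl 1
    have hj : t.j = t'.j := h1 (.up r c) rfl 2
    have hl : t.l = t'.l := h1 (.dn r c) rfl 1
    have hm : t.m = t'.m := h1 (.dn r c) rfl 2
    refine ⟨⟨hi, hj, hk, hl, hm⟩, fun g hg => ?_⟩
    by_cases hI : Interior r c g
    · exact (legIndex_eq_iff hI).1 (h2 g hg)
    · cases g <;> simp only [Interior, not_not] at hI <;> subst hI
      · exact Prod.ext hi (Prod.ext (h1 (.bN c) rfl 1) (h1 (.bN c) rfl 0))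
      · exact Prod.ext hj (Prod.ext (h1 (.bE r) rfl 0) (h1 (.bE r) rfl 2))
      · exact Prod.ext hm (Prod.ext (h1 (.bS c) rfl 1) (h1 (.bS c) rfl 2))
      · exact Prod.ext hl (Prod.ext (h1 (.bW r) rfl 0) (h1 (.bW r) rfl 1))
  · rintro ⟨⟨hi, hj, hk, hl, hm⟩, h⟩
    refine Prod.ext ?_ ?_
    · funext ⟨v, hv⟩ e
      have hg : ∀ g, ¬ Interior r c g → t.leg g = t'.leg g := fun g hg => h g fun h' =>
        hg (hout g h')
      cases v <;> simp only [Vertex.cell, Prod.mk.injEq] at hv <;> obtain ⟨rfl, rfl⟩ := hv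
      · fin_cases e <;> simp [phys, hi, hj, hk]
      · fin_cases e <;> simp [phys, hl, hm, hk]
      · have := hg .north (by simp [Interior])
        simp only [leg, Prod.mk.injEq] at this
        fin_cases e <;> simp [phys, this]
      · have := hg .east (by simp [Interior])
        simp only [leg, Prod.mk.injEq] at this
        fin_cases e <;> simp [phys, this]
      · have := hg .south (by simp [Interior])
        simp only [leg, Prod.mk.injEq] at this
        fin_cases e <;> simp [phys, this]
      · have := hg .west (by simp [Interior])
        simp only [leg, Prod.mk.injEq] at this
        fin_cases e <;> simp [phys, this]
    · funext ⟨g, hg⟩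
      have := h g hg
      cases g <;> exact congrArg (bondIndex _) this

/-- A row index fixes the record, so the overlap of two columns runs over pairs of labels with equal
records and the prescribed outgoing legs. -/
theorem gram_copyTensor {out : Finset Leg} (hout : ∀ g ∈ out, Interior r c g)
    (κ : CellLabel ι → ℂ) (s s' : CellLabel ι) :
    ∑ x, conj (legMatrix (copyTensor (m := m) (n := n) r c κ) out x fun g => s.legIndex r c g.1) *
      legMatrix (copyTensor (m := m) (n := n) r c κ) out x (fun g => s'.legIndex r c g.1) =
      labelGram κ out s s' := by
  classical
  have h : ∀ (s : CellLabel ι) x,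
      legMatrix (copyTensor (m := m) (n := n) r c κ) out x (fun g => s.legIndex r c g.1) =
      ∑ t : CellLabel ι, if x = ((fun v e => t.phys v.1 e : Phys ι m n r c),
        fun g : {g // g ∉ out} => t.legIndex r c g.1) ∧ (∀ g ∈ out, t.leg g = s.leg g)
        then κ t else 0 := by
    rintro s ⟨x, y⟩
    unfold legMatrix copyTensor
    refine Finset.sum_congr rfl fun t _ => ?_
    have : ((∀ v e, x v e = t.phys v.1 e) ∧ (fun g => if hg : g ∈ out then s.legIndex r c g
        else y ⟨g, hg⟩) = t.legIndex r c) ↔ ((x, y) = ((fun v e => t.phys v.1 e : Phys ι m n r c),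
        fun g : {g // g ∉ out} => t.legIndex r c g.1) ∧ (∀ g ∈ out, t.leg g = s.leg g)) := by
      rw [Prod.mk.injEq, and_assoc]
      refine and_congr ⟨fun h => funext fun v => funext fun e => h v e,
        fun h v e => by rw [h]⟩ ?_
      constructor
      · intro h
        refine ⟨funext fun g => ?_, fun g hg => ?_⟩
        · rw [← h]
          simp [g.2]
        · rw [← CellLabel.legIndex_eq_iff (hout g hg), ← h]
          simp [hg]
      · rintro ⟨h1, h2⟩
        funext g
        split_ifs with hg
        · exact ((CellLabel.legIndex_eq_iff (hout g hg)).2 (h2 g hg)).symm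
        · rw [h1]
    by_cases hc : (x, y) = ((fun v e => t.phys v.1 e : Phys ι m n r c),
        fun g : {g // g ∉ out} => t.legIndex r c g.1) ∧ (∀ g ∈ out, t.leg g = s.leg g)
    · rw [if_pos hc]
      exact if_pos (this.2 hc)
    · rw [if_neg hc]
      exact if_neg (mt this.1 hc)
  simp only [h]
  rw [sum_conj_mul_fiber]
  unfold labelGram
  refine Finset.sum_congr rfl fun q _ => ?_
  simp only [CellLabel.sameRecord_iff hout]

/-- Completion to an isometry needs at least as many rows as columns. Two outgoing legs have at most
|ι|⁶ values, and the two vertices of the cell alone have |ι|⁶ physical values; here the doubling of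
the edges is used. -/
theorem card_out_le [Nonempty ι] {out : Finset Leg} (hout : out.card ≤ 2) :
    Fintype.card (∀ g : {g // g ∈ out}, Fin (legDim
      (fun (_ : Fin (m + 1)) (b : Fin (n + 2)) => bondDim (Fintype.card (ι × ι × ι)) b)
      (fun (a : Fin (m + 2)) (_ : Fin (n + 1)) => bondDim (Fintype.card (ι × ι × ι)) a) r c g)) ≤
    Fintype.card (Phys ι m n r c × ∀ g : {g // g ∉ out}, Fin (legDim
      (fun (_ : Fin (m + 1)) (b : Fin (n + 2)) => bondDim (Fintype.card (ι × ι × ι)) b)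
      (fun (a : Fin (m + 2)) (_ : Fin (n + 1)) => bondDim (Fintype.card (ι × ι × ι)) a) r c g)) := by
  have hK : 0 < Fintype.card (ι × ι × ι) := Fintype.card_pos
  have hb : ∀ {b : ℕ} (a : Fin (b + 2)), 0 < bondDim (Fintype.card (ι × ι × ι)) a ∧
      bondDim (Fintype.card (ι × ι × ι)) a ≤ Fintype.card (ι × ι × ι) := fun a => by
    unfold bondDim
    split_ifs <;> omega
  have hl : ∀ g, 0 < legDim
      (fun (_ : Fin (m + 1)) (b : Fin (n + 2)) => bondDim (Fintype.card (ι × ι × ι)) b)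
      (fun (a : Fin (m + 2)) (_ : Fin (n + 1)) => bondDim (Fintype.card (ι × ι × ι)) a) r c g ∧
      legDim
      (fun (_ : Fin (m + 1)) (b : Fin (n + 2)) => bondDim (Fintype.card (ι × ι × ι)) b)
      (fun (a : Fin (m + 2)) (_ : Fin (n + 1)) => bondDim (Fintype.card (ι × ι × ι)) a) r c g ≤
      Fintype.card (ι × ι × ι) := fun g => by
    cases g <;> exact hb _
  have h2 : 2 ≤ Fintype.card {v : Vertex m n // v.cell = (r, c)} :=
    Fintype.one_lt_card_iff.2 ⟨⟨.up r c, rfl⟩, ⟨.dn r c, rfl⟩,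
      fun h => by cases congrArg Subtype.val h⟩
  have h3 : Fintype.card (Phys ι m n r c) = Fintype.card (ι × ι × ι) ^
      Fintype.card {v : Vertex m n // v.cell = (r, c)} := by
    simp only [Fintype.card_pi, Finset.prod_const, Finset.card_univ, Fintype.card_fin,
      Fintype.card_prod]
    ring
  rw [Fintype.card_prod (Phys ι m n r c), h3, Fintype.card_pi, Fintype.card_pi]
  simp only [Fintype.card_fin]
  calc _ ≤ ∏ _g : {g // g ∈ out}, Fintype.card (ι × ι × ι) :=
        Finset.prod_le_prod' fun g _ => (hl g.1).2
    _ = Fintype.card (ι × ι × ι) ^ out.card := by simp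
    _ ≤ Fintype.card (ι × ι × ι) ^ Fintype.card {v : Vertex m n // v.cell = (r, c)} :=
        Nat.pow_le_pow_right hK (hout.trans h2)
    _ ≤ _ := Nat.le_mul_of_pos_right _ (Finset.prod_pos fun g _ => (hl g.1).1)

/-- The copy tensor of a cell agrees with an isometry for the labels that obey the branching
rules. -/
theorem exists_isometric_cellTensor [Nonempty ι] {out : Finset Leg} (hcard : out.card ≤ 2)
    (hout : ∀ g ∈ out, Interior r c g) (κ : CellLabel ι → ℂ) (Bns Bew : ι → ι → ι → Prop)
    (hκ : ∀ s s' : CellLabel ι, (∀ g ∈ out, s.LegRel Bns Bew g) →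
      labelGram κ out s s' = if ∀ g ∈ out, s.leg g = s'.leg g then 1 else 0) :
    ∃ T : CellTensor ι m n r c, IsIsometric T out ∧ ∀ x y (s : CellLabel ι),
      (∀ g ∈ out, s.LegRel Bns Bew g) → (∀ g ∈ out, y g = s.legIndex r c g) →
        T x y = copyTensor r c κ x y := by
  -- Only outgoing indices read off from admissible labels are kept. Other columns, such as those in
  -- which the two legs disagree on the loop at their corner, are filled in freely.
  obtain ⟨A, hA, hS⟩ := exists_isometry_extension (card_out_le hcard)
    (legMatrix (copyTensor (m := m) (n := n) r c κ) out)
    {o | ∃ s : CellLabel ι, (∀ g ∈ out, s.LegRel Bns Bew g) ∧ o = fun g : {g // g ∈ out} => s.legIndex r c g.1} (by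
      rintro _ ⟨s, hs, rfl⟩ _ ⟨s', hs', rfl⟩
      rw [gram_copyTensor hout, hκ s s' hs]
      refine if_congr ⟨fun h => funext fun g => ?_, fun h g hg => ?_⟩ rfl rfl
      · exact (CellLabel.legIndex_eq_iff (hout g.1 g.2)).2 (h g.1 g.2)
      · exact (CellLabel.legIndex_eq_iff (hout g hg)).1 (congrFun h ⟨g, hg⟩))
  refine ⟨fun x y => A (x, fun g => y g.1) fun g => y g.1, ?_, fun x y s hs hy => ?_⟩
  · have hT : legMatrix (fun x y => A (x, fun g => y g.1) fun g => y g.1) out = A := by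
      funext ⟨x, i⟩ o
      simp only [legMatrix]
      congr 1
      · refine Prod.ext rfl (funext fun g => ?_)
        simp [g.2]
      · funext g
        simp [g.2]
    unfold IsIsometric
    rw [hT]
    convert hA
  · refine (hS _ _ ⟨s, hs, funext fun g => hy g.1 g.2⟩).trans ?_
    unfold legMatrix
    congr 1
    funext g
    split_ifs <;> rfl

end

/-! ### Replacing the copy tensors by isometries without changing the contraction. -/

section

set_option linter.unusedSectionVars false

variable {ι : Type} [Fintype ι] [DecidableEq ι] {m n : ℕ}

/-- Distance of a cell from the orthogonality center. -/
def centerDist (r₀ r : Fin (m + 1)) (c₀ c : Fin (n + 1)) : ℕ :=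
  ((r : ℤ) - r₀).natAbs + ((c : ℤ) - c₀).natAbs

/-- If the bond indices at all cells closer to the orthogonality center come from labels that obey
the branching rules, then so do those at the outgoing legs. -/
theorem exists_label_outLegs (T : ∀ r c, CellTensor ι m n r c) {Bns Bew : ι → ι → ι → Prop}
    {r₀ r : Fin (m + 1)} {c₀ c : Fin (n + 1)} (hne : (r, c) ≠ (r₀, c₀))
    (h : ∀ r b, Fin ((cellNetwork T).hdim r b)) (v : ∀ a c, Fin ((cellNetwork T).vdim a c))
    (H : ∀ r' c', centerDist r₀ r' c₀ c' < centerDist r₀ r c₀ c → ∃ t : CellLabel ι,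
      (∀ g, t.LegRel Bns Bew g) ∧ (cellNetwork T).legIndex h v r' c' = t.legIndex r' c') :
    ∃ s : CellLabel ι, (∀ g ∈ outLegs r₀ r c₀ c, s.LegRel Bns Bew g) ∧
      ∀ g ∈ outLegs r₀ r c₀ c, (cellNetwork T).legIndex h v r c g = s.legIndex r c g := by
  have vert : ∀ {r : Fin m} {c : Fin (n + 1)} {s t : CellLabel ι},
      (cellNetwork T).legIndex h v r.castSucc c = s.legIndex r.castSucc c →
      (cellNetwork T).legIndex h v r.succ c = t.legIndex r.succ c →
      s.m = t.i ∧ s.B = t.L ∧ s.R = t.T := fun hs ht => by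
    simpa [CellLabel.leg] using
      leg_south_eq_of_legIndex ((congrFun hs .south).symm.trans (congrFun ht .north))
  have horz : ∀ {r : Fin (m + 1)} {c : Fin n} {s t : CellLabel ι},
      (cellNetwork T).legIndex h v r c.castSucc = s.legIndex r c.castSucc →
      (cellNetwork T).legIndex h v r c.succ = t.legIndex r c.succ →
      s.j = t.l ∧ s.T = t.L ∧ s.R = t.B := fun hs ht => by
    simpa [CellLabel.leg] using
      leg_east_eq_of_legIndex ((congrFun hs .east).symm.trans (congrFun ht .west))
  have hmem : ∀ g, g ∈ outLegs r₀ r c₀ c ↔ _ := fun g => mem_outLegs g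
  rcases lt_trichotomy r r₀ with hr | hr | hr
  · obtain ⟨r, rfl⟩ := Fin.exists_castSucc_eq.2 (hr.trans_le (Fin.le_last _)).ne
    have hr' := lt_asymm hr
    have hr1 : (r : ℕ) < r₀ := hr
    rcases lt_trichotomy c c₀ with hc | hc | hc
    · obtain ⟨c, rfl⟩ := Fin.exists_castSucc_eq.2 (hc.trans_le (Fin.le_last _)).ne
      have hc' := lt_asymm hc
      have hc1 : (c : ℕ) < c₀ := hc
      obtain ⟨y, hy, hyl⟩ := H r.succ c.castSucc (by simp [centerDist]; omega)
      obtain ⟨z, hz, hzl⟩ := H r.castSucc c.succ (by simp [centerDist]; omega)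
      -- The diagonal neighbour `q` touches both `y` and `z`, and serves to show that these carry
      -- the same loop on the plaquette at the corner between the outgoing legs.
      obtain ⟨q, hq, hql⟩ := H r.succ c.succ (by simp [centerDist]; omega)
      have e1 := horz hyl hql
      have e2 := vert hzl hql
      have e : z.B = y.T := e2.2.1.trans e1.2.1.symm
      -- The outgoing legs south and east involve only the entries `m`, `B`, `R` (from `y`) and `j`,
      -- `T` (from `z`). The remaining entries are arbitrary; the other cases are built in the same
      -- way.
      refine ⟨⟨y.i, z.l, y.i, y.i, y.i, y.i, z.L, y.L, y.T⟩, ?_, ?_⟩ <;>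
        simp only [Leg.forall_iff, hmem, hr, hc, hr', hc', true_implies, false_implies, true_and,
          and_true]
      · exact ⟨by simpa [CellLabel.LegRel, e] using hz .west,
          by simpa [CellLabel.LegRel] using hy .north⟩
      · refine ⟨(congrFun hzl .west).trans ?_, congrFun hyl .north⟩
        exact congrArg (bondIndex _) (by simp [CellLabel.leg, e])
    · subst hc
      obtain ⟨y, hy, hyl⟩ := H r.succ c (by simp [centerDist]; omega)
      refine ⟨⟨y.i, y.i, y.i, y.i, y.i, y.i, y.i, y.L, y.T⟩, ?_, ?_⟩ <;>
        simp only [Leg.forall_iff, hmem, hr, hr', lt_irrefl, true_implies, false_implies, true_and,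
          and_true]
      · exact hy .north
      · exact congrFun hyl .north
    · obtain ⟨c, rfl⟩ := Fin.exists_succ_eq.2 ((Fin.zero_le _).trans_lt hc).ne'
      have hc' := lt_asymm hc
      have hc1 : (c₀ : ℕ) < c + 1 := hc
      obtain ⟨y, hy, hyl⟩ := H r.succ c.succ (by simp [centerDist]; omega)
      obtain ⟨z, hz, hzl⟩ := H r.castSucc c.castSucc (by simp [centerDist]; omega)
      obtain ⟨q, hq, hql⟩ := H r.succ c.castSucc (by simp [centerDist]; omega)
      have e1 := horz hql hyl
      have e2 := vert hzl hql
      have e : z.R = y.L := e2.2.2.trans e1.2.1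
      refine ⟨⟨y.i, y.i, y.i, z.j, y.i, z.T, y.i, y.L, y.T⟩, ?_, ?_⟩ <;>
        simp only [Leg.forall_iff, hmem, hr, hc, hr', hc', true_implies, false_implies, true_and]
      · exact ⟨by simpa [CellLabel.LegRel] using hy .north,
          by simpa [CellLabel.LegRel, e] using hz .east⟩
      · refine ⟨congrFun hyl .north, (congrFun hzl .east).trans ?_⟩
        exact congrArg (bondIndex _) (by simp [CellLabel.leg, e])
  · subst hr
    rcases lt_trichotomy c c₀ with hc | hc | hc
    · obtain ⟨c, rfl⟩ := Fin.exists_castSucc_eq.2 (hc.trans_le (Fin.le_last _)).ne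
      have hc' := lt_asymm hc
      have hc1 : (c : ℕ) < c₀ := hc
      obtain ⟨z, hz, hzl⟩ := H r c.succ (by simp [centerDist]; omega)
      refine ⟨⟨z.i, z.l, z.i, z.i, z.i, z.i, z.L, z.i, z.B⟩, ?_, ?_⟩ <;>
        simp only [Leg.forall_iff, hmem, hc, hc', lt_irrefl, true_implies, false_implies, true_and,
          and_true]
      · exact hz .west
      · exact congrFun hzl .west
    · exact (hne (by rw [hc])).elim
    · obtain ⟨c, rfl⟩ := Fin.exists_succ_eq.2 ((Fin.zero_le _).trans_lt hc).ne'
      have hc' := lt_asymm hc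
      have hc1 : (c₀ : ℕ) < c + 1 := hc
      obtain ⟨z, hz, hzl⟩ := H r c.castSucc (by simp [centerDist]; omega)
      refine ⟨⟨z.i, z.i, z.i, z.j, z.i, z.T, z.i, z.R, z.i⟩, ?_, ?_⟩ <;>
        simp only [Leg.forall_iff, hmem, hc, hc', lt_irrefl, true_implies, false_implies, true_and]
      · exact hz .east
      · exact congrFun hzl .east
  · obtain ⟨r, rfl⟩ := Fin.exists_succ_eq.2 ((Fin.zero_le _).trans_lt hr).ne'
    have hr' := lt_asymm hr
    have hr1 : (r₀ : ℕ) < r + 1 := hr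
    rcases lt_trichotomy c c₀ with hc | hc | hc
    · obtain ⟨c, rfl⟩ := Fin.exists_castSucc_eq.2 (hc.trans_le (Fin.le_last _)).ne
      have hc' := lt_asymm hc
      have hc1 : (c : ℕ) < c₀ := hc
      obtain ⟨y, hy, hyl⟩ := H r.castSucc c.castSucc (by simp [centerDist]; omega)
      obtain ⟨z, hz, hzl⟩ := H r.succ c.succ (by simp [centerDist]; omega)
      obtain ⟨q, hq, hql⟩ := H r.castSucc c.succ (by simp [centerDist]; omega)
      have e1 := horz hyl hql
      have e2 := vert hql hzl
      have e : z.L = y.R := e2.2.1.symm.trans e1.2.2.symm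
      refine ⟨⟨y.m, z.l, y.i, y.i, y.i, y.B, y.R, y.i, z.B⟩, ?_, ?_⟩ <;>
        simp only [Leg.forall_iff, hmem, hr, hc, hr', hc', true_implies, false_implies, and_true]
      · exact ⟨by simpa [CellLabel.LegRel] using hy .south,
          by simpa [CellLabel.LegRel, e] using hz .west⟩
      · refine ⟨congrFun hyl .south, (congrFun hzl .west).trans ?_⟩
        exact congrArg (bondIndex _) (by simp [CellLabel.leg, e])
    · subst hc
      obtain ⟨y, hy, hyl⟩ := H r.castSucc c (by simp [centerDist]; omega)
      refine ⟨⟨y.m, y.i, y.i, y.i, y.i, y.B, y.R, y.i, y.i⟩, ?_, ?_⟩ <;>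
        simp only [Leg.forall_iff, hmem, hr, hr', lt_irrefl, true_implies, false_implies, and_true]
      · exact hy .south
      · exact congrFun hyl .south
    · obtain ⟨c, rfl⟩ := Fin.exists_succ_eq.2 ((Fin.zero_le _).trans_lt hc).ne'
      have hc' := lt_asymm hc
      have hc1 : (c₀ : ℕ) < c + 1 := hc
      obtain ⟨y, hy, hyl⟩ := H r.castSucc c.succ (by simp [centerDist]; omega)
      obtain ⟨z, hz, hzl⟩ := H r.succ c.castSucc (by simp [centerDist]; omega)
      obtain ⟨q, hq, hql⟩ := H r.castSucc c.castSucc (by simp [centerDist]; omega)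
      have e1 := horz hql hyl
      have e2 := vert hql hzl
      have e : z.T = y.B := e2.2.2.symm.trans e1.2.2
      refine ⟨⟨y.m, y.i, y.i, z.j, y.i, y.B, y.R, z.R, y.i⟩, ?_, ?_⟩ <;>
        simp only [Leg.forall_iff, hmem, hr, hc, hr', hc', true_implies, false_implies, true_and]
      · exact ⟨by simpa [CellLabel.LegRel] using hy .south,
          by simpa [CellLabel.LegRel, e] using hz .east⟩
      · refine ⟨congrFun hyl .south, (congrFun hzl .east).trans ?_⟩
        exact congrArg (bondIndex _) (by simp [CellLabel.leg, e])

/-- A network of copy tensors whose amplitudes are isometric on the labels that obey the branching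
rules is the contraction of a network in isometric form. -/
theorem exists_isometricForm [Nonempty ι] (r₀ : Fin (m + 1)) (c₀ : Fin (n + 1))
    (κ : Fin (m + 1) → Fin (n + 1) → CellLabel ι → ℂ) (Bns Bew : ι → ι → ι → Prop)
    (hsupp : ∀ r c t, κ r c t ≠ 0 → ∀ g, t.LegRel Bns Bew g)
    (hκ : ∀ r c, (r, c) ≠ (r₀, c₀) → ∀ s s' : CellLabel ι,
      (∀ g ∈ outLegs r₀ r c₀ c, s.LegRel Bns Bew g) →
      labelGram (κ r c) (outLegs r₀ r c₀ c) s s' =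
        if ∀ g ∈ outLegs r₀ r c₀ c, s.leg g = s'.leg g then 1 else 0) :
    ∃ net : PEPS m n (Phys ι m n), net.BondDimLE (Fintype.card (ι × ι × ι)) ∧
      net.IsIsometricForm r₀ c₀ ∧ ∀ x, net.contract x = double (fun X => ∑ g : Face m n → ι,
        if ∀ p : RimFace m n, X (.rim p) = g p then ∏ r, ∏ c, κ r c (cellLabel X g r c) else 0)
        x := by
  have hT : ∀ r c, ∃ T : CellTensor ι m n r c,
      ((r, c) ≠ (r₀, c₀) → IsIsometric T (outLegs r₀ r c₀ c)) ∧
      ∀ x y, ((r, c) ≠ (r₀, c₀) → ∃ s : CellLabel ι,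
        (∀ g ∈ outLegs r₀ r c₀ c, s.LegRel Bns Bew g) ∧
        (∀ g ∈ outLegs r₀ r c₀ c, y g = s.legIndex r c g)) →
        T x y = copyTensor r c (κ r c) x y := fun r c => by
    by_cases hne : (r, c) = (r₀, c₀)
    · exact ⟨copyTensor r c (κ r c), fun h => (h hne).elim, fun _ _ _ => rfl⟩
    · have hcard : (outLegs r₀ r c₀ c).card ≤ 2 := by
        rcases outLegs_cases hne with h | h | h | h | h | h | h | h <;> rw [h] <;> decide
      obtain ⟨T, h1, h2⟩ := exists_isometric_cellTensor hcard
        (fun g hg => interior_of_mem_outLegs hg) (κ r c) Bns Bew (hκ r c hne)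
      refine ⟨T, fun _ => h1, fun x y h => ?_⟩
      obtain ⟨s, hs, hy⟩ := h hne
      exact h2 x y s hs hy
  choose T hiso hT using hT
  refine ⟨cellNetwork T, cellNetwork_bondDimLE T, fun r c h => hiso r c h, fun x => ?_⟩
  rw [← contract_cellNetwork_copyTensor]
  refine Finset.sum_congr rfl fun h _ => Finset.sum_congr rfl fun v _ => ?_
  let net := cellNetwork fun r c => copyTensor (m := m) (n := n) r c (κ r c)
  let τ : Fin (m + 1) → Fin (n + 1) → ℂ := fun r c =>
    copyTensor r c (κ r c) (x r c) (net.legIndex h v r c)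
  let τ' : Fin (m + 1) → Fin (n + 1) → ℂ := fun r c => T r c (x r c) (net.legIndex h v r c)
  change ∏ r, ∏ c, τ' r c = ∏ r, ∏ c, τ r c
  have hlab : ∀ r c, τ r c ≠ 0 → ∃ t : CellLabel ι,
      (∀ g, t.LegRel Bns Bew g) ∧ net.legIndex h v r c = t.legIndex r c := fun r c h0 => by
    obtain ⟨t, -, ht⟩ := Finset.exists_ne_zero_of_sum_ne_zero h0
    have hP : (∀ v e, x r c v e = t.phys v.1 e) ∧ net.legIndex h v r c = t.legIndex r c :=
      by_contra fun hn => ht (if_neg hn)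
    exact ⟨t, hsupp r c t fun h0 => ht (by simp only [h0, ite_self]), hP.2⟩
  -- If no closer cell vanishes, then all closer bond indices come from admissible labels, hence so
  -- do the outgoing indices here, where the isometry agrees with the copy tensor.
  have heq : ∀ r c, (∀ r' c', centerDist r₀ r' c₀ c' < centerDist r₀ r c₀ c → τ r' c' ≠ 0) →
      τ' r c = τ r c := fun r c H =>
    hT r c _ _ fun hne => exists_label_outLegs (fun r c => copyTensor r c (κ r c)) hne h v
      fun r' c' hd => hlab r' c' (H r' c' hd)
  by_cases hall : ∀ r c, τ r c ≠ 0
  · exact Finset.prod_congr rfl fun r _ => Finset.prod_congr rfl fun c _ =>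
      heq r c fun r' c' _ => hall r' c'
  · push Not at hall
    obtain ⟨r', c', hz'⟩ := hall
    -- Among the vanishing copy tensors one nearest to the center is chosen. All closer ones are
    -- nonzero, so there the isometry agrees with the copy tensor and vanishes as well; both
    -- products are zero.
    obtain ⟨⟨r, c⟩, hz, hmin⟩ := Finset.exists_min_image
      (Finset.univ.filter fun q : Fin (m + 1) × Fin (n + 1) => τ q.1 q.2 = 0)
      (fun q => centerDist r₀ q.1 c₀ q.2) ⟨(r', c'), by simp [hz']⟩
    simp only [Finset.mem_filter, Finset.mem_univ, true_and] at hz hmin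
    have hz2 : τ' r c = 0 := (heq r c fun r' c' hd h0 =>
      absurd (hmin (r', c') h0) (not_le.2 hd)).trans hz
    rw [Finset.prod_eq_zero (Finset.mem_univ r) (Finset.prod_eq_zero (Finset.mem_univ c) hz2),
      Finset.prod_eq_zero (Finset.mem_univ r) (Finset.prod_eq_zero (Finset.mem_univ c) hz)]

end

/-! ### States built from unitary vertex tensors. -/

section

set_option linter.unusedSectionVars false

variable {ι : Type} [Fintype ι] [DecidableEq ι] {m n : ℕ}

/-- The weight of the labels: `v` for every string except for those on the rim, `u` for every
plaquette, and `v` for every plaquette that is not at the boundary. -/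
def labelWeight (v u : ι → ℂ) (X : Config ι m n) (g : Face m n → ι) : ℂ :=
  (∏ r, ∏ c, v (X (.vert r c))) * ((∏ a, ∏ c, v (X (.ns a c))) * ∏ r, ∏ b, v (X (.ew r b))) *
    ∏ a, ∏ b, u (g (a, b)) *
      if (a = 0 ∨ a = Fin.last _) ∨ (b = 0 ∨ b = Fin.last _) then 1 else v (g (a, b))

/-- The string-net state with vertex tensors `Y` and `Z` at the upper and lower vertices of the
cells, where the rim edges carry the labels of their plaquettes. -/
def cellState (Y Z : Fin (m + 1) → Fin (n + 1) → ι → ι → ι → ι → ι → ι → ℂ) (v u : ι → ℂ)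
    (X : Config ι m n) : ℂ :=
  ∑ g : Face m n → ι, if ∀ p : RimFace m n, X (.rim p) = g p then labelWeight v u X g *
    ∏ r, ∏ c, Y r c (X (.ns r.castSucc c)) (X (.ew r c.succ)) (X (.vert r c))
        (g (r.castSucc, c.castSucc)) (g (r.castSucc, c.succ)) (g (r.succ, c.succ)) *
      Z r c (X (.ew r c.castSucc)) (X (.ns r.succ c)) (X (.vert r c))
        (g (r.castSucc, c.castSucc)) (g (r.succ, c.castSucc)) (g (r.succ, c.succ)) else 0

/-- Each plaquette gets `y` from the one surrounding cell for which neither of the legs beside it is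
outgoing, and `z` from the one for which both are; cells with just one contribute 1. This is
`prod_segment_create` and `prod_segment_consume` in each of the two directions, so `z` appears only
inside the patch. -/
theorem prod_faces {M : Type*} [CommMonoid M] (r₀ : Fin (m + 1)) (c₀ : Fin (n + 1))
    (y z : Fin (m + 2) → Fin (n + 2) → M) :
    ∏ r : Fin (m + 1), ∏ c : Fin (n + 1),
      ((if r₀ < r then (if c₀ < c then z r.castSucc c.castSucc else 1)
          else if c₀ < c then 1 else y r.castSucc c.castSucc) *
        (if r₀ < r then (if c < c₀ then z r.castSucc c.succ else 1)
          else if c < c₀ then 1 else y r.castSucc c.succ) *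
        (if r < r₀ then (if c₀ < c then z r.succ c.castSucc else 1)
          else if c₀ < c then 1 else y r.succ c.castSucc) *
        (if r < r₀ then (if c < c₀ then z r.succ c.succ else 1)
          else if c < c₀ then 1 else y r.succ c.succ)) =
    ∏ a, ∏ b, y a b * if (a = 0 ∨ a = Fin.last _) ∨ (b = 0 ∨ b = Fin.last _) then 1 else z a b := by
  have h : ∀ r : Fin (m + 1), ∏ c : Fin (n + 1),
      ((if r₀ < r then (if c₀ < c then z r.castSucc c.castSucc else 1)
          else if c₀ < c then 1 else y r.castSucc c.castSucc) *
        (if r₀ < r then (if c < c₀ then z r.castSucc c.succ else 1)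
          else if c < c₀ then 1 else y r.castSucc c.succ) *
        (if r < r₀ then (if c₀ < c then z r.succ c.castSucc else 1)
          else if c₀ < c then 1 else y r.succ c.castSucc) *
        (if r < r₀ then (if c < c₀ then z r.succ c.succ else 1)
          else if c < c₀ then 1 else y r.succ c.succ)) =
      ((if r₀ < r then 1 else ∏ b, y r.castSucc b) * (if r < r₀ then 1 else ∏ b, y r.succ b)) *
      ((if r₀ < r then ∏ b, (if b = 0 ∨ b = Fin.last _ then 1 else z r.castSucc b) else 1) *
        (if r < r₀ then ∏ b, (if b = 0 ∨ b = Fin.last _ then 1 else z r.succ b) else 1)) := by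
    intro r
    have e1 := fun a => prod_segment_create c₀ (y a)
    have e2 := fun a => prod_segment_consume c₀ (z a)
    simp only [← e1, ← e2]
    rcases lt_trichotomy r r₀ with hr | rfl | hr
    · simp only [hr, lt_asymm hr, if_true, if_false, Finset.prod_mul_distrib, one_mul, mul_one,
        mul_assoc]
    · simp only [lt_irrefl, if_false, Finset.prod_mul_distrib, mul_one, mul_assoc]
    · simp only [hr, lt_asymm hr, if_true, if_false, Finset.prod_mul_distrib, one_mul, mul_one,
        mul_assoc]
      ac_rfl
  rw [Finset.prod_congr rfl fun r _ => h r, Finset.prod_mul_distrib, Finset.prod_mul_distrib,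
    Finset.prod_mul_distrib, prod_segment_create r₀ fun a => ∏ b, y a b,
    prod_segment_consume r₀ fun a => ∏ b, if b = 0 ∨ b = Fin.last _ then 1 else z a b,
    ← Finset.prod_mul_distrib]
  refine Finset.prod_congr rfl fun a _ => ?_
  rw [Finset.prod_mul_distrib]
  split_ifs with ha
  · simp [ha]
  · simp [ha]

/-- Moving the center merely shifts weights from one cell to another. For this reason the networks
for all centers represent the same state. -/
theorem prod_cellWeight (v u : ι → ℂ) (X : Config ι m n) (g : Face m n → ι)
    (r₀ : Fin (m + 1)) (c₀ : Fin (n + 1)) :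
    ∏ r, ∏ c, cellWeight v u (outLegs r₀ r c₀ c) (cellLabel X g r c) = labelWeight v u X g := by
  rw [labelWeight, ← prod_faces r₀ c₀ (fun a b => u (g (a, b))) fun a b => v (g (a, b))]
  simp only [cellWeight, faceWeight, leg_prod, mem_outLegs, Finset.prod_mul_distrib]
  have h1 : (∏ r, ∏ c, if r₀ < r then 1 else v ((cellLabel X g r c).leg .north).1) *
      (∏ r, ∏ c, if r < r₀ then 1 else v ((cellLabel X g r c).leg .south).1) =
      ∏ a, ∏ c, v (X (.ns a c)) := by
    rw [Finset.prod_comm, Finset.prod_comm (f := fun r c => if r < r₀ then _ else _),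
      Finset.prod_comm (f := fun a c => v (X (.ns a c))), ← Finset.prod_mul_distrib]
    exact Finset.prod_congr rfl fun c _ => prod_segment_create r₀ fun a => v (X (.ns a c))
  have h2 : (∏ r, ∏ c, if c₀ < c then 1 else v ((cellLabel X g r c).leg .west).1) *
      (∏ r, ∏ c, if c < c₀ then 1 else v ((cellLabel X g r c).leg .east).1) =
      ∏ r, ∏ b, v (X (.ew r b)) := by
    rw [← Finset.prod_mul_distrib]
    exact Finset.prod_congr rfl fun r _ => prod_segment_create c₀ fun b => v (X (.ew r b))
  rw [← h1, ← h2]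
  simp only [cellLabel]
  ring

/-- A string-net state whose vertex tensors are unitary is an isoTNS. -/
theorem isIsoTNS_cellState [Nonempty ι] {d : ι → ℝ} {D : ℝ} {Bns Bew Bk : ι → ι → ι → Prop}
    {v u : ι → ℂ} (hD : 0 < D) (hd : ∀ i, 0 < d i) (hv : ∀ x, conj (v x) * v x = d x)
    (hu : ∀ x, conj (u x) * u x = d x / D)
    (hns : IsBalanced d D Bns) (hew : IsBalanced d D Bew) (hk : IsBalanced d D Bk)
    {Y Z : Fin (m + 1) → Fin (n + 1) → ι → ι → ι → ι → ι → ι → ℂ}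
    (hY : ∀ r c, IsVertexTensor d Bns Bew Bk (Y r c))
    (hZ : ∀ r c, IsVertexTensor d Bew Bns Bk (Z r c)) (C : ℂ) (Ψ : Config ι m n → ℂ)
    (hΨ : ∀ X, Ψ X = C * cellState Y Z v u X) :
    IsIsoTNS (Fintype.card (ι × ι × ι)) (double Ψ) := by
  intro r₀ c₀
  -- The overall constant is put at the orthogonality center, the only tensor that need not be an
  -- isometry.
  let κ : Fin (m + 1) → Fin (n + 1) → CellLabel ι → ℂ := fun r c t =>
    (if (r, c) = (r₀, c₀) then C else 1) *
      cellAmplitude v u (Y r c) (Z r c) (outLegs r₀ r c₀ c) t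
  have hsupp : ∀ r c t, κ r c t ≠ 0 → ∀ g, t.LegRel Bns Bew g := by
    intro r c t h0
    have h0' : Y r c t.i t.j t.k t.L t.T t.R * Z r c t.l t.m t.k t.L t.B t.R ≠ 0 := fun h =>
      h0 (by simp [κ, cellAmplitude, h])
    obtain ⟨hy1, hy2, -⟩ := (hY r c).support _ _ _ _ _ _ (left_ne_zero_of_mul h0')
    obtain ⟨hz1, hz2, -⟩ := (hZ r c).support _ _ _ _ _ _ (right_ne_zero_of_mul h0')
    rw [Leg.forall_iff]
    exact ⟨hy1, hy2, hz2, hz1⟩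
  have hgram : ∀ r c, (r, c) ≠ (r₀, c₀) → ∀ s s' : CellLabel ι,
      (∀ g ∈ outLegs r₀ r c₀ c, s.LegRel Bns Bew g) →
      labelGram (κ r c) (outLegs r₀ r c₀ c) s s' =
        if ∀ g ∈ outLegs r₀ r c₀ c, s.leg g = s'.leg g then 1 else 0 := by
    intro r c hne s s' hs
    have hκ : κ r c = cellAmplitude v u (Y r c) (Z r c) (outLegs r₀ r c₀ c) := by
      funext t
      simp only [κ, if_neg hne, one_mul]
    rw [hκ]
    rcases outLegs_cases hne with h | h | h | h | h | h | h | h <;> rw [h] at hs ⊢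
    · exact labelGram_south_east hD hd hv hu (hY r c) (hZ r c) hns hew hk hs
    · exact labelGram_south_west hD hd hv hu (hY r c) (hZ r c) hns hew hk hs
    · exact labelGram_north_east hD hd hv hu (hY r c) (hZ r c) hns hew hk hs
    · exact labelGram_north_west hD hd hv hu (hY r c) (hZ r c) hns hew hk hs
    · exact labelGram_south hD hd hv hu (hY r c) (hZ r c) hns hew hk hs
    · exact labelGram_north hD hd hv hu (hY r c) (hZ r c) hns hew hk hs
    · exact labelGram_east hD hd hv hu (hY r c) (hZ r c) hns hew hk hs
    · exact labelGram_west hD hd hv hu (hY r c) (hZ r c) hns hew hk hs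
  obtain ⟨net, h1, h2, h3⟩ := exists_isometricForm r₀ c₀ κ Bns Bew hsupp hgram
  refine ⟨net, h1, h2, fun x => (h3 x).trans ?_⟩
  congr 1
  funext X
  rw [hΨ, cellState, Finset.mul_sum]
  refine Finset.sum_congr rfl fun g _ => ?_
  rw [mul_ite, mul_zero]
  refine if_congr Iff.rfl ?_ rfl
  simp only [κ, cellAmplitude, Finset.prod_mul_distrib]
  rw [prod_cellWeight]
  have hC : (∏ r, ∏ c, if (r, c) = (r₀, c₀) then C else 1) = C := by
    rw [← Fintype.prod_prod_type' (f := fun r c => if (r, c) = (r₀, c₀) then C else 1)]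
    simp
  rw [hC]
  rfl

end

/-! ### Geometry of the honeycomb patch -/

section

variable {m n : ℕ}

/-- The plaquette on the right of an edge, seen along its orientation; `none` is the outside. -/
def Edge.sideA : Edge m n → Option (Face m n)
  | .vert r c => some (r.castSucc, c.castSucc)
  | .ns a c => some (a, c.succ)
  | .ew r b => some (r.succ, b)
  | .rim _ => none

/-- The plaquette on the other side of an edge. -/
def Edge.sideB : Edge m n → Option (Face m n)
  | .vert r c => some (r.succ, c.succ)
  | .ns a c => some (a, c.castSucc)
  | .ew r b => some (r.castSucc, b)
  | .rim p => some p

/-- The plaquettes beside an edge are those opposite to the other two edges of the vertex. This and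
the next lemma let conditions at vertices be read as conditions on edges. -/
theorem Vertex.face_add_one (v : Vertex m n) (e : Fin 3) :
    v.face (e + 1) = if v.pointsIn e then (v.edge e).sideA else (v.edge e).sideB := by
  cases v <;> fin_cases e <;> simp [face, pointsIn, edge, Edge.sideA, Edge.sideB]

theorem Vertex.face_add_two (v : Vertex m n) (e : Fin 3) :
    v.face (e + 2) = if v.pointsIn e then (v.edge e).sideB else (v.edge e).sideA := by
  cases v <;> fin_cases e <;> simp [face, pointsIn, edge, Edge.sideA, Edge.sideB]

theorem exists_rim_end (p : RimFace m n) (b : Bool) :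
    ∃ (v : Vertex m n) (e : Fin 3), v.edge e = .rim p ∧ v.pointsIn e = b := by
  obtain ⟨⟨a, c⟩, hp⟩ := p
  rcases eq_or_ne a 0 with rfl | h0
  · cases b
    · rcases eq_or_ne c 0 with rfl | hc
      · exact ⟨.bW 0, 0, rfl, rfl⟩
      · obtain ⟨c, rfl⟩ := Fin.exists_succ_eq.2 hc
        exact ⟨.bN c, 0, rfl, rfl⟩
    · rcases eq_or_ne c (Fin.last _) with rfl | hc
      · exact ⟨.bE 0, 0, rfl, rfl⟩
      · obtain ⟨c, rfl⟩ := Fin.exists_castSucc_eq.2 hc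
        exact ⟨.bN c, 1, rfl, rfl⟩
  rcases eq_or_ne a (Fin.last _) with rfl | h1
  · cases b
    · rcases eq_or_ne c (Fin.last _) with rfl | hc
      · exact ⟨.bE (Fin.last _), 2, rfl, rfl⟩
      · obtain ⟨c, rfl⟩ := Fin.exists_castSucc_eq.2 hc
        exact ⟨.bS c, 1, rfl, rfl⟩
    · rcases eq_or_ne c 0 with rfl | hc
      · exact ⟨.bW (Fin.last _), 1, rfl, rfl⟩
      · obtain ⟨c, rfl⟩ := Fin.exists_succ_eq.2 hc
        exact ⟨.bS c, 2, rfl, rfl⟩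
  rcases hp with (hp | hp) | (hp | hp)
  · exact (h0 hp).elim
  · exact (h1 hp).elim
  · change c = 0 at hp
    subst hp
    cases b
    · obtain ⟨a, rfl⟩ := Fin.exists_castSucc_eq.2 h1
      exact ⟨.bW a, 0, rfl, rfl⟩
    · obtain ⟨a, rfl⟩ := Fin.exists_succ_eq.2 h0
      exact ⟨.bW a, 1, rfl, rfl⟩
  · change c = Fin.last _ at hp
    subst hp
    cases b
    · obtain ⟨a, rfl⟩ := Fin.exists_succ_eq.2 h0
      exact ⟨.bE a, 2, rfl, rfl⟩
    · obtain ⟨a, rfl⟩ := Fin.exists_castSucc_eq.2 h1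
      exact ⟨.bE a, 0, rfl, rfl⟩

/-- Every edge ends at one vertex and starts at another one. -/
theorem exists_end (E : Edge m n) (b : Bool) :
    ∃ (v : Vertex m n) (e : Fin 3), v.edge e = E ∧ v.pointsIn e = b := by
  cases E with
  | vert r c =>
    cases b
    · exact ⟨.dn r c, 0, rfl, rfl⟩
    · exact ⟨.up r c, 1, rfl, rfl⟩
  | ns a c =>
    cases b
    · induction a using Fin.cases with
      | zero => exact ⟨.bN c, 2, rfl, rfl⟩
      | succ r => exact ⟨.dn r c, 2, rfl, rfl⟩
    · induction a using Fin.lastCases with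
      | last => exact ⟨.bS c, 0, rfl, rfl⟩
      | cast r => exact ⟨.up r c, 0, rfl, rfl⟩
  | ew r a =>
    cases b
    · induction a using Fin.lastCases with
      | last => exact ⟨.bE r, 1, rfl, rfl⟩
      | cast c => exact ⟨.dn r c, 1, rfl, rfl⟩
    · induction a using Fin.cases with
      | zero => exact ⟨.bW r, 2, rfl, rfl⟩
      | succ c => exact ⟨.up r c, 2, rfl, rfl⟩
  | rim p => exact exists_rim_end p b

/-- Every edge has one end at which it points into the vertex and one at which it points out, so a
product over all corners of vertices is a product over edges with two factors each. -/
theorem halfEdge_bijective : Function.Bijective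
    (fun q : Vertex m n × Fin 3 => (q.1.edge q.2, q.1.pointsIn q.2)) := by
  constructor
  · rintro ⟨v, e⟩ ⟨v', e'⟩ h
    simp only [Prod.mk.injEq] at h
    obtain ⟨h1, h2⟩ := h
    cases v <;> fin_cases e <;> cases v' <;> fin_cases e' <;>
      simp [Vertex.edge, Vertex.pointsIn] at h1 h2 ⊢
    all_goals first
      | exact h1
      | exact Fin.succ_ne_zero _ h1.1.symm
      | exact Fin.succ_ne_zero _ h1.2.symm
      | exact Fin.castSucc_ne_last _ h1.1.symm
      | exact Fin.castSucc_ne_last _ h1.2.symm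
  · rintro ⟨E, b⟩
    obtain ⟨v, e, h1, h2⟩ := exists_end E b
    exact ⟨(v, e), Prod.ext h1 h2⟩

theorem prod_halfEdge {M : Type*} [CommMonoid M] (f : Edge m n → Bool → M) :
    ∏ v : Vertex m n, ∏ e, f (v.edge e) (v.pointsIn e) = ∏ E, f E true * f E false := by
  rw [← Fintype.prod_prod_type' (f := fun (v : Vertex m n) e => f (v.edge e) (v.pointsIn e)),
    Function.Bijective.prod_comp halfEdge_bijective fun q => f q.1 q.2, Fintype.prod_prod_type]
  simp

theorem prod_vertex {M : Type*} [CommMonoid M] (f : Vertex m n → M) :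
    ∏ v, f v = ((∏ r, ∏ c, f (.up r c)) * (∏ r, ∏ c, f (.dn r c))) *
      (((∏ c, f (.bN c)) * ∏ r, f (.bE r)) * ((∏ c, f (.bS c)) * ∏ r, f (.bW r))) := by
  let φ : ((Fin (m + 1) × Fin (n + 1) ⊕ Fin (m + 1) × Fin (n + 1)) ⊕
      ((Fin (n + 1) ⊕ Fin (m + 1)) ⊕ (Fin (n + 1) ⊕ Fin (m + 1)))) → Vertex m n :=
    Sum.elim (Sum.elim (fun q => .up q.1 q.2) fun q => .dn q.1 q.2)
      (Sum.elim (Sum.elim .bN .bE) (Sum.elim .bS .bW))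
  have hφ : Function.Bijective φ := by
    constructor
    · rintro ((x | x) | ((x | x) | (x | x))) ((y | y) | ((y | y) | (y | y))) h <;>
        simp [φ, Prod.ext_iff] at h ⊢ <;> exact h
    · rintro (⟨r, c⟩ | ⟨r, c⟩ | c | r | c | r)
      · exact ⟨.inl (.inl (r, c)), rfl⟩
      · exact ⟨.inl (.inr (r, c)), rfl⟩
      · exact ⟨.inr (.inl (.inl c)), rfl⟩
      · exact ⟨.inr (.inl (.inr r)), rfl⟩
      · exact ⟨.inr (.inr (.inl c)), rfl⟩
      · exact ⟨.inr (.inr (.inr r)), rfl⟩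
  rw [← hφ.prod_comp]
  simp only [Fintype.prod_sum_type, Fintype.prod_prod_type, φ, Sum.elim_inl, Sum.elim_inr]

end

/-! ### Abelian string-nets -/

section

variable {ι : Type} [Fintype ι] [DecidableEq ι] {m n : ℕ}

/-- Any two of a string and the loops on its sides determine the third. -/
structure IsLatin (B : ι → ι → ι → Prop) : Prop where
  string : ∀ f f', ∃! x, B x f f'
  left : ∀ x f', ∃! f, B x f f'
  right : ∀ x f, ∃! f', B x f f'

omit [Fintype ι] [DecidableEq ι] in
theorem IsLatin.mirror {B : ι → ι → ι → Prop} (h : IsLatin B) : IsLatin fun x f f' => B x f' f :=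
  ⟨fun f f' => h.string f' f, h.right, h.left⟩

-- All weights are 1, and for each pair of loops there is exactly one string, so the sums count the
-- possible loops.
omit [DecidableEq ι] in
theorem IsLatin.isBalanced {B : ι → ι → ι → Prop} (h : IsLatin B) :
    IsBalanced (fun _ => 1) (Fintype.card ι) B where
  left f := by
    rw [Finset.sum_comm]
    have : ∀ f', (∑ x, open scoped Classical in if B x f f' then (1 : ℝ) * 1 else 0) = 1 :=
        fun f' => by
      obtain ⟨x, hx, hu⟩ := h.string f f'
      rw [Finset.sum_eq_single x (fun y _ hy => if_neg fun h' => hy (hu y h')) (by simp)]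
      simp [hx]
    rw [Finset.sum_congr rfl fun f' _ => this f']
    simp
  right f' := by
    rw [Finset.sum_comm]
    have : ∀ f, (∑ x, open scoped Classical in if B x f f' then (1 : ℝ) * 1 else 0) = 1 :=
        fun f => by
      obtain ⟨x, hx, hu⟩ := h.string f f'
      rw [Finset.sum_eq_single x (fun y _ hy => if_neg fun h' => hy (hu y h')) (by simp)]
      simp [hx]
    rw [Finset.sum_congr rfl fun f _ => this f]
    simp

-- On the diagonal each sum has a single nonzero term, of modulus 1, because two loops determine the
-- string between them. Off the diagonal one factor vanishes, because a string and one loop beside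
-- it determine the other loop.
open scoped Classical in
theorem isVertexTensor_of_norm {Bi Bj Bk : ι → ι → ι → Prop} (hi : IsLatin Bi) (hj : IsLatin Bj)
    (hk : IsLatin Bk) {Y : ι → ι → ι → ι → ι → ι → ℂ}
    (hY : ∀ i j k L T R, ‖Y i j k L T R‖ = if Bi i L T ∧ Bj j T R ∧ Bk k L R then 1 else 0) :
    IsVertexTensor (fun _ => 1) Bi Bj Bk Y := by
  have h0 : ∀ i j k L T R, ¬ (Bi i L T ∧ Bj j T R ∧ Bk k L R) → Y i j k L T R = 0 :=
    fun i j k L T R h => norm_eq_zero.1 ((hY _ _ _ _ _ _).trans (if_neg h))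
  have h1 : ∀ i j k L T R, (Bi i L T ∧ Bj j T R ∧ Bk k L R) →
      conj (Y i j k L T R) * Y i j k L T R = 1 := fun i j k L T R h => by
    rw [Complex.conj_mul', hY, if_pos h]
    simp
  refine ⟨fun i j k L T R h => by_contra fun h' => h (h0 _ _ _ _ _ _ h'), ?_, ?_, ?_⟩
  · intro j k L T R R' hj' hk'
    split_ifs with h
    · subst h
      obtain ⟨x, hx, hu⟩ := hi.string L T
      rw [Finset.sum_eq_single x (fun y _ hy => ?_) (by simp)]
      · simp [h1 x j k L T R ⟨hx, hj', hk'⟩]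
      · simp [h0 y j k L T R fun h' => hy (hu y h'.1)]
    · refine Finset.sum_eq_zero fun x _ => ?_
      rw [h0 x j k L T R' fun h' => h ((hj.right j T).unique hj' h'.2.1)]
      simp
  · intro i k L L' T R hi' hk'
    split_ifs with h
    · subst h
      obtain ⟨x, hx, hu⟩ := hj.string T R
      rw [Finset.sum_eq_single x (fun y _ hy => ?_) (by simp)]
      · simp [h1 i x k L T R ⟨hi', hx, hk'⟩]
      · simp [h0 i y k L T R fun h' => hy (hu y h'.2.1)]
    · refine Finset.sum_eq_zero fun x _ => ?_
      rw [h0 i x k L' T R fun h' => h ((hi.left i T).unique hi' h'.1)]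
      simp
  · intro i j L T T' R hi' hj'
    split_ifs with h
    · subst h
      obtain ⟨x, hx, hu⟩ := hk.string L R
      rw [Finset.sum_eq_single x (fun y _ hy => ?_) (by simp)]
      · simp [h1 i j x L T R ⟨hi', hj', hx⟩]
      · simp [h0 i j y L T R fun h' => hy (hu y h'.2.2)]
    · refine Finset.sum_eq_zero fun x _ => ?_
      rw [h0 i j x L T' R fun h' => h ((hi.right i L).unique hi' h'.1)]
      simp

/-- The branching rule for a string, its direction at a vertex, and the two loops beside it in
counterclockwise order. -/
def EndRel (B : ι → ι → ι → Prop) (b : Bool) (x f f' : ι) : Prop :=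
  if b then B x f f' else B x f' f

open scoped Classical in
/-- A contraction of loop labels with phases at the vertices that vanish unless an abelian
branching rule holds is an isoTNS. -/
theorem isIsoTNS_abelian [Nonempty ι] {B : ι → ι → ι → Prop} (hB : IsLatin B) (z : ι)
    (hz : ∀ x f, B x z f ↔ x = f) (t : Vertex m n → (Fin 3 → ι) → (Fin 3 → ι) → ℂ)
    (ht : ∀ v a f, ‖t v a f‖ =
      if ∀ e, EndRel B (v.pointsIn e) (a e) (f (e + 1)) (f (e + 2)) then 1 else 0)
    (u : ι → ℂ) (hu : ∀ f, ‖u f‖ = 1) (C : ℂ) (Ψ : Config ι m n → ℂ)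
    (hΨ : ∀ X, Ψ X = C * ∑ g : Face m n → ι, (∏ a, ∏ b, u (g (a, b))) *
      ∏ v : Vertex m n, t v (fun e => X (v.edge e)) fun e => (v.face e).elim z g) :
    IsIsoTNS (Fintype.card (ι × ι × ι)) (double Ψ) := by
  -- The boundary vertices are absorbed into their cells, those in the north and east into the upper
  -- vertex, those in the south and west into the lower one. They add no constraint: beside the
  -- empty outside the rim string equals the loop, and the rule for the third edge already holds in
  -- the cell.
  let Y : Fin (m + 1) → Fin (n + 1) → ι → ι → ι → ι → ι → ι → ℂ := fun r c i j k L T R =>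
    t (.up r c) ![i, k, j] ![R, T, L] * ((if r = 0 then t (.bN c) ![T, L, i] ![L, T, z] else 1) *
      if c = Fin.last n then t (.bE r) ![T, j, R] ![R, z, T] else 1)
  let Z : Fin (m + 1) → Fin (n + 1) → ι → ι → ι → ι → ι → ι → ℂ := fun r c l m' k L B R =>
    t (.dn r c) ![k, l, m'] ![B, R, L] *
      ((if r = Fin.last m then t (.bS c) ![m', B, R] ![z, R, B] else 1) *
      if c = 0 then t (.bW r) ![L, B, l] ![B, L, z] else 1)
  have hY : ∀ r c i j k L T R, ‖Y r c i j k L T R‖ =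
      if B i T L ∧ B j R T ∧ B k L R then 1 else 0 := by
    intro r c i j k L T R
    simp only [Y, norm_mul, apply_ite norm, norm_one, ht, EndRel, Fin.forall_fin_succ,
      Vertex.pointsIn]
    by_cases h1 : B i T L <;> by_cases h2 : B j R T <;> by_cases h3 : B k L R <;>
      simp [h1, h2, h3, hz]
  have hZ : ∀ r c l m' k L B' R, ‖Z r c l m' k L B' R‖ =
      if B l B' L ∧ B m' R B' ∧ B k L R then 1 else 0 := by
    intro r c l m' k L B' R
    simp only [Z, norm_mul, apply_ite norm, norm_one, ht, EndRel, Fin.forall_fin_succ,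
      Vertex.pointsIn]
    by_cases h1 : B l B' L <;> by_cases h2 : B m' R B' <;> by_cases h3 : B k L R <;>
      simp [h1, h2, h3, hz]
  have hcard : (0 : ℝ) < Fintype.card ι := by exact_mod_cast Fintype.card_pos
  have hs : ((Real.sqrt (Fintype.card ι) : ℝ) : ℂ) ≠ 0 := by
    exact_mod_cast (Real.sqrt_pos.2 hcard).ne'
  -- All quantum dimensions are 1 and D = |ι|, so |u|² must be 1/|ι|. The factor √|ι| per plaquette
  -- that this removes is restored in the constant.
  refine isIsoTNS_cellState (d := fun _ => 1) (D := Fintype.card ι) (v := fun _ => 1)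
    (u := fun f => u f / (Real.sqrt (Fintype.card ι) : ℝ)) (Bns := fun x f f' => B x f' f)
    (Bew := fun x f f' => B x f' f) (Bk := B) (Y := Y) (Z := Z)
    hcard (fun _ => one_pos) (fun _ => by simp) (fun x => ?_)
    hB.mirror.isBalanced hB.mirror.isBalanced hB.isBalanced
    (fun r c => isVertexTensor_of_norm hB.mirror hB.mirror hB fun i j k L T R => by
      rw [hY])
    (fun r c => isVertexTensor_of_norm hB.mirror hB.mirror hB fun i j k L T R => by
      rw [hZ])
    (C * ∏ _a : Fin (m + 2), ∏ _b : Fin (n + 2), ((Real.sqrt (Fintype.card ι) : ℝ) : ℂ)) Ψ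
    fun X => ?_
  · rw [Complex.conj_mul', norm_div, hu, Complex.norm_real, Real.norm_eq_abs,
      abs_of_nonneg (Real.sqrt_nonneg _)]
    norm_cast
    rw [div_pow, Real.sq_sqrt hcard.le, one_pow]
  · rw [hΨ, mul_assoc]
    congr 1
    rw [cellState, Finset.mul_sum]
    refine Finset.sum_congr rfl fun g _ => ?_
    split_ifs with hX
    · rw [← mul_assoc]
      congr 1
      · simp only [labelWeight, Finset.prod_const_one, one_mul, ite_self, mul_one,
          ← Finset.prod_mul_distrib, mul_div_cancel₀ _ hs]
      · have hv : ∀ v : Vertex m n, t v (fun e => X (v.edge e)) (fun e => (v.face e).elim z g) =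
            t v ![X (v.edge 0), X (v.edge 1), X (v.edge 2)]
              ![(v.face 0).elim z g, (v.face 1).elim z g, (v.face 2).elim z g] := fun v => by
          congr 1 <;> funext e <;> fin_cases e <;> rfl
        rw [Finset.prod_congr rfl fun v _ => hv v, prod_vertex]
        simp only [Y, Z, Finset.prod_mul_distrib, Vertex.edge, Vertex.face]
        have e1 : ∀ f : Fin (m + 1) → Fin (n + 1) → ℂ, (∏ r, ∏ c, if r = 0 then f r c else 1) =
            ∏ c, f 0 c := fun f => by
          rw [Finset.prod_eq_single 0 (fun r _ hr => by simp [hr]) (by simp)]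
          simp
        have e2 : ∀ f : Fin (m + 1) → Fin (n + 1) → ℂ,
            (∏ r, ∏ c, if r = Fin.last m then f r c else 1) = ∏ c, f (Fin.last m) c := fun f => by
          rw [Finset.prod_eq_single (Fin.last m) (fun r _ hr => by simp [hr]) (by simp)]
          simp
        rw [e1 fun r c => t (.bN c) _ _, e2 fun r c => t (.bS c) _ _]
        simp only [Finset.prod_ite_eq', Finset.mem_univ, if_true]
        simp [hX]
        ring
    · push Not at hX
      obtain ⟨p, hp⟩ := hX
      -- A configuration whose rim strings differ from the loops violates the rule at the vertex
      -- into which the rim edge points, where one of the two sides is the outside.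
      obtain ⟨v, e, hv, hve⟩ := exists_rim_end p true
      have : t v (fun e => X (v.edge e)) (fun e => (v.face e).elim z g) = 0 := by
        rw [← norm_eq_zero, ht, if_neg]
        intro h
        have := h e
        rw [Vertex.face_add_one, Vertex.face_add_two, hve, hv] at this
        exact hp ((hz _ _).1 this)
      rw [Finset.prod_eq_zero (Finset.mem_univ v) this]
      simp

end

/-! ### Fusion rules -/

namespace FusionRules

variable {N : ℕ} (R : FusionRules N)

theorem dual_eq_iff {a b : Fin (N + 1)} : R.dual a = b ↔ a = R.dual b :=
  ⟨fun h => by rw [← h, R.dual_dual], fun h => by rw [h, R.dual_dual]⟩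

theorem dual_injective : Function.Injective R.dual := fun a b h => by
  rw [← R.dual_dual a, h, R.dual_dual]

theorem allowed_rot {a b c : Fin (N + 1)} : R.allowed a b c ↔ R.allowed b c a :=
  ⟨R.allowed_rotate _ _ _, fun h => R.allowed_rotate _ _ _ (R.allowed_rotate _ _ _ h)⟩

theorem allowed_comm {a b c : Fin (N + 1)} : R.allowed a b c ↔ R.allowed b a c :=
  ⟨R.allowed_swap _ _ _, R.allowed_swap _ _ _⟩

theorem allowed_dual_iff {a b c : Fin (N + 1)} :
    R.allowed (R.dual a) (R.dual b) (R.dual c) ↔ R.allowed a b c :=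
  ⟨fun h => by simpa only [R.dual_dual] using R.allowed_dual _ _ _ h, R.allowed_dual _ _ _⟩

/-- The string `x` may separate plaquettes with the loop labels `f` and `f'`. -/
def Separates (x f f' : Fin (N + 1)) : Prop := R.allowed x f (R.dual f')

theorem separates_dual {x f f' : Fin (N + 1)} :
    R.Separates (R.dual x) f f' ↔ R.Separates x f' f := by
  rw [Separates, Separates, ← R.allowed_dual_iff, R.dual_dual, R.dual_dual, allowed_rot,
    allowed_comm, allowed_rot, allowed_rot]

/-- Applied to the empty outside, this identifies rim strings with loop labels. -/
theorem separates_zero {x f : Fin (N + 1)} : R.Separates x 0 f ↔ x = f := by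
  rw [Separates, allowed_rot, allowed_rot, R.allowed_zero, R.dual_dual]

theorem endRel_separates {b : Bool} {x f f' : Fin (N + 1)} :
    EndRel R.Separates b x f f' ↔ R.Separates (if b then x else R.dual x) f f' := by
  cases b
  · simp [EndRel, separates_dual]
  · simp [EndRel]

variable {R}

theorem IsAbelian.isLatin (h : R.IsAbelian) : IsLatin R.Separates where
  string f f' := by
    obtain ⟨x, hx, hu⟩ := h f (R.dual f')
    exact ⟨x, R.allowed_rot.2 hx, fun y hy => hu y (R.allowed_rot.1 hy)⟩
  left x f' := by
    obtain ⟨f, hf, hu⟩ := h (R.dual f') x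
    exact ⟨f, R.allowed_rot.1 hf, fun y hy => hu y (R.allowed_rot.2 hy)⟩
  right x f := by
    obtain ⟨y, hy, hu⟩ := h x f
    refine ⟨R.dual y, by simpa only [Separates, R.dual_dual] using hy, fun z hz => ?_⟩
    rw [← R.dual_eq_iff]
    exact hu _ hz

/-- Associativity of fusion supplies some intermediate string for the other channel, and uniqueness
of fusion identifies it with `n`; so the remaining constraint is automatic. -/
theorem IsAbelian.admissible_iff (h : R.IsAbelian) {i j m k l n : Fin (N + 1)} :
    R.Admissible i j m k l n ↔
      R.allowed i j m ∧ R.allowed k l (R.dual m) ∧ R.allowed j k (R.dual n) := by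
  refine ⟨fun ⟨h1, h2, _, h4⟩ => ⟨h1, h2, h4⟩, fun ⟨h1, h2, h4⟩ => ⟨h1, h2, ?_, h4⟩⟩
  have hc := R.allowed_assoc i j k l
  have : Nonempty {e // R.allowed i j (R.dual e) ∧ R.allowed e k l} :=
    ⟨⟨R.dual m, by rwa [R.dual_dual], R.allowed_rot.2 h2⟩⟩
  have hpos : 0 < Nat.card {f // R.allowed i f l ∧ R.allowed j k (R.dual f)} := by
    rw [← hc]
    exact Nat.card_pos
  obtain ⟨⟨⟨f, hf1, hf2⟩⟩, -⟩ := Nat.card_pos_iff.1 hpos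
  have : f = n := R.dual_injective ((h j k).unique hf2 h4)
  subst this
  exact R.allowed_comm.1 (R.allowed_rot.1 (R.allowed_rot.1 hf1))

-- Of the four fusion constraints of F at a vertex, three say that the strings separate the loops
-- beside them. The fourth, that the strings may meet, follows by `admissible_iff`.
open scoped Classical in
theorem IsAbelian.norm_abelianTensor (h : R.IsAbelian)
    {F : Fin (N + 1) → Fin (N + 1) → Fin (N + 1) →
      Fin (N + 1) → Fin (N + 1) → Fin (N + 1) → ℂ} (hF : R.IsAbelianFSymbol F) {m n : ℕ}
    {phase : Vertex m n → (Fin 3 → Fin (N + 1)) → (Fin 3 → Fin (N + 1)) → ℂ}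
    (hp : ∀ v a f, ‖phase v a f‖ = 1) (v : Vertex m n) (a f : Fin 3 → Fin (N + 1)) :
    ‖R.abelianTensor F phase v a f‖ =
      if ∀ e, R.Separates (a e) (f (e + 1)) (f (e + 2)) then 1 else 0 := by
  have hF' : ∀ i j m k l n, ‖F i j m k l n‖ = if R.Admissible i j m k l n then 1 else 0 := by
    intro i j m k l n
    split_ifs with h'
    · exact (hF i j m k l n).1 h'
    · rw [(hF i j m k l n).2 h', norm_zero]
  rw [abelianTensor, norm_mul, hp, one_mul, apply_ite norm, Complex.norm_conj, hF', hF']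
  have h3 : (∀ e : Fin 3, R.Separates (a e) (f (e + 1)) (f (e + 2))) ↔
      R.Separates (a 0) (f 1) (f 2) ∧ R.Separates (a 1) (f 2) (f 0) ∧
        R.Separates (a 2) (f 0) (f 1) := by
    simp only [Fin.forall_fin_succ]
    simp
  rw [if_congr h3 rfl rfl]
  cases v.isUpper
  · refine (if_congr h.admissible_iff rfl rfl).trans ?_
    have e1 : R.allowed (R.dual (a 1)) (R.dual (f 2)) (f 0) ↔ R.Separates (a 1) (f 2) (f 0) := by
      rw [Separates, ← R.allowed_dual_iff (a := a 1), R.dual_dual]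
    have e2 : R.allowed (f 1) (R.dual (a 2)) (R.dual (f 0)) ↔ R.Separates (a 2) (f 0) (f 1) := by
      rw [Separates, ← R.allowed_dual_iff (a := a 2), R.dual_dual, allowed_rot]
    have e3 : R.allowed (R.dual (f 2)) (f 1) (R.dual (R.dual (a 0))) ↔
        R.Separates (a 0) (f 1) (f 2) := by
      rw [Separates, R.dual_dual, allowed_comm, allowed_rot, allowed_rot]
    rw [e1, e2, e3]
    exact if_congr (by tauto) rfl rfl
  · refine (if_congr h.admissible_iff rfl rfl).trans ?_
    have e1 : R.allowed (a 0) (R.dual (f 2)) (f 1) ↔ R.Separates (a 0) (f 1) (f 2) := by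
      rw [Separates, allowed_rot, allowed_comm, allowed_rot, allowed_rot]
    have e2 : R.allowed (f 0) (a 2) (R.dual (f 1)) ↔ R.Separates (a 2) (f 0) (f 1) := by
      rw [Separates, allowed_comm]
    have e3 : R.allowed (R.dual (f 2)) (f 0) (R.dual (a 1)) ↔ R.Separates (a 1) (f 2) (f 0) := by
      rw [Separates, ← R.allowed_dual_iff (a := a 1), R.dual_dual, allowed_rot, allowed_rot,
        allowed_rot, allowed_rot, allowed_rot]
    rw [e1, e2, e3]
    exact if_congr (by tauto) rfl rfl

end FusionRules

open scoped Classical in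
/-- An abelian string-net tensor network with arbitrary phases is an isoTNS. -/
theorem FusionRules.IsAbelian.isIsoTNS {N : ℕ} {R : FusionRules N} (h : R.IsAbelian)
    {F : Fin (N + 1) → Fin (N + 1) → Fin (N + 1) →
      Fin (N + 1) → Fin (N + 1) → Fin (N + 1) → ℂ} (hF : R.IsAbelianFSymbol F) {m n : ℕ}
    (phase : Vertex m n → (Fin 3 → Fin (N + 1)) → (Fin 3 → Fin (N + 1)) → ℂ)
    (hp : ∀ v a f, ‖phase v a f‖ = 1) :
    IsIsoTNS (Fintype.card (Fin (N + 1) × Fin (N + 1) × Fin (N + 1)))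
      (double (loopNetwork R.dual 0 (R.abelianTensor F phase))) := by
  refine isIsoTNS_abelian h.isLatin 0 (fun x f => R.separates_zero)
    (fun v a f => R.abelianTensor F phase v
      (fun e => if v.pointsIn e then a e else R.dual (a e)) f) (fun v a f => ?_)
    (fun _ => 1) (fun _ => norm_one) 1 _ fun X => ?_
  · refine (h.norm_abelianTensor hF hp v _ f).trans ?_
    exact if_congr (forall_congr' fun e => R.endRel_separates.symm) rfl rfl
  · simp only [Finset.prod_const_one, one_mul]
    rfl

/-! ### Adding loops to plaquettes one after the other -/

section

variable {m n : ℕ}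

theorem fin_three_add (e : Fin 3) :
    e + 1 + 2 = e ∧ e + 1 + 1 = e + 2 ∧ e + 2 + 2 = e + 1 ∧ e + 2 + 1 = e := by
  revert e; decide

theorem Vertex.face_injective (v : Vertex m n) : Function.Injective v.face := by
  intro e e' h
  cases v <;> fin_cases e <;> fin_cases e' <;>
    simp [face, Fin.ext_iff] at h ⊢

theorem borders_of_side {p : Face m n} {E : Edge m n}
    (h : E.sideA = some p ∨ E.sideB = some p) : Borders p E := by
  obtain ⟨v, e, rfl, hb⟩ := exists_end E true
  rcases h with h | h
  · exact ⟨v, e + 1, by rw [v.face_add_one, hb, if_pos rfl, h], .inr (by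
      rw [add_assoc]; congr 1; exact add_zero e)⟩
  · exact ⟨v, e + 2, by rw [v.face_add_two, hb, if_pos rfl, h], .inl (by
      rw [add_assoc]; congr 1; exact add_zero e)⟩

theorem elim_update_of_ne {A ι : Type*} [DecidableEq A] {z : ι} {g : A → ι} {p : A} {x : ι}
    {o : Option A} (h : o ≠ some p) :
    o.elim z (Function.update g p x) = o.elim z g := by
  cases o with
  | none => rfl
  | some q => exact Function.update_of_ne (fun h' => h (by rw [h'])) _ _

theorem elim_update {A ι : Type*} [DecidableEq A] {z : ι} {g : A → ι} {p : A} {x : ι}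
    {o : Option A} :
    o.elim z (Function.update g p x) = if o = some p then x else o.elim z g := by
  split_ifs with h
  · subst h
    exact Function.update_self _ _ _
  · exact elim_update_of_ne h

/-- A labelling that is trivial at `p`, together with a new label for `p`, amounts to an arbitrary
labelling. This is the bookkeeping for filling one plaquette. -/
theorem sum_ite_eq_sum_update {A ι : Type*} [Fintype A] [DecidableEq A] [Fintype ι]
    [DecidableEq ι] (z : ι) (p : A) (h : (A → ι) → ι → ℂ) :
    ∑ g : A → ι, (if g p = z then ∑ s, h g s else 0) =
      ∑ g : A → ι, h (Function.update g p z) (g p) := by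
  rw [← Finset.sum_filter, ← Finset.sum_product']
  refine Finset.sum_bij' (fun q _ => Function.update q.1 p q.2)
    (fun g _ => (Function.update g p z, g p)) (by simp) (by simp) ?_ (by simp) ?_
  · rintro ⟨g, s⟩ hg
    have : g p = z := by simpa using hg
    ext x
    · by_cases hx : x = p
      · subst hx; simp [this]
      · simp [hx]
    · simp
  · rintro ⟨g, s⟩ hg
    have : g p = z := by simpa using hg
    subst this
    simp

open scoped Classical in
/-- The weight of the loop labels when loops have been added to the plaquettes of a list. -/
noncomputable def loopWeight {A ι : Type*} [Fintype A] (z : ι) (w : ι → ℂ) (l : List A)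
    (g : A → ι) : ℂ :=
  ∏ p, if p ∈ l then w (g p) else if g p = z then 1 else 0

theorem loopWeight_cons {A ι : Type*} [Fintype A] [DecidableEq A] {z : ι} {w : ι → ℂ} {l : List A}
    {p : A} (hp : p ∉ l) (g : A → ι) :
    loopWeight z w (p :: l) g = loopWeight z w l (Function.update g p z) * w (g p) := by
  unfold loopWeight
  rw [← Finset.mul_prod_erase _ _ (Finset.mem_univ p),
    ← Finset.mul_prod_erase _ _ (Finset.mem_univ p), if_pos List.mem_cons_self, if_neg hp,
    if_pos (Function.update_self _ _ _), one_mul, mul_comm]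
  congr 1
  refine Finset.prod_congr rfl fun q hq => ?_
  have hq : q ≠ p := Finset.ne_of_mem_erase hq
  rw [Function.update_of_ne hq]
  by_cases hql : q ∈ l
  · rw [if_pos hql, if_pos (List.mem_cons_of_mem _ hql)]
  · rw [if_neg hql, if_neg fun h => (List.mem_cons.1 h).elim hq hql]

theorem loopWeight_eq_zero {A ι : Type*} [Fintype A] {z : ι} {w : ι → ℂ} {l : List A} {p : A}
    (hp : p ∉ l) {g : A → ι} (hg : g p ≠ z) : loopWeight z w l g = 0 := by
  refine Finset.prod_eq_zero (Finset.mem_univ p) ?_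
  rw [if_neg hp, if_neg hg]

theorem loopWeight_nil {A ι : Type*} [Fintype A] {z : ι} {w : ι → ℂ} {g : A → ι}
    (hg : g ≠ fun _ => z) : loopWeight z w [] g = 0 := by
  obtain ⟨p, hp⟩ := Function.ne_iff.1 hg
  exact loopWeight_eq_zero List.not_mem_nil hp

theorem loopWeight_of_forall_mem {A ι : Type*} [Fintype A] {z : ι} {w : ι → ℂ} {l : List A}
    (hl : ∀ p, p ∈ l) (g : A → ι) : loopWeight z w l g = ∏ p, w (g p) :=
  Finset.prod_congr rfl fun p _ => if_pos (hl p)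

end

/-! ### The ground states of the Lin–Levin models -/

namespace LinLevin

variable {G : Type} [AddCommGroup G] (L : LinLevin G) {m n : ℕ}

/-- The string configuration that results from loops in the plaquettes. -/
def loopConfig (g : Face m n → G) : Config G m n :=
  fun E => E.sideB.elim 0 g - E.sideA.elim 0 g

theorem inward_loopConfig (g : Face m n → G) (v : Vertex m n) (e : Fin 3) :
    inward Neg.neg (loopConfig g) v e =
      (v.face (e + 2)).elim 0 g - (v.face (e + 1)).elim 0 g := by
  rw [inward, v.face_add_one, v.face_add_two, loopConfig]
  split_ifs <;> simp

theorem inward_injective {X X' : Config G m n} {v : Vertex m n} {e : Fin 3}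
    (h : inward Neg.neg X v e = inward Neg.neg X' v e) : X (v.edge e) = X' (v.edge e) := by
  unfold inward at h
  split_ifs at h with hb
  · exact h
  · exact neg_injective h

/-- The rim edge of an empty plaquette has vacuum on both sides, so its string is trivial and F has
a zero argument. -/
theorem turn_eq_one {p : Face m n} {g : Face m n → G} (hg : g p = 0) (s : G) :
    L.turn m n p (loopConfig g) s = 1 := by
  have h : ∀ q : RimFace m n, p = q.1 → L.F (- -loopConfig g (.rim q) - s) s
      (-loopConfig g (.rim q)) = 1 := by
    rintro q rfl
    have : loopConfig g (.rim q) = 0 := by simp [loopConfig, Edge.sideA, Edge.sideB, hg]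
    rw [this, neg_zero, L.F_zero_right]
  unfold turn
  have h1 := h ⟨(0, Fin.last _), .inl (.inl rfl)⟩
  have h2 := h ⟨(Fin.last _, 0), .inl (.inr rfl)⟩
  by_cases e1 : p = (0, Fin.last _) <;> by_cases e2 : p = (Fin.last _, 0)
  · simp only [if_pos e1, if_pos e2, h1 e1, h2 e2, inv_one, mul_one]
  · simp only [if_pos e1, if_neg e2, h1 e1, mul_one]
  · simp only [if_neg e1, if_pos e2, h2 e2, inv_one, mul_one]
  · simp only [if_neg e1, if_neg e2, mul_one]

theorem norm_corner (b : Bool) (a : Fin 3 → G) (s : G) (e : Fin 3) : ‖L.corner b a s e‖ = 1 := by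
  cases b <;> fin_cases e <;> simp [corner, L.norm_F]

-- The shifts at the corners determine the new strings completely: they are those of the loop labels
-- with −s at `p`. The sign comes from the orientation convention of `loopConfig`.
open scoped Classical in
theorem addLoop_loopConfig {p : Face m n} {g : Face m n → G} (hg : g p = 0) (s : G)
    (X : Config G m n) :
    L.addLoop m n p s X (loopConfig g) =
      if X = loopConfig (Function.update g p (-s)) then
        ∏ v : Vertex m n, ∏ e : Fin 3, if v.face e = some p then
          L.corner v.isUpper (inward Neg.neg (loopConfig g) v) s e else 1
      else 0 := by
  unfold addLoop
  rw [L.turn_eq_one hg, one_mul]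
  have hi : ∀ (v : Vertex m n) (e : Fin 3), v.face e = some p →
      inward Neg.neg (loopConfig (Function.update g p (-s))) v (e + 1) =
        inward Neg.neg (loopConfig g) v (e + 1) - s ∧
      inward Neg.neg (loopConfig (Function.update g p (-s))) v (e + 2) =
        inward Neg.neg (loopConfig g) v (e + 2) + s := by
    intro v e he
    have n1 : v.face (e + 1) ≠ some p := fun h => by
      have := v.face_injective (h.trans he.symm)
      exact absurd this (by fin_cases e <;> decide)
    have n2 : v.face (e + 2) ≠ some p := fun h => by
      have := v.face_injective (h.trans he.symm)
      exact absurd this (by fin_cases e <;> decide)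
    obtain ⟨a1, a2, a3, a4⟩ := fin_three_add e
    simp only [inward_loopConfig, a1, a2, a3, a4, elim_update_of_ne n1, elim_update_of_ne n2, he,
      Option.elim_some, Function.update_self, hg]
    constructor <;> abel
  refine if_congr ⟨fun ⟨h1, h2⟩ => ?_, fun h => ?_⟩ rfl rfl
  · funext E
    by_cases hE : Borders p E
    · obtain ⟨v, e, he, rfl | rfl⟩ := hE
      · exact inward_injective ((h2 v e he).2.1.trans (hi v e he).1.symm)
      · exact inward_injective ((h2 v e he).2.2.trans (hi v e he).2.symm)
    · rw [h1 E hE, loopConfig, loopConfig, elim_update_of_ne fun h => hE (borders_of_side (.inr h)),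
        elim_update_of_ne fun h => hE (borders_of_side (.inl h))]
  · subst h
    refine ⟨fun E hE => ?_, fun v e he => ⟨?_, hi v e he⟩⟩
    · rw [loopConfig, loopConfig, elim_update_of_ne fun h => hE (borders_of_side (.inr h)),
        elim_update_of_ne fun h => hE (borders_of_side (.inl h))]
    · simp only [inward_loopConfig]
      change (v.face 2).elim 0 g - (v.face 1).elim 0 g + ((v.face 0).elim 0 g - (v.face 2).elim 0 g)
        + ((v.face 1).elim 0 g - (v.face 0).elim 0 g) = 0
      abel

variable [Fintype G] [DecidableEq G]

omit [DecidableEq G] in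
theorem plaquette_apply (p : Face m n) (X' X : Config G m n) :
    L.plaquette m n p X' X = ∑ s, L.d s / (Fintype.card G : ℂ) * L.addLoop m n p s X' X := by
  simp only [plaquette, Matrix.sum_apply, Matrix.smul_apply, smul_eq_mul]

-- Induction on the plaquettes already filled. Since each is filled once, starting empty, a corner
-- phase depends only on the loops around that vertex, and the accumulated phase remains a product
-- of functions of modulus 1 at the vertices.
open scoped Classical in
theorem exists_phase (l : List (Face m n)) (hl : l.Nodup) :
    ∃ θ : Vertex m n → (Fin 3 → G) → ℂ, (∀ v f, ‖θ v f‖ = 1) ∧ ∀ X,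
      ((l.map (L.plaquette m n)).prod.mulVec (Pi.single (fun _ => 0) 1)) X =
        ∑ g : Face m n → G,
          loopWeight 0 (fun x => L.d (-x) / (Fintype.card G : ℂ)) l g *
          (∏ v, θ v fun e => (v.face e).elim 0 g) * if X = loopConfig g then 1 else 0 := by
  induction l with
  | nil =>
    refine ⟨fun _ _ => 1, by simp, fun X => ?_⟩
    rw [Finset.sum_eq_single 0]
    · have : loopConfig (0 : Face m n → G) = fun _ => 0 := by
        funext E
        simp only [loopConfig]
        cases E.sideA <;> cases E.sideB <;> simp
      simp only [this, loopWeight, List.map_nil, List.prod_nil, Matrix.one_mulVec, Pi.single_apply]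
      simp
    · intro g _ hg
      rw [loopWeight_nil (z := (0 : G)) hg, zero_mul, zero_mul]
    · simp
  | cons p l ih =>
    rw [List.nodup_cons] at hl
    obtain ⟨θ, hθ, h⟩ := ih hl.2
    -- `f₀` is the set of loops around the vertex before `p` is filled, and `κ` is the corner phase
    -- expressed through the loops after it is filled.
    let f₀ : Vertex m n → (Fin 3 → G) → Fin 3 → G := fun v f e =>
      if v.face e = some p then 0 else f e
    let κ : Vertex m n → (Fin 3 → G) → ℂ := fun v f => ∏ e, if v.face e = some p then
      L.corner v.isUpper (fun e => f₀ v f (e + 2) - f₀ v f (e + 1)) (-f e) e else 1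
    refine ⟨fun v f => θ v (f₀ v f) * κ v f, fun v f => ?_, fun X => ?_⟩
    · rw [norm_mul, hθ, one_mul, norm_prod]
      exact Finset.prod_eq_one fun e _ => by split_ifs <;> simp [norm_corner]
    rw [List.map_cons, List.prod_cons, ← Matrix.mulVec_mulVec, Matrix.mulVec, dotProduct]
    simp only [h]
    let W := loopWeight (A := Face m n) 0 (fun x => L.d (-x) / (Fintype.card G : ℂ)) l
    have h1 : ∑ X', L.plaquette m n p X X' * ∑ g : Face m n → G,
        W g * (∏ v, θ v fun e => (v.face e).elim 0 g) * (if X' = loopConfig g then 1 else 0) =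
        ∑ g : Face m n → G, W g * (∏ v, θ v fun e => (v.face e).elim 0 g) *
          L.plaquette m n p X (loopConfig g) := by
      simp only [Finset.mul_sum]
      rw [Finset.sum_comm]
      refine Finset.sum_congr rfl fun g _ => ?_
      rw [Finset.sum_eq_single (loopConfig g) (fun X' _ hX => by simp [hX]) (by simp)]
      simp [mul_comm]
    refine h1.trans ?_
    let H : (Face m n → G) → G → ℂ := fun g x =>
      W g * (∏ v, θ v fun e => (v.face e).elim 0 g) * (L.d (-x) / (Fintype.card G : ℂ) *
        if X = loopConfig (Function.update g p x) then
          ∏ v : Vertex m n, ∏ e : Fin 3, if v.face e = some p then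
            L.corner v.isUpper (inward Neg.neg (loopConfig g) v) (-x) e else 1
        else 0)
    have h2 : ∀ g : Face m n → G, W g * (∏ v, θ v fun e => (v.face e).elim 0 g) *
          L.plaquette m n p X (loopConfig g) = if g p = 0 then ∑ x, H g x else 0 := by
      intro g
      split_ifs with hg
      -- Adding `s` produces the label −s, so the sum is reindexed by the final label `x`; this is
      -- the origin of `L.d (-x)` in the weight.
      · rw [plaquette_apply, ← Equiv.sum_comp (Equiv.neg G), Finset.mul_sum]
        refine Finset.sum_congr rfl fun x _ => ?_
        rw [Equiv.neg_apply, L.addLoop_loopConfig hg, neg_neg]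
        by_cases hX : X = loopConfig (Function.update g p x)
        · simp only [H, if_pos hX]
        · simp only [H, if_neg hX]
      · simp only [W, loopWeight_eq_zero hl.1 hg, zero_mul]
    rw [Finset.sum_congr rfl fun g _ => h2 g, sum_ite_eq_sum_update]
    refine Finset.sum_congr rfl fun g _ => ?_
    simp only [H, Function.update_idem, Function.update_eq_self]
    have w2 : ∀ v : Vertex m n, (fun e => (v.face e).elim 0 (Function.update g p 0)) =
        f₀ v fun e => (v.face e).elim 0 g := fun v => by
      funext e
      exact elim_update
    have w3 : ∀ v : Vertex m n, (∏ e : Fin 3, if v.face e = some p then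
            L.corner v.isUpper (inward Neg.neg (loopConfig (Function.update g p 0)) v) (-g p) e
            else 1) = κ v fun e => (v.face e).elim 0 g := fun v => by
      refine Finset.prod_congr rfl fun e _ => ?_
      split_ifs with he
      · have : inward Neg.neg (loopConfig (Function.update g p 0)) v = fun e =>
            f₀ v (fun e => (v.face e).elim 0 g) (e + 2) -
              f₀ v (fun e => (v.face e).elim 0 g) (e + 1) := by
          funext e
          rw [inward_loopConfig, ← w2]
        have hgp : g p = (v.face e).elim 0 g := by rw [he, Option.elim_some]
        rw [this, hgp]
      · rfl
    rw [loopWeight_cons hl.1]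
    simp only [W, w2, w3, Finset.prod_mul_distrib]
    split_ifs
    · ring
    · ring

open scoped Classical in
theorem isIsoTNS_groundState (m n : ℕ) :
    IsIsoTNS (Fintype.card (G × G × G)) (double (L.groundState m n)) := by
  obtain ⟨θ, hθ, h⟩ := L.exists_phase (Finset.univ : Finset (Face m n)).toList
    (Finset.nodup_toList _)
  let B : G → G → G → Prop := fun x f f' => x = f' - f
  have hB : IsLatin B := by
    refine ⟨fun f f' => ⟨f' - f, rfl, fun y hy => hy⟩, fun x f' => ⟨f' - x, ?_, ?_⟩,
      fun x f => ⟨x + f, ?_, ?_⟩⟩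
    · simp [B]
    · intro y hy
      simp only [B] at hy
      simp [hy]
    · simp [B]
    · intro y hy
      simp only [B] at hy
      simp [hy]
  refine isIsoTNS_abelian hB 0 (fun x f => by simp [B])
    (fun v a f => if ∀ e, EndRel B (v.pointsIn e) (a e) (f (e + 1)) (f (e + 2)) then θ v f else 0)
    (fun v a f => by split_ifs <;> simp [hθ])
    (fun f => L.d (-f)) (fun f => L.norm_d _)
    (∏ _p : Face m n, (Fintype.card G : ℂ)⁻¹) _ fun X => ?_
  rw [groundState, h, Finset.mul_sum]
  refine Finset.sum_congr rfl fun g _ => ?_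
  -- Every edge ends at a vertex, so the condition that the strings come from the loops splits into
  -- conditions at vertices, which become part of the vertex tensors.
  have hX : X = loopConfig g ↔ ∀ (v : Vertex m n) (e : Fin 3),
      EndRel B (v.pointsIn e) (X (v.edge e)) ((v.face (e + 1)).elim 0 g)
        ((v.face (e + 2)).elim 0 g) := by
    have key : ∀ (v : Vertex m n) (e : Fin 3),
      EndRel B (v.pointsIn e) (X (v.edge e)) ((v.face (e + 1)).elim 0 g)
        ((v.face (e + 2)).elim 0 g) ↔ X (v.edge e) = loopConfig g (v.edge e) := by
      intro v e
      rw [EndRel, v.face_add_one, v.face_add_two]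
      cases v.pointsIn e <;> exact Iff.rfl
    simp only [key]
    refine ⟨fun h v e => by rw [h], fun h => funext fun E => ?_⟩
    obtain ⟨v, e, rfl, -⟩ := exists_end E true
    exact h v e
  have hw : ∏ p : Face m n, (L.d (-g p) / (Fintype.card G : ℂ)) =
      (∏ _p : Face m n, (Fintype.card G : ℂ)⁻¹) * ∏ a, ∏ b, L.d (-g (a, b)) := by
    rw [← Fintype.prod_prod_type' (f := fun a b => L.d (-g (a, b))), ← Finset.prod_mul_distrib]
    exact Finset.prod_congr rfl fun p _ => by rw [div_eq_mul_inv, mul_comm]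
  rw [loopWeight_of_forall_mem fun p => Finset.mem_toList.2 (Finset.mem_univ p), hw,
    Finset.prod_ite_zero, mul_assoc, mul_assoc]
  congr 2
  by_cases hX' : X = loopConfig g
  · rw [if_pos hX', mul_one, if_pos fun v _ => hX.1 hX' v]
  · rw [if_neg hX', mul_zero, if_neg fun h' => hX' (hX.2 fun v => h' v (Finset.mem_univ v))]

end LinLevin

/-! ### The algebra of Levin–Wen models -/

namespace LevinWen

variable {N : ℕ} (M : LevinWen N)

theorem v_ne_zero (s : Fin (N + 1)) : M.v s ≠ 0 := fun h => by
  have := M.v_sq s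
  simp [h] at this

theorem allowed_pair (s : Fin (N + 1)) : M.allowed s (M.dual s) 0 := (M.allowed_zero _ _).2 rfl

theorem sum_dual {A : Type*} [AddCommMonoid A] (f : Fin (N + 1) → A) :
    ∑ x, f (M.dual x) = ∑ x, f x :=
  Equiv.sum_comp (Function.Involutive.toPerm M.dual M.dual_dual) f

theorem v_zero : M.v 0 = 1 := by
  have h0 : M.allowed 0 0 0 := (M.allowed_zero _ _).2 M.dual_zero.symm
  have h1 := M.normalization 0 0 0 h0
  have h2 := M.v_sq 0
  rw [M.dual_zero] at h1 h2
  rw [h1] at h2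
  have := M.v_ne_zero 0
  field_simp at h2
  exact h2

theorem v_dual (s : Fin (N + 1)) : M.v (M.dual s) = M.v s := by
  have h1 := M.normalization s (M.dual s) 0 (M.allowed_pair s)
  have h2 := M.v_sq s
  rw [M.dual_dual] at h1
  rw [h1, M.v_zero] at h2
  have := M.v_ne_zero s
  have := M.v_ne_zero (M.dual s)
  field_simp at h2
  exact h2.symm

theorem d_dual (s : Fin (N + 1)) : M.d (M.dual s) = M.d s := by rw [d, d, v_dual]

theorem d_pos (s : Fin (N + 1)) : 0 < M.d s := by
  have := norm_pos_iff.2 (M.v_ne_zero s)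
  unfold d
  positivity

theorem conj_v_mul_v (s : Fin (N + 1)) : conj (M.v s) * M.v s = M.d s := by
  rw [Complex.conj_mul', d]
  push_cast
  rfl

theorem totalDim_pos : 0 < M.totalDim :=
  Finset.sum_pos (fun s _ => pow_pos (M.d_pos s) 2) Finset.univ_nonempty

-- The tetrahedral symmetries move the trivial index to the last place, where the normalization
-- gives the value.
open scoped Classical in
theorem F_pair (m p n : Fin (N + 1)) :
    M.F m (M.dual m) 0 p (M.dual p) n =
      if M.allowed (M.dual p) m n then M.v n / (M.v p * M.v m) else 0 := by
  have hm := M.v_ne_zero m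
  have hp := M.v_ne_zero p
  have hn := M.v_ne_zero n
  have h : M.F m (M.dual m) 0 p (M.dual p) n = M.F (M.dual p) m n (M.dual m) p 0 := by
    rw [M.tetrahedral₃ m, M.tetrahedral₂ m, M.tetrahedral₁ n, M.tetrahedral₃ (M.dual p)]
    simp only [M.dual_dual, M.v_dual, M.v_zero]
    field_simp
  rw [h]
  split_ifs with ha
  · have := M.normalization _ _ _ ha
    rwa [M.dual_dual, M.v_dual] at this
  · exact M.F_eq_zero _ _ _ _ _ _ fun h' => ha h'.1

theorem F_vacuum {i j m : Fin (N + 1)} (h : M.allowed i j m) : M.F i j m 0 m j = 1 := by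
  have hm := M.v_ne_zero m
  have hj := M.v_ne_zero j
  have hi := M.v_ne_zero i
  rw [M.tetrahedral₂, M.tetrahedral₃]
  have h0 := M.F_pair m (M.dual j) i
  rw [M.dual_dual] at h0
  rw [h0, if_pos (by
    rw [M.allowed_rot, M.allowed_comm, M.allowed_rot, M.allowed_rot]
    exact M.allowed_comm.1 h)]
  simp only [M.v_dual, M.v_zero]
  field_simp

theorem allowed_zero_middle {i j : Fin (N + 1)} : M.allowed i 0 j ↔ j = M.dual i := by
  rw [M.allowed_comm, M.allowed_rot, M.allowed_zero]

open scoped Classical in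
theorem F_vacuum_eq_ite (i j m l n : Fin (N + 1)) :
    M.F i j m 0 l n = if l = m ∧ n = j ∧ M.allowed i j m then 1 else 0 := by
  split_ifs with h
  · obtain ⟨rfl, rfl, h⟩ := h
    exact M.F_vacuum h
  · refine M.F_eq_zero _ _ _ _ _ _ fun ⟨h1, h2, h3, h4⟩ => h ⟨?_, ?_, h1⟩
    · rw [M.allowed_rot, M.allowed_zero] at h2
      rw [← M.dual_dual l, ← h2, M.dual_dual]
    · rw [M.allowed_zero_middle] at h4
      exact M.dual_injective h4

-- Unitarity of F is the pentagon with one label trivial: one factor on each side becomes an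
-- explicit quotient of `v`, the other two on the left become F and its conjugate, and the vacuum
-- symbol on the right gives the Kronecker delta.
open scoped Classical in
theorem sum_F_mul_conj (j p c e i r : Fin (N + 1)) :
    ∑ n, M.F j p i c e n * conj (M.F j p r c e n) =
      if r = i ∧ M.allowed j p i ∧ M.allowed c e (M.dual i) then 1 else 0 := by
  have hc := M.v_ne_zero c
  have hp := M.v_ne_zero p
  have he := M.v_ne_zero e
  have hi := M.v_ne_zero i
  have hpent := M.pentagon i j p (M.dual (M.dual c)) (M.dual c) p 0 (M.dual r) (M.dual e)
  have hterm : ∀ n, M.F (M.dual c) (M.dual (M.dual c)) 0 p (M.dual p) n *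
      M.F j i p (M.dual c) n (M.dual (M.dual e)) *
      M.F j (M.dual (M.dual e)) n (M.dual (M.dual c)) p (M.dual (M.dual r)) =
      M.v e / (M.v i * M.v c) * (M.F j p i c e n * conj (M.F j p r c e n)) := by
    intro n
    have hn := M.v_ne_zero n
    have hr := M.v_ne_zero r
    have e1 : M.F j i p (M.dual c) n (M.dual (M.dual e)) =
        M.v p * M.v e / (M.v i * M.v n) * M.F j p i c e n := by
      rw [M.tetrahedral₃, M.dual_dual, M.dual_dual]
    -- Conjugation dualizes all six indices, and the tetrahedral symmetries bring the result to this
    -- form; the ratios of `v` cancel.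
    have e2 : M.F j (M.dual (M.dual e)) n (M.dual (M.dual c)) p (M.dual (M.dual r)) =
        conj (M.F j p r c e n) := by
      rw [← M.unitary, M.dual_dual, M.dual_dual, M.dual_dual, M.tetrahedral₃ j e, M.tetrahedral₂ j,
        M.tetrahedral₁ r, M.tetrahedral₃ (M.dual c), M.tetrahedral₂ (M.dual c),
        M.tetrahedral₁ (M.dual p)]
      simp only [M.v_dual]
      field_simp
    rw [e1, e2, M.F_pair]
    split_ifs with h
    · rw [M.v_dual]
      field_simp
    -- Where the explicit factor vanishes by its fusion constraint, F vanishes by the same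
    -- constraint, so the terms agree.
    · have : M.F j p i c e n = 0 := M.F_eq_zero _ _ _ _ _ _ fun h' => h (by
        rw [← M.allowed_dual_iff, M.dual_dual, M.dual_dual]
        exact h'.2.2.2)
      simp [this]
  rw [Finset.sum_congr rfl fun n _ => hterm n, ← Finset.mul_sum, M.dual_zero, M.dual_dual r,
    M.F_vacuum_eq_ite] at hpent
  have hk : M.v e / (M.v i * M.v c) ≠ 0 := div_ne_zero he (mul_ne_zero hi hc)
  refine mul_left_cancel₀ hk (hpent.trans ?_)
  by_cases hr : r = i
  · subst hr
    have := M.F_pair (M.dual r) (M.dual c) (M.dual (M.dual e))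
    simp only [M.dual_dual] at this ⊢
    rw [this]
    have h1 : M.allowed j r p ↔ M.allowed j p r := by
      rw [M.allowed_comm, M.allowed_rot]
    have h2 : M.allowed c (M.dual r) e ↔ M.allowed c e (M.dual r) := by
      rw [M.allowed_comm, M.allowed_rot]
    simp only [h1, h2, M.v_dual, true_and]
    by_cases h3 : M.allowed j p r <;> by_cases h4 : M.allowed c e (M.dual r) <;>
      simp [h3, h4, mul_comm]
  · rw [if_neg fun h => hr h.2.1, if_neg fun h => hr h.1]
    simp

open scoped Classical in
theorem sum_conj_F_mul (i j k l m m' : Fin (N + 1)) :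
    ∑ n, conj (M.F i j m k l n) * M.F i j m' k l n =
      if m = m' ∧ M.allowed i j m ∧ M.allowed k l (M.dual m) then 1 else 0 := by
  have h := M.sum_F_mul_conj i j k l m' m
  simp only [mul_comm (M.F _ _ _ _ _ _)] at h
  rw [h]
  by_cases hm : m = m'
  · subst hm
    rfl
  · rw [if_neg fun h => hm h.1, if_neg fun h => hm h.1]

-- For fixed `i`, `j`, `k`, `l`, the symbol is a square matrix in `n` and `m` whose allowed columns
-- are orthonormal. Completing these to a unitary matrix gives `A`.
open scoped Classical in
theorem exists_isASymbol : ∃ A, M.IsASymbol A := by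
  have h := fun i j k l => exists_isometry_extension le_rfl
    (Matrix.of fun n m => M.F i j m k l n)
    {m | M.allowed i j m ∧ M.allowed k l (M.dual m)} fun m hm m' _ => by
      simp only [Matrix.of_apply]
      rw [M.sum_conj_F_mul]
      by_cases hmm : m = m'
      · rw [if_pos ⟨hmm, hm⟩, if_pos hmm]
      · rw [if_neg fun h => hmm h.1, if_neg hmm]
  choose A hA hF using h
  refine ⟨fun i j m k l n => A i j k l n m, fun i j m k l n => ?_, fun i j k l m m' => ?_⟩
  · split_ifs with h
    · exact (hF i j k l n m h).symm
    · exact M.F_eq_zero _ _ _ _ _ _ fun h' => h ⟨h'.1, h'.2.1⟩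
  · have := congrFun (congrFun (hA i j k l) m) m'
    rw [Matrix.mul_apply, Matrix.one_apply] at this
    exact this

-- This is the normalization of the column m = 0 of F, whose entries have squared modulus d_n / (d_i
-- d_k) where fusion allows them.
open scoped Classical in
theorem sum_allowed_d (i k : Fin (N + 1)) :
    ∑ n, (if M.allowed i k n then M.d n else 0) = M.d i * M.d k := by
  have h := M.sum_conj_F_mul i (M.dual i) (M.dual k) (M.dual (M.dual k)) 0 0
  rw [if_pos ⟨rfl, M.allowed_pair i, by rw [M.dual_zero]; exact M.allowed_pair _⟩] at h
  have hi := M.d_pos i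
  have hk := M.d_pos k
  have hterm : ∀ n, conj (M.F i (M.dual i) 0 (M.dual k) (M.dual (M.dual k)) n) *
      M.F i (M.dual i) 0 (M.dual k) (M.dual (M.dual k)) n =
      ((((if M.allowed i k n then M.d n else 0) / (M.d i * M.d k) : ℝ)) : ℂ) := by
    intro n
    rw [Complex.conj_mul', M.F_pair, M.dual_dual, M.v_dual, M.allowed_comm]
    split_ifs with h
    · simp only [norm_div, norm_mul, d]
      push_cast
      rw [div_pow, mul_pow, mul_comm]
    · simp
  rw [Finset.sum_congr rfl fun n _ => hterm n, ← Complex.ofReal_sum, ← Finset.sum_div] at h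
  have h' := Complex.ofReal_eq_one.1 h
  rw [div_eq_one_iff_eq (by positivity)] at h'
  exact h'

-- For a fixed string x the sum over the other loop is d_x² times the given dimension, by
-- `sum_allowed_d`; then ∑ d_x² = D.
open scoped Classical in
theorem isBalanced : IsBalanced M.d M.totalDim M.Separates where
  left f := by
    have : ∀ x, (∑ f', if M.Separates x f f' then M.d x * M.d f' else 0) = M.d x ^ 2 * M.d f := by
      intro x
      have h := M.sum_allowed_d x f
      rw [← M.sum_dual] at h
      rw [sq, mul_assoc, ← h, Finset.mul_sum]
      refine Finset.sum_congr rfl fun y _ => ?_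
      rw [mul_ite, mul_zero]
      exact if_congr Iff.rfl (by simp [M.d_dual]) rfl
    rw [Finset.sum_congr rfl fun x _ => this x, ← Finset.sum_mul, totalDim]
  right f' := by
    have : ∀ x, (∑ f, if M.Separates x f f' then M.d x * M.d f else 0) = M.d x ^ 2 * M.d f' := by
      intro x
      have h := M.sum_allowed_d x (M.dual f')
      rw [sq, mul_assoc, ← M.d_dual f', ← h, Finset.mul_sum]
      refine Finset.sum_congr rfl fun y _ => ?_
      rw [mul_ite, mul_zero]
      refine if_congr ?_ rfl rfl
      rw [FusionRules.Separates, M.allowed_comm, M.allowed_rot]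
    rw [Finset.sum_congr rfl fun x _ => this x, ← Finset.sum_mul, totalDim]

theorem isBalanced_swap : IsBalanced M.d M.totalDim fun x f f' => M.Separates x f' f :=
  ⟨M.isBalanced.right, M.isBalanced.left⟩

/-! ### The symmetric vertex symbols -/

/-- The amplitude of a vertex with strings `a` and loops `f` in the opposite plaquettes, normalized
so that it is invariant under rotations. -/
noncomputable def vertexSymbol (a f : Fin 3 → Fin (N + 1)) : ℂ :=
  M.F (a 0) (M.dual (f 2)) (f 1) (f 0) (a 2) (a 1) / (M.v (f 1) * M.v (a 1))

theorem vertexSymbol_rotate (a f : Fin 3 → Fin (N + 1)) :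
    M.vertexSymbol a f =
      M.F (a 1) (M.dual (f 0)) (f 2) (f 1) (a 0) (a 2) / (M.v (f 2) * M.v (a 2)) := by
  have h1 := M.v_ne_zero (f 1)
  have h2 := M.v_ne_zero (a 1)
  rw [vertexSymbol, M.tetrahedral₃, M.tetrahedral₂, M.dual_dual, M.v_dual]
  field_simp

theorem vertexSymbol_eq (a f : Fin 3 → Fin (N + 1)) (e : Fin 3) :
    M.vertexSymbol a f =
      M.F (a e) (M.dual (f (e + 2))) (f (e + 1)) (f e) (a (e + 2)) (a (e + 1)) /
        (M.v (f (e + 1)) * M.v (a (e + 1))) := by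
  have h : ∀ a f : Fin 3 → Fin (N + 1),
      M.vertexSymbol a f = M.vertexSymbol (fun e => a (e + 1)) fun e => f (e + 1) :=
    fun a f => M.vertexSymbol_rotate a f
  have h2 : M.vertexSymbol a f = M.vertexSymbol (fun e => a (e + 2)) fun e => f (e + 2) := by
    rw [h, h]
    simp only [(fin_three_add _).2.1]
  fin_cases e
  · rfl
  · exact h a f
  · exact h2

theorem separates_of_vertexSymbol_ne_zero {a f : Fin 3 → Fin (N + 1)}
    (h : M.vertexSymbol a f ≠ 0) (e : Fin 3) : M.Separates (a e) (f (e + 1)) (f (e + 2)) := by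
  rw [M.vertexSymbol_eq a f e] at h
  by_contra h'
  refine h ?_
  rw [M.F_eq_zero, zero_div]
  rintro ⟨h1, -⟩
  exact h' (M.allowed_comm.1 (M.allowed_rot.1 (M.allowed_rot.1 h1)))

-- With an empty plaquette F has a vacuum index and reduces to constraints: the two strings beside
-- that plaquette copy the loops on their other sides. It serves for plaquettes not yet filled and
-- for the boundary vertices.
open scoped Classical in
theorem vertexSymbol_of_zero {a f : Fin 3 → Fin (N + 1)} {e : Fin 3} (he : f e = 0) :
    M.vertexSymbol a f =
      if a (e + 2) = f (e + 1) ∧ a (e + 1) = M.dual (f (e + 2)) ∧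
        M.Separates (a e) (f (e + 1)) (f (e + 2)) then
        (M.v (f (e + 1)) * M.v (f (e + 2)))⁻¹ else 0 := by
  have h : M.allowed (a e) (M.dual (f (e + 2))) (f (e + 1)) ↔
      M.Separates (a e) (f (e + 1)) (f (e + 2)) := by
    rw [FusionRules.Separates, M.allowed_comm, M.allowed_rot]
  rw [M.vertexSymbol_eq a f e, he, M.F_vacuum_eq_ite, h]
  split_ifs with h'
  · rw [h'.2.1, M.v_dual, one_div]
  · rw [zero_div]

/-- Conjugation dualizes all indices, so lower vertices have the same symmetric symbol as upper
ones. -/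
theorem vertexSymbol_lower (a f : Fin 3 → Fin (N + 1)) :
    conj (M.F (M.dual (a 1)) (M.dual (f 2)) (f 0) (f 1) (M.dual (a 2)) (M.dual (a 0))) =
      M.vertexSymbol a f * (M.v (f 0) * M.v (a 0)) := by
  have h1 := M.v_ne_zero (f 0)
  have h2 := M.v_ne_zero (a 0)
  rw [← M.unitary, M.vertexSymbol_eq a f 2, M.dual_dual, M.dual_dual, M.dual_dual, M.dual_dual,
    M.tetrahedral₂, M.dual_dual]
  change _ = M.F (a 2) (M.dual (f 1)) (f 0) (f 2) (a 1) (a 0) / (M.v (f 0) * M.v (a 0)) * _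
  rw [div_mul_cancel₀ _ (mul_ne_zero h1 h2)]

-- After a rotation, `x` is the last index of F and `R` the one in which its columns are
-- orthonormal; the factors `v` in the symbol turn unitarity into this weighted form.
open scoped Classical in
theorem sum_vertexSymbol (y z R R' T L : Fin (N + 1)) (hz : M.Separates z R T)
    (hy : M.Separates y L R) :
    ∑ x, (M.d x : ℂ) * (conj (M.vertexSymbol ![x, y, z] ![R, T, L]) *
      M.vertexSymbol ![x, y, z] ![R', T, L]) = if R = R' then 1 / (M.d R : ℂ) else 0 := by
  have e2 : ∀ x Q, M.vertexSymbol ![x, y, z] ![Q, T, L] =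
      M.F z (M.dual T) Q L y x / (M.v Q * M.v x) := fun x Q => M.vertexSymbol_eq _ _ 2
  have hterm : ∀ x, (M.d x : ℂ) * (conj (M.vertexSymbol ![x, y, z] ![R, T, L]) *
      M.vertexSymbol ![x, y, z] ![R', T, L]) =
      (conj (M.v R) * M.v R')⁻¹ * (conj (M.F z (M.dual T) R L y x) * M.F z (M.dual T) R' L y x) := by
    intro x
    have hx := M.v_ne_zero x
    have hx' : conj (M.v x) ≠ 0 := by simpa using hx
    rw [e2, e2, ← M.conj_v_mul_v, map_div₀, map_mul, div_eq_mul_inv, div_eq_mul_inv, mul_inv,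
      mul_inv, mul_inv]
    calc _ = (conj (M.v x) * (conj (M.v x))⁻¹) * (M.v x * (M.v x)⁻¹) * ((conj (M.v R))⁻¹ *
        (M.v R')⁻¹ * (conj (M.F z (M.dual T) R L y x) * M.F z (M.dual T) R' L y x)) := by ring
      _ = _ := by rw [mul_inv_cancel₀ hx, mul_inv_cancel₀ hx']; ring
  rw [Finset.sum_congr rfl fun x _ => hterm x, ← Finset.mul_sum, M.sum_conj_F_mul]
  by_cases h : R = R'
  · subst h
    have h1 : M.allowed z (M.dual T) R := by
      rw [M.allowed_comm, M.allowed_rot]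
      exact hz
    have h2 : M.allowed L y (M.dual R) := M.allowed_comm.1 hy
    rw [if_pos ⟨rfl, h1, h2⟩, if_pos rfl, M.conj_v_mul_v, mul_one, one_div]
  · rw [if_neg fun h' => h h'.1, if_neg h, mul_zero]

theorem vertexSymbol_perm (x y z R T L : Fin (N + 1)) :
    M.vertexSymbol ![x, y, z] ![R, T, L] = M.vertexSymbol ![y, z, x] ![T, L, R] :=
  M.vertexSymbol_rotate _ _

-- The three sums are one and the same identity, `sum_vertexSymbol`, in the three rotated positions.
open scoped Classical in
theorem isVertexTensor_up :
    IsVertexTensor M.d (fun x f f' => M.Separates x f' f) (fun x f f' => M.Separates x f' f)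
      M.Separates fun i j k L T R => M.vertexSymbol ![i, k, j] ![R, T, L] where
  support i j k L T R h := by
    have := M.separates_of_vertexSymbol_ne_zero h
    exact ⟨this 0, this 2, this 1⟩
  sum_i j k L T R R' hj hk := M.sum_vertexSymbol k j R R' T L hj hk
  sum_j i k L L' T R hi hk := by
    simpa only [← M.vertexSymbol_perm] using M.sum_vertexSymbol i k L L' R T hk hi
  sum_k i j L T T' R hi hj := by
    simpa only [M.vertexSymbol_perm i] using M.sum_vertexSymbol j i T T' L R hi hj

open scoped Classical in
theorem isVertexTensor_dn :
    IsVertexTensor M.d (fun x f f' => M.Separates x f' f) (fun x f f' => M.Separates x f' f)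
      M.Separates fun l m k L B R =>
        M.vertexSymbol ![M.dual k, M.dual l, M.dual m] ![B, R, L] where
  support l m k L B R h := by
    have := M.separates_of_vertexSymbol_ne_zero h
    exact ⟨M.separates_dual.1 (this 1), M.separates_dual.1 (this 2), M.separates_dual.1 (this 0)⟩
  sum_i m k L B R R' hm hk := by
    have h := M.sum_vertexSymbol (M.dual m) (M.dual k) R R' L B (M.separates_dual.2 hk)
      (M.separates_dual.2 hm)
    rw [← M.sum_dual] at h
    simpa only [M.vertexSymbol_perm (M.dual k), M.d_dual] using h
  sum_j l k L L' B R hl hk := by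
    have h := M.sum_vertexSymbol (M.dual k) (M.dual l) L L' B R (M.separates_dual.2 hl)
      (M.separates_dual.2 hk)
    rw [← M.sum_dual] at h
    simpa only [fun x z => M.vertexSymbol_perm x (M.dual k) z, M.d_dual] using h
  sum_k l m L B B' R hl hm := by
    have h := M.sum_vertexSymbol (M.dual l) (M.dual m) B B' R L (M.separates_dual.2 hm)
      (M.separates_dual.2 hl)
    rw [← M.sum_dual] at h
    simpa only [M.d_dual] using h

end LevinWen

/-! ### The ground states of the Levin–Wen models -/

theorem Edge.sideA_ne_sideB {m n : ℕ} (E : Edge m n) : E.sideA ≠ E.sideB := by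
  cases E <;> simp [sideA, sideB, Fin.ext_iff]

/-- On the counterclockwise walk around `p`, every edge of `p` is entered from at exactly one
corner, since `p` lies on only one side of it. -/
theorem prod_face_add_one {m n : ℕ} {A : Type*} [CommMonoid A] (p : Face m n) (h : Edge m n → A) :
    ∏ v : Vertex m n, ∏ e, (if v.face e = some p then h (v.edge (e + 1)) else 1) =
      ∏ E : Edge m n, if E.sideA = some p ∨ E.sideB = some p then h E else 1 := by
  have h1 : ∀ v : Vertex m n, ∏ e, (if v.face e = some p then h (v.edge (e + 1)) else 1) =
      ∏ e, if (if v.pointsIn e then (v.edge e).sideB else (v.edge e).sideA) = some p then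
        h (v.edge e) else 1 := by
    intro v
    simp only [← v.face_add_two]
    rw [← Equiv.prod_comp (Equiv.addRight (1 : Fin 3))
      fun e => if v.face (e + 2) = some p then h (v.edge e) else 1]
    refine Finset.prod_congr rfl fun e _ => ?_
    rw [Equiv.coe_addRight]
    simp only [(fin_three_add e).1]
  rw [Finset.prod_congr rfl fun v _ => h1 v, prod_halfEdge fun E b =>
    if (if b then E.sideB else E.sideA) = some p then h E else 1]
  refine Finset.prod_congr rfl fun E _ => ?_
  have := E.sideA_ne_sideB
  by_cases hA : E.sideA = some p
  · have hB : E.sideB ≠ some p := fun hB => this (hA.trans hB.symm)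
    simp [hA, hB]
  · simp [hA]

namespace LevinWen

variable {N : ℕ} (M : LevinWen N) {m n : ℕ}

/-- The amplitude of a string configuration for given loop labels. -/
noncomputable def loopState (g : Face m n → Fin (N + 1)) (X : Config (Fin (N + 1)) m n) : ℂ :=
  (∏ E, M.v (X E)) *
    ∏ v : Vertex m n, M.vertexSymbol (inward M.dual X v) fun e => (v.face e).elim 0 g

/-- The configuration before a loop is added to the plaquette `p`, when the loop labels are `g`. -/
def emptied (p : Face m n) (g : Face m n → Fin (N + 1)) (X : Config (Fin (N + 1)) m n) :
    Config (Fin (N + 1)) m n := fun E =>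
  if E.sideA = some p then E.sideB.elim 0 g
  else if E.sideB = some p then M.dual (E.sideA.elim 0 g) else X E

theorem v_inward (X : Config (Fin (N + 1)) m n) (v : Vertex m n) (e : Fin 3) :
    M.v (inward M.dual X v e) = M.v (X (v.edge e)) := by
  unfold inward
  split_ifs
  · rfl
  · exact M.v_dual _

theorem eq_emptied_iff_of_face_add_one {p : Face m n} {v : Vertex m n} {e : Fin 3}
    (h : v.face (e + 1) = some p) (g : Face m n → Fin (N + 1))
    (X X' : Config (Fin (N + 1)) m n) :
    X (v.edge e) = M.emptied p g X' (v.edge e) ↔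
      inward M.dual X v e = (v.face (e + 2)).elim 0 g := by
  have hne := (v.edge e).sideA_ne_sideB
  rw [v.face_add_two, inward, emptied]
  rw [v.face_add_one] at h
  cases hb : v.pointsIn e <;> rw [hb] at h
  all_goals simp only [if_true, if_false, Bool.false_eq_true] at h ⊢
  · have hA : (v.edge e).sideA ≠ some p := fun hA => hne (hA.trans h.symm)
    rw [if_neg hA, if_pos h]
    exact M.dual_eq_iff.symm
  · rw [if_pos h]

theorem eq_emptied_iff_of_face_add_two {p : Face m n} {v : Vertex m n} {e : Fin 3}
    (h : v.face (e + 2) = some p) (g : Face m n → Fin (N + 1))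
    (X X' : Config (Fin (N + 1)) m n) :
    X (v.edge e) = M.emptied p g X' (v.edge e) ↔
      inward M.dual X v e = M.dual ((v.face (e + 1)).elim 0 g) := by
  have hne := (v.edge e).sideA_ne_sideB
  rw [v.face_add_one, inward, emptied]
  rw [v.face_add_two] at h
  cases hb : v.pointsIn e <;> rw [hb] at h
  all_goals simp only [if_true, if_false, Bool.false_eq_true] at h ⊢
  · rw [if_pos h]
    exact M.dual_injective.eq_iff.symm
  · have hA : (v.edge e).sideA ≠ some p := fun hA => hne (hA.trans h.symm)
    rw [if_neg hA, if_pos h]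

theorem inward_emptied {p : Face m n} {v : Vertex m n} {e : Fin 3}
    (h1 : v.face (e + 1) ≠ some p) (h2 : v.face (e + 2) ≠ some p) (g : Face m n → Fin (N + 1))
    (X : Config (Fin (N + 1)) m n) :
    inward M.dual (M.emptied p g X) v e = inward M.dual X v e := by
  rw [v.face_add_one] at h1
  rw [v.face_add_two] at h2
  unfold inward emptied
  split_ifs at h1 h2 ⊢ <;> first | rfl | contradiction

theorem emptied_of_not_borders {p : Face m n} {E : Edge m n} (h : ¬ Borders p E)
    (g : Face m n → Fin (N + 1)) (X : Config (Fin (N + 1)) m n) : M.emptied p g X E = X E := by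
  rw [emptied, if_neg fun h' => h (borders_of_side (.inl h')),
    if_neg fun h' => h (borders_of_side (.inr h'))]

theorem eq_emptied_of_vertexSymbol_ne_zero {p : Face m n} {g : Face m n → Fin (N + 1)}
    (hg : g p = 0) {v : Vertex m n} {e : Fin 3} (he : v.face e = some p)
    {X : Config (Fin (N + 1)) m n}
    (h : M.vertexSymbol (inward M.dual X v) (fun e => (v.face e).elim 0 g) ≠ 0)
    (X' : Config (Fin (N + 1)) m n) :
    X (v.edge (e + 1)) = M.emptied p g X' (v.edge (e + 1)) ∧
      X (v.edge (e + 2)) = M.emptied p g X' (v.edge (e + 2)) := by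
  obtain ⟨a1, a2, a3, a4⟩ := fin_three_add e
  rw [M.vertexSymbol_of_zero (e := e) (by simp only [he, Option.elim_some, hg])] at h
  have h' := of_not_not fun h' => h (if_neg h')
  refine ⟨(M.eq_emptied_iff_of_face_add_two (by rw [a1, he]) g X X').2 ?_,
    (M.eq_emptied_iff_of_face_add_one (by rw [a4, he]) g X X').2 ?_⟩
  · rw [h'.2.1, a2]
  · rw [h'.1, a3]

/-- While `p` is empty the vertex symbol is only a normalization, and the two strings along `p`
equal the neighbouring loops up to duals. Substituting these makes the corner F of the added loop
exactly the F in the new vertex symbol, with label s* at `p`; the ratio of `v` belongs to one edge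
of `p`. -/
theorem corner_mul_vertexSymbol {p : Face m n} {g : Face m n → Fin (N + 1)}
    (hg : g p = 0) (s : Fin (N + 1)) (X : Config (Fin (N + 1)) m n) (v : Vertex m n) :
    ((∏ e : Fin 3, if v.face e = some p then
        M.F (inward M.dual (M.emptied p g X) v e) (inward M.dual (M.emptied p g X) v (e + 1))
          (inward M.dual (M.emptied p g X) v (e + 2)) (M.dual s) (inward M.dual X v (e + 2))
          (inward M.dual X v (e + 1)) else 1) *
      M.vertexSymbol (inward M.dual (M.emptied p g X) v) (fun e => (v.face e).elim 0 g)) *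
      (∏ e : Fin 3, if v.face e = some p then
        M.v (M.emptied p g X (v.edge (e + 1))) / M.v (X (v.edge (e + 1))) else 1) =
      M.vertexSymbol (inward M.dual X v)
        (fun e => (v.face e).elim 0 (Function.update g p (M.dual s))) := by
  by_cases h : ∃ e, v.face e = some p
  · obtain ⟨e, he⟩ := h
    have hne : ∀ e', e' ≠ e → v.face e' ≠ some p :=
      fun e' h' h'' => h' (v.face_injective (h''.trans he.symm))
    have n1 : v.face (e + 1) ≠ some p := hne _ (by fin_cases e <;> decide)
    have n2 : v.face (e + 2) ≠ some p := hne _ (by fin_cases e <;> decide)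
    obtain ⟨a1, a2, a3, a4⟩ := fin_three_add e
    have i0 : inward M.dual (M.emptied p g X) v e = inward M.dual X v e :=
      M.inward_emptied n1 n2 g X
    have i1 : inward M.dual (M.emptied p g X) v (e + 1) = M.dual ((v.face (e + 2)).elim 0 g) := by
      have := (M.eq_emptied_iff_of_face_add_two (v := v) (e := e + 1) (p := p)
        (by rw [a1, he]) g (M.emptied p g X) X).1 rfl
      rwa [a2] at this
    have i2 : inward M.dual (M.emptied p g X) v (e + 2) = (v.face (e + 1)).elim 0 g := by
      have := (M.eq_emptied_iff_of_face_add_one (v := v) (e := e + 2) (p := p)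
        (by rw [a4, he]) g (M.emptied p g X) X).1 rfl
      rwa [a3] at this
    rw [Finset.prod_eq_single e (fun e' _ h' => if_neg (hne e' h')) (by simp),
      Finset.prod_eq_single e (fun e' _ h' => if_neg (hne e' h')) (by simp), if_pos he, if_pos he,
      M.vertexSymbol_of_zero (e := e) (by simp only [he, Option.elim_some, hg]),
      M.vertexSymbol_eq _ _ e, elim_update_of_ne n1, elim_update_of_ne n2, he, Option.elim_some,
      Function.update_self, ← M.v_inward, ← M.v_inward, i0, i1, i2, M.v_dual]
    have h1 := M.v_ne_zero ((v.face (e + 1)).elim 0 g)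
    have h2 := M.v_ne_zero ((v.face (e + 2)).elim 0 g)
    have h3 := M.v_ne_zero (inward M.dual X v (e + 1))
    split_ifs with hs
    · field_simp
    · rw [mul_zero, zero_mul, M.F_eq_zero, zero_div]
      rintro ⟨hs', -⟩
      refine hs ⟨rfl, rfl, ?_⟩
      exact M.allowed_comm.1 (M.allowed_rot.1 (M.allowed_rot.1 hs'))
  · push Not at h
    have h1 : inward M.dual (M.emptied p g X) v = inward M.dual X v :=
      funext fun e => M.inward_emptied (h _) (h _) g X
    simp only [h, if_false, Finset.prod_const_one, one_mul, mul_one, h1, elim_update_of_ne (h _)]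

/-- An empty plaquette determines the strings around it, so only `emptied` contributes as an initial
configuration. The ratios of `v` left over at the corners replace the edge weights around `p`. -/
theorem sum_addLoop_loopState {p : Face m n} {g : Face m n → Fin (N + 1)} (hg : g p = 0)
    (s : Fin (N + 1)) (X : Config (Fin (N + 1)) m n) :
    ∑ X', M.addLoop m n p s X X' * M.loopState g X' =
      M.loopState (Function.update g p (M.dual s)) X := by
  classical
  rw [Finset.sum_eq_single (M.emptied p g X) (fun X' _ hX' => ?_) (by simp)]
  · rw [addLoop, if_pos fun E hE => (M.emptied_of_not_borders hE g X).symm, loopState, loopState,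
      ← Finset.prod_congr rfl fun v _ => M.corner_mul_vertexSymbol hg s X v,
      Finset.prod_mul_distrib, Finset.prod_mul_distrib,
      prod_face_add_one p fun E => M.v (M.emptied p g X E) / M.v (X E)]
    have h : ∏ E : Edge m n, (if E.sideA = some p ∨ E.sideB = some p then
        M.v (M.emptied p g X E) / M.v (X E) else 1) =
        (∏ E, M.v (M.emptied p g X E)) / ∏ E, M.v (X E) := by
      rw [← Finset.prod_div_distrib]
      refine Finset.prod_congr rfl fun E _ => ?_
      split_ifs with hE
      · rfl
      · push Not at hE
        rw [emptied, if_neg hE.1, if_neg hE.2, div_self (M.v_ne_zero _)]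
    have h0 : ∏ E, M.v (X E) ≠ 0 := Finset.prod_ne_zero_iff.2 fun E _ => M.v_ne_zero _
    rw [h]
    field_simp
  · obtain ⟨E, hE⟩ := Function.ne_iff.1 hX'
    by_cases hB : Borders p E
    · obtain ⟨v, e, he, hve⟩ := hB
      have : M.vertexSymbol (inward M.dual X' v) (fun e => (v.face e).elim 0 g) = 0 := by
        by_contra h
        have := M.eq_emptied_of_vertexSymbol_ne_zero hg he h X
        rcases hve with rfl | rfl
        · exact hE this.1
        · exact hE this.2
      rw [loopState, Finset.prod_eq_zero (Finset.mem_univ v) this, mul_zero, mul_zero]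
    · rw [M.emptied_of_not_borders hB] at hE
      rw [addLoop, if_neg fun h => hE (h E hB).symm, zero_mul]

theorem loopState_zero (X : Config (Fin (N + 1)) m n) :
    M.loopState (fun _ => 0) X = (Pi.single (fun _ => 0) 1 : Config (Fin (N + 1)) m n → ℂ) X := by
  classical
  have hf : ∀ v : Vertex m n, (fun e => (v.face e).elim 0 fun _ => 0) =
      fun _ => (0 : Fin (N + 1)) := fun v => by
    funext e
    cases v.face e <;> rfl
  rw [Pi.single_apply]
  unfold loopState
  simp only [hf]
  split_ifs with h
  · have h0 : ∀ v : Vertex m n, inward M.dual X v = fun _ => 0 := fun v => by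
      funext e
      simp [inward, h, M.dual_zero]
    have h1 : M.vertexSymbol (fun _ => 0) (fun _ => 0) = 1 := by
      rw [M.vertexSymbol_of_zero (e := 0) rfl, if_pos ⟨rfl, M.dual_zero.symm, M.separates_zero.2 rfl⟩,
        M.v_zero]
      simp
    simp only [h0, h1]
    simp [h, M.v_zero]
  · obtain ⟨E, hE⟩ := Function.ne_iff.1 h
    obtain ⟨v, e, rfl, hb⟩ := exists_end E true
    rw [Finset.prod_eq_zero (Finset.mem_univ v), mul_zero]
    by_contra h'
    have := M.separates_of_vertexSymbol_ne_zero h' e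
    rw [M.separates_zero, inward, if_pos hb] at this
    exact hE this

theorem plaquette_apply (p : Face m n) (X' X : Config (Fin (N + 1)) m n) :
    M.plaquette m n p X' X =
      ∑ s, M.v s ^ 2 / (M.totalDim : ℂ) * M.addLoop m n p s X' X := by
  simp only [plaquette, Matrix.sum_apply, Matrix.smul_apply, smul_eq_mul]

/-- Each factor of the product finds its plaquette empty, so `sum_addLoop_loopState` applies at
every step. -/
theorem prod_plaquette_mulVec (l : List (Face m n)) (hl : l.Nodup)
    (X : Config (Fin (N + 1)) m n) :
    ((l.map (M.plaquette m n)).prod.mulVec (Pi.single (fun _ => 0) 1)) X =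
      ∑ g : Face m n → Fin (N + 1),
        loopWeight 0 (fun x => M.v x ^ 2 / (M.totalDim : ℂ)) l g * M.loopState g X := by
  induction l generalizing X with
  | nil =>
    rw [Finset.sum_eq_single (fun _ => 0) (fun g _ hg => by rw [loopWeight_nil hg, zero_mul])
      (by simp), M.loopState_zero, List.map_nil, List.prod_nil, Matrix.one_mulVec]
    simp [loopWeight]
  | cons p l ih =>
    rw [List.nodup_cons] at hl
    rw [List.map_cons, List.prod_cons, ← Matrix.mulVec_mulVec, Matrix.mulVec, dotProduct]
    simp only [ih hl.2]
    have h1 : ∑ X', M.plaquette m n p X X' * ∑ g : Face m n → Fin (N + 1),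
        loopWeight 0 (fun x => M.v x ^ 2 / (M.totalDim : ℂ)) l g * M.loopState g X' =
        ∑ g : Face m n → Fin (N + 1), if g p = 0 then ∑ x,
          loopWeight 0 (fun x => M.v x ^ 2 / (M.totalDim : ℂ)) l g *
            (M.v x ^ 2 / (M.totalDim : ℂ) * M.loopState (Function.update g p x) X) else 0 := by
      simp only [Finset.mul_sum]
      rw [Finset.sum_comm]
      refine Finset.sum_congr rfl fun g _ => ?_
      split_ifs with hg
      -- Adding `s` gives the label s*, and the weight v_s² is the same for both.
      · rw [← M.sum_dual]
        simp only [← M.sum_addLoop_loopState hg, M.plaquette_apply, Finset.mul_sum,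
          Finset.sum_mul, M.v_dual]
        rw [Finset.sum_comm]
        refine Finset.sum_congr rfl fun s _ => Finset.sum_congr rfl fun X' _ => ?_
        ring
      · rw [loopWeight_eq_zero hl.1 hg]
        simp
    rw [h1, sum_ite_eq_sum_update]
    refine Finset.sum_congr rfl fun g _ => ?_
    rw [Function.update_idem, Function.update_eq_self, loopWeight_cons hl.1, mul_assoc]

theorem groundState_eq (X : Config (Fin (N + 1)) m n) :
    M.groundState m n X = ∑ g : Face m n → Fin (N + 1),
      (∏ p, M.v (g p) ^ 2 / (M.totalDim : ℂ)) * M.loopState g X := by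
  rw [groundState, M.prod_plaquette_mulVec _ (Finset.nodup_toList _)]
  refine Finset.sum_congr rfl fun g _ => ?_
  rw [loopWeight_of_forall_mem fun p => Finset.mem_toList.2 (Finset.mem_univ p)]

end LevinWen

/-! ### The ground state as a tensor network -/

section

variable {m n : ℕ}

theorem prod_edge {A : Type*} [CommMonoid A] (f : Edge m n → A) :
    ∏ E, f E = ((∏ r, ∏ c, f (.vert r c)) * ((∏ a, ∏ c, f (.ns a c)) * ∏ r, ∏ b, f (.ew r b))) *
      ∏ p, f (.rim p) := by
  let φ : ((Fin (m + 1) × Fin (n + 1) ⊕ (Fin (m + 2) × Fin (n + 1) ⊕ Fin (m + 1) × Fin (n + 2))) ⊕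
      RimFace m n) → Edge m n :=
    Sum.elim (Sum.elim (fun q => .vert q.1 q.2)
      (Sum.elim (fun q => .ns q.1 q.2) fun q => .ew q.1 q.2)) .rim
  have hφ : Function.Bijective φ := by
    constructor
    · rintro ((x | (x | x)) | x) ((y | (y | y)) | y) h <;>
        simp [φ, Prod.ext_iff] at h ⊢ <;> exact h
    · rintro (⟨r, c⟩ | ⟨r, c⟩ | ⟨r, c⟩ | p)
      · exact ⟨.inl (.inl (r, c)), rfl⟩
      · exact ⟨.inl (.inr (.inl (r, c))), rfl⟩
      · exact ⟨.inl (.inr (.inr (r, c))), rfl⟩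
      · exact ⟨.inr p, rfl⟩
  rw [← hφ.prod_comp]
  simp only [Fintype.prod_sum_type, Fintype.prod_prod_type, φ, Sum.elim_inl, Sum.elim_inr]

theorem prod_rimFace {A : Type*} [CommMonoid A] (f : Face m n → A) :
    ∏ p : RimFace m n, f p = ∏ a, ∏ b,
      if (a = 0 ∨ a = Fin.last _) ∨ (b = 0 ∨ b = Fin.last _) then f (a, b) else 1 := by
  rw [← Fintype.prod_prod_type' (f := fun a b =>
    if (a = 0 ∨ a = Fin.last _) ∨ (b = 0 ∨ b = Fin.last _) then f (a, b) else 1),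
    ← Finset.prod_filter]
  exact (Finset.prod_subtype _ (by simp) _).symm

/-- Every plaquette inside the patch is at the top of one cell and at the bottom of another one;
those on the boundary are so once, except for the leftmost and the rightmost plaquette. -/
theorem prod_top_bottom {A : Type*} [CommMonoid A] (f : Face m n → A) :
    ((∏ r : Fin (m + 1), ∏ c : Fin (n + 1), f (r.castSucc, c.succ)) *
      ∏ r : Fin (m + 1), ∏ c : Fin (n + 1), f (r.succ, c.castSucc)) *
      (f (Fin.last _, Fin.last _) * f (0, 0)) =
    ∏ a, ∏ b, f (a, b) *
      if (a = 0 ∨ a = Fin.last _) ∨ (b = 0 ∨ b = Fin.last _) then 1 else f (a, b) := by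
  have h1 : ∏ r : Fin (m + 1), ∏ c : Fin (n + 1), f (r.castSucc, c.succ) =
      ∏ a, ∏ b, if a = Fin.last _ ∨ b = 0 then 1 else f (a, b) := by
    rw [Fin.prod_univ_castSucc (n := m + 1)]
    simp only [true_or, if_true, Finset.prod_const_one, mul_one]
    refine Finset.prod_congr rfl fun r _ => ?_
    rw [Fin.prod_univ_succ (n := n + 1)]
    simp [Fin.castSucc_ne_last]
  have h2 : ∏ r : Fin (m + 1), ∏ c : Fin (n + 1), f (r.succ, c.castSucc) =
      ∏ a, ∏ b, if a = 0 ∨ b = Fin.last _ then 1 else f (a, b) := by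
    rw [Fin.prod_univ_succ (n := m + 1)]
    simp only [true_or, if_true, Finset.prod_const_one, one_mul]
    refine Finset.prod_congr rfl fun r _ => ?_
    rw [Fin.prod_univ_castSucc (n := n + 1)]
    simp [Fin.castSucc_ne_last]
  have h3 : ∀ q : Face m n, f q = ∏ a, ∏ b, if a = q.1 ∧ b = q.2 then f (a, b) else 1 := by
    intro q
    rw [Finset.prod_eq_single q.1 (fun a _ ha => by simp [ha]) (by simp),
      Finset.prod_eq_single q.2 (fun a _ ha => by simp [ha]) (by simp)]
    simp
  rw [h1, h2, h3 (Fin.last _, Fin.last _), h3 (0, 0)]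
  simp only [← Finset.prod_mul_distrib]
  refine Finset.prod_congr rfl fun a _ => Finset.prod_congr rfl fun b _ => ?_
  have l1 : (0 : Fin (m + 2)) ≠ Fin.last _ := by simp [Fin.ext_iff]
  have l2 : (0 : Fin (n + 2)) ≠ Fin.last _ := by simp [Fin.ext_iff]
  rcases eq_or_ne a 0 with rfl | a0 <;> rcases eq_or_ne b 0 with rfl | b0
  · simp [l1, l2]
  · rcases eq_or_ne b (Fin.last _) with rfl | b1
    · simp [l1, l2.symm]
    · simp [l1, b0, b1]
  · rcases eq_or_ne a (Fin.last _) with rfl | a1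
    · simp [l1.symm, l2]
    · simp [l2, a0, a1]
  · rcases eq_or_ne a (Fin.last _) with rfl | a1 <;> rcases eq_or_ne b (Fin.last _) with rfl | b1
    · simp [l1.symm, l2.symm]
    · simp [l1.symm, b0, b1]
    · simp [l2.symm, a0, a1]
    · simp [a0, b0, a1, b1]

/-- At a boundary vertex the two amplitudes need to agree only if the adjacent cell does not vanish;
otherwise both products are zero. -/
theorem prod_vertex_eq {t b : Vertex m n → ℂ} {y z : Fin (m + 1) → Fin (n + 1) → ℂ}
    (hup : ∀ r c, t (.up r c) = b (.up r c) * y r c)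
    (hdn : ∀ r c, t (.dn r c) = b (.dn r c) * z r c)
    (hN : ∀ c, y 0 c ≠ 0 → t (.bN c) = b (.bN c))
    (hE : ∀ r, y r (Fin.last _) ≠ 0 → t (.bE r) = b (.bE r))
    (hS : ∀ c, z (Fin.last _) c ≠ 0 → t (.bS c) = b (.bS c))
    (hW : ∀ r, z r 0 ≠ 0 → t (.bW r) = b (.bW r)) :
    ∏ v, t v = (∏ v, b v) * ∏ r, ∏ c, y r c * z r c := by
  by_cases h : ∀ r c, y r c ≠ 0 ∧ z r c ≠ 0
  · rw [prod_vertex, prod_vertex]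
    simp only [hup, hdn, fun c => hN c (h _ _).1, fun r => hE r (h _ _).1,
      fun c => hS c (h _ _).2, fun r => hW r (h _ _).2, Finset.prod_mul_distrib]
    ring
  · push Not at h
    obtain ⟨r, c, h⟩ := h
    have h0 : ∏ r, ∏ c, y r c * z r c = 0 := by
      refine Finset.prod_eq_zero (Finset.mem_univ r) (Finset.prod_eq_zero (Finset.mem_univ c) ?_)
      by_cases hy : y r c = 0
      · rw [hy, zero_mul]
      · rw [h hy, mul_zero]
    rw [h0, mul_zero]
    by_cases hy : y r c = 0
    · exact Finset.prod_eq_zero (Finset.mem_univ (.up r c)) (by rw [hup, hy, mul_zero])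
    · exact Finset.prod_eq_zero (Finset.mem_univ (.dn r c)) (by rw [hdn, h hy, mul_zero])

end

/-! ### The string-net PEPS and the isometric form of Levin–Wen ground states. -/

namespace LevinWen

variable {N : ℕ} (M : LevinWen N) {m n : ℕ}

/-- The tensor of the upper vertex of a cell. -/
noncomputable def upTensor (i j k L T R : Fin (N + 1)) : ℂ :=
  M.vertexSymbol ![i, k, j] ![R, T, L]

/-- The tensor of the lower vertex of a cell. -/
noncomputable def dnTensor (l m k L B R : Fin (N + 1)) : ℂ :=
  M.vertexSymbol ![M.dual k, M.dual l, M.dual m] ![B, R, L]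

/-- The string-net state with the symmetric vertex tensors. -/
noncomputable def symState (m n : ℕ) : Config (Fin (N + 1)) m n → ℂ :=
  cellState (fun _ _ => M.upTensor) (fun _ _ => M.dnTensor) M.v M.v

section

variable (X : Config (Fin (N + 1)) m n) (g : Face m n → Fin (N + 1))

theorem inward_eq (v : Vertex m n) : inward M.dual X v =
    ![if v.pointsIn 0 then X (v.edge 0) else M.dual (X (v.edge 0)),
      if v.pointsIn 1 then X (v.edge 1) else M.dual (X (v.edge 1)),
      if v.pointsIn 2 then X (v.edge 2) else M.dual (X (v.edge 2))] := by
  funext e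
  fin_cases e <;> rfl

theorem faceLabels_eq (v : Vertex m n) : (fun e => (v.face e).elim 0 g) =
    ![(v.face 0).elim 0 g, (v.face 1).elim 0 g, (v.face 2).elim 0 g] := by
  funext e
  fin_cases e <;> rfl

theorem vertexSymbol_up (r : Fin (m + 1)) (c : Fin (n + 1)) :
    M.vertexSymbol (inward M.dual X (.up r c)) (fun e => ((Vertex.up r c).face e).elim 0 g) =
      M.upTensor (X (.ns r.castSucc c)) (X (.ew r c.succ)) (X (.vert r c))
        (g (r.castSucc, c.castSucc)) (g (r.castSucc, c.succ)) (g (r.succ, c.succ)) := by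
  rw [inward_eq, faceLabels_eq]
  rfl

theorem vertexSymbol_dn (r : Fin (m + 1)) (c : Fin (n + 1)) :
    M.vertexSymbol (inward M.dual X (.dn r c)) (fun e => ((Vertex.dn r c).face e).elim 0 g) =
      M.dnTensor (X (.ew r c.castSucc)) (X (.ns r.succ c)) (X (.vert r c))
        (g (r.castSucc, c.castSucc)) (g (r.succ, c.castSucc)) (g (r.succ, c.succ)) := by
  rw [inward_eq, faceLabels_eq]
  rfl

end

/-- The factor `x` of the plaquette at each end of its rim edge. -/
noncomputable def rimEnd (x : Face m n → ℂ) : Edge m n → ℂ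
  | .rim p => x p
  | _ => 1

-- A boundary vertex has the empty outside as one of its plaquettes, so its symbol is the inverse of
-- the `v` of the two others. Each boundary plaquette receives this factor at both ends of its rim
-- edge.
open scoped Classical in
theorem prod_vertexSymbol (X : Config (Fin (N + 1)) m n) (g : Face m n → Fin (N + 1)) :
    ∏ v : Vertex m n, M.vertexSymbol (inward M.dual X v) (fun e => (v.face e).elim 0 g) =
      if ∀ p : RimFace m n, X (.rim p) = g p then
        (∏ p : RimFace m n, (M.v (g p))⁻¹ * (M.v (g p))⁻¹) *
        ∏ r, ∏ c, M.upTensor (X (.ns r.castSucc c)) (X (.ew r c.succ)) (X (.vert r c))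
          (g (r.castSucc, c.castSucc)) (g (r.castSucc, c.succ)) (g (r.succ, c.succ)) *
        M.dnTensor (X (.ew r c.castSucc)) (X (.ns r.succ c)) (X (.vert r c))
          (g (r.castSucc, c.castSucc)) (g (r.succ, c.castSucc)) (g (r.succ, c.succ))
      else 0 := by
  split_ifs with hX
  · have hrim : ∏ v : Vertex m n, ∏ e, rimEnd (fun p => (M.v (g p))⁻¹) (v.edge e) =
        ∏ p : RimFace m n, (M.v (g p))⁻¹ * (M.v (g p))⁻¹ := by
      rw [prod_halfEdge fun E _ => rimEnd (fun p => (M.v (g p))⁻¹) E, prod_edge]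
      simp [rimEnd]
    rw [← hrim]
    refine prod_vertex_eq (fun r c => ?_) (fun r c => ?_) (fun c hy => ?_) (fun r hy => ?_)
      (fun c hz => ?_) fun r hz => ?_
    · rw [M.vertexSymbol_up]
      simp [Fin.prod_univ_three, Vertex.edge, rimEnd]
    · rw [M.vertexSymbol_dn]
      simp [Fin.prod_univ_three, Vertex.edge, rimEnd]
    · have h := (M.isVertexTensor_up.support _ _ _ _ _ _ hy).1
      refine (M.vertexSymbol_of_zero (e := 2) rfl).trans
        ((if_pos ⟨hX _, congrArg M.dual (hX _), M.separates_dual.2 h⟩).trans ?_)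
      simp [Fin.prod_univ_three, Vertex.edge, rimEnd, Vertex.face, mul_comm]
    · have h := (M.isVertexTensor_up.support _ _ _ _ _ _ hy).2.1
      refine (M.vertexSymbol_of_zero (e := 1) rfl).trans
        ((if_pos ⟨hX _, congrArg M.dual (hX _), M.separates_dual.2 h⟩).trans ?_)
      simp [Fin.prod_univ_three, Vertex.edge, rimEnd, Vertex.face, mul_comm]
    · have h := (M.isVertexTensor_dn.support _ _ _ _ _ _ hz).2.1
      refine (M.vertexSymbol_of_zero (e := 0) rfl).trans
        ((if_pos ⟨hX _, congrArg M.dual (hX _), h⟩).trans ?_)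
      simp [Fin.prod_univ_three, Vertex.edge, rimEnd, Vertex.face, mul_comm]
    · have h := (M.isVertexTensor_dn.support _ _ _ _ _ _ hz).1
      refine (M.vertexSymbol_of_zero (e := 2) rfl).trans
        ((if_pos ⟨hX _, congrArg M.dual (hX _), h⟩).trans ?_)
      simp [Fin.prod_univ_three, Vertex.edge, rimEnd, Vertex.face, mul_comm]
  · push Not at hX
    obtain ⟨p, hp⟩ := hX
    obtain ⟨v, e, hv, hb⟩ := exists_rim_end p true
    refine Finset.prod_eq_zero (Finset.mem_univ v) ?_
    by_contra h
    have := M.separates_of_vertexSymbol_ne_zero h e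
    rw [v.face_add_one, v.face_add_two, hb, if_pos rfl, if_pos rfl, inward, hb, if_pos rfl, hv] at this
    exact hp (M.separates_zero.1 this)

/-- A boundary plaquette has v² from its own weight, v from its rim string and v⁻² from the two
boundary vertices, hence v in total; an inner one keeps v². This is what `labelWeight` prescribes.
-/
theorem groundState_eq_symState (X : Config (Fin (N + 1)) m n) :
    M.groundState m n X = (∏ _p : Face m n, (M.totalDim : ℂ)⁻¹) * M.symState m n X := by
  rw [groundState_eq, symState, cellState, Finset.mul_sum]
  refine Finset.sum_congr rfl fun g _ => ?_
  rw [loopState, M.prod_vertexSymbol]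
  split_ifs with hX
  · have h : (∏ p : Face m n, M.v (g p) ^ 2 / (M.totalDim : ℂ)) * ((∏ E, M.v (X E)) *
        ∏ p : RimFace m n, (M.v (g p))⁻¹ * (M.v (g p))⁻¹) =
        (∏ _p : Face m n, (M.totalDim : ℂ)⁻¹) * labelWeight M.v M.v X g := by
      have hr : (∏ p : RimFace m n, M.v (X (.rim p))) *
          ∏ p : RimFace m n, (M.v (g p))⁻¹ * (M.v (g p))⁻¹ =
          ∏ p : RimFace m n, (M.v (g p))⁻¹ := by
        rw [← Finset.prod_mul_distrib]
        refine Finset.prod_congr rfl fun p _ => ?_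
        rw [hX, ← mul_assoc, mul_inv_cancel₀ (M.v_ne_zero _), one_mul]
      have hf : (∏ p : Face m n, M.v (g p) ^ 2) * ∏ p : RimFace m n, (M.v (g p))⁻¹ =
          ∏ a, ∏ b, M.v (g (a, b)) *
            if (a = 0 ∨ a = Fin.last _) ∨ (b = 0 ∨ b = Fin.last _) then 1
            else M.v (g (a, b)) := by
        rw [prod_rimFace fun p => (M.v (g p))⁻¹, Fintype.prod_prod_type]
        simp only [← Finset.prod_mul_distrib]
        refine Finset.prod_congr rfl fun a _ => Finset.prod_congr rfl fun b _ => ?_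
        split_ifs
        · rw [sq, mul_assoc, mul_inv_cancel₀ (M.v_ne_zero _)]
        · rw [mul_one, sq]
      rw [labelWeight, ← hf, prod_edge, ← hr]
      simp only [div_eq_mul_inv, Finset.prod_mul_distrib]
      ring
    refine Eq.trans ?_ (mul_assoc _ _ _)
    rw [← h]
    ring
  · simp

-- Replacing F by the symmetric symbol produces v of the vertical string, which turns 1/√v into √v,
-- and v of the top or bottom plaquette. The latter give the right plaquette weights by
-- `prod_top_bottom`, thanks to the extra factors at the leftmost and the rightmost plaquette.
open scoped Classical in
theorem prod_tensor {w : Fin (N + 1) → ℂ} (hw : ∀ i, w i ^ 2 = M.v i)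
    (X : Config (Fin (N + 1)) m n) (g : Face m n → Fin (N + 1)) :
    ∏ v : Vertex m n, M.tensor w v (inward M.dual X v) (fun e => (v.face e).elim 0 g) =
      if ∀ p : RimFace m n, X (.rim p) = g p then labelWeight M.v M.v X g *
        ∏ r, ∏ c, M.upTensor (X (.ns r.castSucc c)) (X (.ew r c.succ)) (X (.vert r c))
          (g (r.castSucc, c.castSucc)) (g (r.castSucc, c.succ)) (g (r.succ, c.succ)) *
        M.dnTensor (X (.ew r c.castSucc)) (X (.ns r.succ c)) (X (.vert r c))
          (g (r.castSucc, c.castSucc)) (g (r.succ, c.castSucc)) (g (r.succ, c.succ))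
      else 0 := by
  have hw0 : ∀ i, w i ≠ 0 := fun i h => M.v_ne_zero i (by rw [← hw, h, sq, zero_mul])
  split_ifs with hX
  · let wE : Edge m n → ℂ := fun E => match E with
      | .rim _ => 1
      | E => w (X E)
    let κ : Vertex m n → ℂ := fun v => match v with
      | .up r c => M.v (g (r.castSucc, c.succ))
      | .dn r c => M.v (g (r.succ, c.castSucc))
      | .bE r => if r = Fin.last m then M.v (g (r.succ, Fin.last _)) else 1
      | .bW r => if r = 0 then M.v (g (r.castSucc, 0)) else 1
      | _ => 1
    -- Both ends of an edge other than a rim edge contribute √v, so the edge has weight `v`.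
    have hb : ∏ v : Vertex m n, (∏ e, wE (v.edge e)) * κ v = labelWeight M.v M.v X g := by
      rw [Finset.prod_mul_distrib, prod_halfEdge fun E _ => wE E, prod_edge, prod_vertex,
        labelWeight, ← prod_top_bottom fun p => M.v (g p)]
      simp [wE, κ, ← sq, hw]
    rw [← hb]
    refine prod_vertex_eq (fun r c => ?_) (fun r c => ?_) (fun c hy => ?_) (fun r hy => ?_)
      (fun c hz => ?_) fun r hz => ?_
    · rw [← M.vertexSymbol_up]
      have h1 := hw0 (X (.vert r c))
      have h2 := M.v_ne_zero (g (r.castSucc, c.succ))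
      simp only [tensor, vertexSymbol, Fin.prod_univ_three, Vertex.edge, wE, κ, inward,
        Vertex.pointsIn, Vertex.face, Matrix.cons_val, if_true, Option.elim_some, ← hw (X (.vert r c))]
      field_simp
    · rw [← M.vertexSymbol_dn]
      have h1 := hw0 (X (.vert r c))
      refine (congrArg (_ * ·) (M.vertexSymbol_lower (inward M.dual X (.dn r c))
        fun e => ((Vertex.dn r c).face e).elim 0 g)).trans ?_
      rw [M.v_inward]
      generalize M.vertexSymbol _ _ = S
      simp only [Fin.prod_univ_three, Vertex.edge, wE, κ, inward,
        Vertex.pointsIn, Vertex.face, Matrix.cons_val, Bool.false_eq_true, if_false,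
        Option.elim_some, ← hw (X (.vert r c)), M.dual_dual]
      field_simp
    · have h := M.separates_dual.2 (M.isVertexTensor_up.support _ _ _ _ _ _ hy).1
      have ha : M.allowed (inward M.dual X (.bN c) 0) (inward M.dual X (.bN c) 1)
          (inward M.dual X (.bN c) 2) := by
        simp only [inward, Vertex.edge, Vertex.pointsIn, Matrix.cons_val, hX]
        exact M.allowed_rot.1 (M.allowed_rot.1 (M.allowed_comm.1 h))
      refine (if_pos ⟨ha, (M.dual_dual _).trans (hX _), hX _⟩).trans ?_
      simp [Fin.prod_univ_three, Vertex.edge, wE, κ, inward, Vertex.pointsIn, M.dual_dual]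
    · have h := M.separates_dual.2 (M.isVertexTensor_up.support _ _ _ _ _ _ hy).2.1
      have ha : M.allowed (inward M.dual X (.bE r) 0) (inward M.dual X (.bE r) 1)
          (inward M.dual X (.bE r) 2) := by
        simp only [inward, Vertex.edge, Vertex.pointsIn, Matrix.cons_val, hX]
        exact M.allowed_comm.1 h
      refine (congrArg (_ * ·) (if_pos ⟨ha, hX _, (M.dual_dual _).trans (hX _)⟩)).trans ?_
      simp [Fin.prod_univ_three, Vertex.edge, wE, κ, inward, Vertex.pointsIn, M.dual_dual,
        Vertex.face, mul_comm]
    · have h := (M.isVertexTensor_dn.support _ _ _ _ _ _ hz).2.1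
      have ha : M.allowed (inward M.dual X (.bS c) 0) (inward M.dual X (.bS c) 1)
          (inward M.dual X (.bS c) 2) := by
        simp only [inward, Vertex.edge, Vertex.pointsIn, Matrix.cons_val, hX]
        exact M.allowed_rot.1 (M.allowed_comm.1 h)
      refine (if_pos ⟨ha, (M.dual_dual _).trans (hX _), hX _⟩).trans ?_
      simp [Fin.prod_univ_three, Vertex.edge, wE, κ, inward, Vertex.pointsIn]
    · have h := (M.isVertexTensor_dn.support _ _ _ _ _ _ hz).1
      have ha : M.allowed (inward M.dual X (.bW r) 0) (inward M.dual X (.bW r) 1)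
          (inward M.dual X (.bW r) 2) := by
        simp only [inward, Vertex.edge, Vertex.pointsIn, Matrix.cons_val, hX]
        exact M.allowed_rot.1 (M.allowed_rot.1 (M.allowed_comm.1 h))
      refine (congrArg (_ * ·) (if_pos ⟨ha, (M.dual_dual _).trans (hX _), hX _⟩)).trans ?_
      simp [Fin.prod_univ_three, Vertex.edge, wE, κ, inward, Vertex.pointsIn, Vertex.face,
        mul_comm]
  · push Not at hX
    obtain ⟨p, hp⟩ := hX
    obtain ⟨v, e, hv, hb⟩ := exists_rim_end p true
    refine Finset.prod_eq_zero (Finset.mem_univ v) ?_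
    cases v <;> fin_cases e <;> simp [Vertex.edge, Vertex.pointsIn] at hv hb
    all_goals subst hv
    · exact if_neg fun h => hp h.2.2
    · exact (congrArg (_ * ·) (if_neg fun h => hp h.2.1)).trans (mul_zero _)
    · exact if_neg fun h => hp h.2.2
    · exact (congrArg (_ * ·) (if_neg fun h => hp h.2.2)).trans (mul_zero _)

theorem loopNetwork_eq_symState {w : Fin (N + 1) → ℂ} (hw : ∀ i, w i ^ 2 = M.v i)
    (X : Config (Fin (N + 1)) m n) :
    loopNetwork M.dual 0 (M.tensor w) X = M.symState m n X :=
  Finset.sum_congr rfl fun g _ => M.prod_tensor hw X g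

theorem labelWeight_div (x : ℂ) (X : Config (Fin (N + 1)) m n) (g : Face m n → Fin (N + 1)) :
    labelWeight M.v (fun s => M.v s / x) X g = (∏ _p : Face m n, x⁻¹) * labelWeight M.v M.v X g := by
  simp only [labelWeight, div_eq_mul_inv, Finset.prod_mul_distrib, Fintype.prod_prod_type]
  ring

theorem isIsoTNS_groundState (m n : ℕ) :
    IsIsoTNS (Fintype.card (Fin (N + 1) × Fin (N + 1) × Fin (N + 1)))
      (double (M.groundState m n)) := by
  have hD := M.totalDim_pos
  have hs : ((Real.sqrt M.totalDim : ℝ) : ℂ) ≠ 0 := by exact_mod_cast (Real.sqrt_pos.2 hD).ne'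
  -- The weight |u|² = d/D requires one factor 1/√D per plaquette, which the constant compensates.
  refine isIsoTNS_cellState (u := fun s => M.v s / (Real.sqrt M.totalDim : ℝ)) hD M.d_pos
    M.conj_v_mul_v (fun x => ?_) M.isBalanced_swap M.isBalanced_swap M.isBalanced
    (fun _ _ => M.isVertexTensor_up) (fun _ _ => M.isVertexTensor_dn)
    ((∏ _p : Face m n, (M.totalDim : ℂ)⁻¹) * ∏ _p : Face m n, ((Real.sqrt M.totalDim : ℝ) : ℂ)) _
    fun X => ?_
  · rw [map_div₀, Complex.conj_ofReal, div_mul_div_comm, M.conj_v_mul_v]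
    norm_cast
    rw [Real.mul_self_sqrt hD.le]
  · have h1 : (∏ _p : Face m n, ((Real.sqrt M.totalDim : ℝ) : ℂ)) *
        ∏ _p : Face m n, ((Real.sqrt M.totalDim : ℝ) : ℂ)⁻¹ = 1 := by
      rw [← Finset.prod_mul_distrib]
      exact Finset.prod_eq_one fun _ _ => mul_inv_cancel₀ hs
    rw [groundState_eq_symState, mul_assoc]
    congr 1
    simp only [symState, cellState, Finset.mul_sum, labelWeight_div]
    refine Finset.sum_congr rfl fun g _ => ?_
    split_ifs
    · rw [mul_assoc (∏ _p : Face m n, _), ← mul_assoc, h1, one_mul]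
      rfl
    · rw [mul_zero]

theorem groundState_eq_loopNetwork (m n : ℕ) (w : Fin (N + 1) → ℂ) (hw : ∀ i, w i ^ 2 = M.v i) :
    ∃ c : ℂ, c ≠ 0 ∧ ∀ X, M.groundState m n X = c * loopNetwork M.dual 0 (M.tensor w) X :=
  ⟨∏ _p : Face m n, (M.totalDim : ℂ)⁻¹,
    Finset.prod_ne_zero_iff.2 fun _ _ => inv_ne_zero (by exact_mod_cast M.totalDim_pos.ne'),
    fun X => by rw [M.groundState_eq_symState, M.loopNetwork_eq_symState hw]⟩

end LevinWen

end StringNet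

open StringNet in
theorem mainTheorem1 :
    -- Levin–Wen models
    (∀ (N : ℕ) (M : LevinWen N),
      (∃ A, M.IsASymbol A) ∧
      (∃ χ : ℕ, ∀ m n : ℕ, IsIsoTNS χ (double (M.groundState m n))) ∧
      (∀ (m n : ℕ) (w : Fin (N + 1) → ℂ), (∀ i, w i ^ 2 = M.v i) →
        ∃ c : ℂ, c ≠ 0 ∧ ∀ X, M.groundState m n X = c * loopNetwork M.dual 0 (M.tensor w) X)) ∧
    -- Lin–Levin abelian models
    (∀ (G : Type) [AddCommGroup G] [Fintype G] [DecidableEq G] (L : LinLevin G),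
      ∃ χ : ℕ, ∀ m n : ℕ, IsIsoTNS χ (double (L.groundState m n))) ∧
    -- abelian string-net tensors with arbitrary phases
    (∀ (N : ℕ) (R : FusionRules N), R.IsAbelian → ∀ F, R.IsAbelianFSymbol F →
      ∃ χ : ℕ, ∀ (m n : ℕ)
        (phase : Vertex m n → (Fin 3 → Fin (N + 1)) → (Fin 3 → Fin (N + 1)) → ℂ),
        (∀ v a f, ‖phase v a f‖ = 1) →
          IsIsoTNS χ (double (loopNetwork R.dual 0 (R.abelianTensor F phase)))) := by
  exact ⟨fun N M => ⟨M.exists_isASymbol, ⟨_, M.isIsoTNS_groundState⟩, M.groundState_eq_loopNetwork⟩,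
    fun G _ _ _ L => ⟨_, L.isIsoTNS_groundState⟩,
    fun N R h F hF => ⟨_, fun m n phase hp => h.isIsoTNS hF phase hp⟩⟩
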